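/- Let $\mathcal P$ be the set of convex polytopes in $\mathbb R^d$ (nonempty convex hulls of finitely many points) with the Hausdorff metric, $\lambda$ the Lebesgue measure, $V_d=\lambda$ on $\mathcal P$, and $Q^x=Q+x$. A functional $\varphi:\mathcal P\to\mathbb R$ is *local* if it has a *local extension* $\Phi$: each $\Phi(P,\cdot)$ is a finite signed Borel measure on $\mathbb R^d$ with $\Phi(P,\mathbb R^d)=\varphi(P)$; $P\mapsto\Phi(P,A)$ is measurable for every Borel set $A$; $\Phi(P+x,A+x)=\Phi(P,A)$; and $\Phi(P,A)=\Phi(Q,A)$ whenever $A\subset U$ for an open set $U$ with $P\cap U=Q\cap U$. A functional $\psi$ on $\mathcal P$ is *homogeneous of degree $k$* if $\psi(\alpha P)=\alpha^k\psi(P)$ for all $\alpha>0$, and also for $\alpha=0$ if $k>0$; a measure-valued functional $\Psi$ is homogeneous of degree $k$ if $\Psi(\alpha P,\alpha A)=\alpha^k\Psi(P,A)$ for the same $\alpha$. Put $\varphi(\emptyset)=0$. Let $\mathcal F_j(P)$ be the set of $j$-dimensional faces of $P$ ($P$ itself included if $\dim P=j$), $\lambda_F$ the $j$-dimensional Lebesgue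 measure on $F\in\mathcal F_j(P)$, $V_j(F)$ its total mass, and $n(P,F)$ the intersection of the normal cone of $P$ at $F$ with the unit sphere. For polytopes $P_i$ with faces $F_i$, $i=1,\dots,k$, let $[F_1,\dots,F_k]$ be the volume of the parallelepiped spanned by the union of orthonormal bases of the orthogonal complements of the direction spaces of $F_1,\dots,F_k$, and let $n(P_1,\dots,P_k;F_1,\dots,F_k)=n\big(\bigcap_i P_i^{x_i},\bigcap_iF_i^{x_i}\big)$, where the $x_i$ are chosen such that the faces $F_i^{x_i}$ have a common relative interior point (for $[F_1,\dots,F_k]\ne0$ the choice does not matter; otherwise the set is irrelevant). Let $\varphi$ be a local functional on $\mathcal P$ with local extension $\Phi$. Then $\varphi=\sum_{j=0}^d\varphi^{(j)}$ and $\Phi=\sum_{j=0}^d\Phi^{(j)}$ with homogeneous functionals $\varphi^{(j)}$, $\Phi^{(j)}$ of degree $j$ such that $\Phi^{(j)}$ is a local extension of $\varphi^{(j)}$, and there are functions $f_j$ with $\Phi^{(j)}(P,\cdot)=\sum_{F\in\mathcal F_j(P)}f_j(n(P,F))\lambda_F$. For any such $\varphi^{(j)},\Phi^{(j)},f_j$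 put $$\varphi^{(j)}_{m_1,\dots,m_k}(P_1,\dots,P_k)=\sum_{F_1\in\mathcal F_{m_1}(P_1)}\cdots\sum_{F_k\in\mathcal F_{m_k}(P_k)}f_j(n(P_1,\dots,P_k;F_1,\dots,F_k))\,[F_1,\dots,F_k]\,V_{m_1}(F_1)\cdots V_{m_k}(F_k),$$ and let $\Phi^{(j)}_{m_1,\dots,m_k}(P_1,\dots,P_k;\cdot)$ be the signed measure on $(\mathbb R^d)^k$ obtained by replacing $V_{m_1}(F_1)\cdots V_{m_k}(F_k)$ with $\lambda_{F_1}\otimes\cdots\otimes\lambda_{F_k}$. Let $j\in\{0,\dots,d\}$. Then the following hold, where all integrands are integrable. 1. For $P,Q\in\mathcal P$: if $j<d$, then $$\int_{\mathbb R^d}\varphi^{(j)}(P\cap Q^x)\,\lambda(dx)=\varphi^{(j)}(P)V_d(Q)+\sum_{m=j+1}^{d-1}\varphi^{(j)}_{m,d-m+j}(P,Q)+\varphi^{(j)}(Q)V_d(P),$$ and if $j=d$, then $\int_{\mathbb R^d}\varphi^{(d)}(P\cap Q^x)\,\lambda(dx)=\varphi^{(d)}(P)V_d(Q)$. 2. For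 $k\ge2$ and $P_1,\dots,P_k\in\mathcal P$, $$\int_{(\mathbb R^d)^{k-1}}\varphi^{(j)}(P_1\cap P_2^{x_2}\cap\dots\cap P_k^{x_k})\,\lambda^{k-1}(d(x_2,\dots,x_k))=\sum_{\substack{m_1,\dots,m_k=j\\ m_1+\dots+m_k=(k-1)d+j}}^d\varphi^{(j)}_{m_1,\dots,m_k}(P_1,\dots,P_k).$$ 3. For $k\ge 2$ and $m_1,\dots,m_k\in\{j,\dots,d\}$ with $m_1+\dots+m_k=(k-1)d+j$, the functional $\varphi^{(j)}_{m_1,\dots,m_k}(P_1,\dots,P_k)$ is homogeneous of degree $m_i$ in $P_i$, $i=1,\dots,k$, and, with the other polytopes fixed, $P_i\mapsto\varphi^{(j)}_{m_1,\dots,m_k}(P_1,\dots,P_k)$ is a local functional with local extension $(P_i,A_i)\mapsto\Phi^{(j)}_{m_1,\dots,m_k}(P_1,\dots,P_k;\mathbb R^d\times\dots\times A_i\times\dots\times\mathbb R^d)$. -/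

import Mathlib

open MeasureTheory Set
open scoped Pointwise RealInnerProductSpace

noncomputable section

namespace PolytopeIntegral

/-- Euclidean space `ℝ^d`. -/
abbrev Eucl (d : ℕ) : Type := EuclideanSpace ℝ (Fin d)

/-- The class `𝒫` of convex polytopes: the nonempty compact sets that are the convex hull of
finitely many points. It carries the topology of the Hausdorff metric. -/
def Polytope (d : ℕ) : Type :=
  {K : TopologicalSpace.NonemptyCompacts (Eucl d) //
    ∃ S : Set (Eucl d), S.Finite ∧ (K : Set (Eucl d)) = convexHull ℝ S}

namespace Polytope

variable {d : ℕ}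

/-- The underlying set of points of a polytope. -/
def carrier (P : Polytope d) : Set (Eucl d) := (P.1 : Set (Eucl d))

instance : CoeOut (Polytope d) (Set (Eucl d)) := ⟨carrier⟩

/-- The topology of the Hausdorff metric. -/
instance : TopologicalSpace (Polytope d) :=
  inferInstanceAs (TopologicalSpace
    {K : TopologicalSpace.NonemptyCompacts (Eucl d) //
      ∃ S : Set (Eucl d), S.Finite ∧ (K : Set (Eucl d)) = convexHull ℝ S})

/-- The Borel σ-algebra of the Hausdorff metric. -/
instance : MeasurableSpace (Polytope d) := borel _

theorem isCompact (P : Polytope d) : IsCompact (P : Set (Eucl d)) := P.1.isCompact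

theorem nonempty (P : Polytope d) : (P : Set (Eucl d)).Nonempty := P.1.nonempty

theorem eq_convexHull (P : Polytope d) :
    ∃ S : Set (Eucl d), S.Finite ∧ (P : Set (Eucl d)) = convexHull ℝ S := P.2

/-- The polytope `α P = {α p | p ∈ P}`. -/
def dilate (α : ℝ) (P : Polytope d) : Polytope d :=
  ⟨⟨⟨α • (P : Set (Eucl d)), P.isCompact.smul α⟩, P.nonempty.smul_set⟩, by
    obtain ⟨S, hS, h⟩ := P.eq_convexHull
    exact ⟨α • S, hS.smul_set, by
      change α • (P : Set (Eucl d)) = _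
      rw [h, convexHull_smul]⟩⟩

/-- The translate `P + x`. -/
def translate (x : Eucl d) (P : Polytope d) : Polytope d :=
  ⟨⟨⟨x +ᵥ (P : Set (Eucl d)), P.isCompact.vadd x⟩, P.nonempty.vadd_set⟩, by
    obtain ⟨S, hS, h⟩ := P.eq_convexHull
    exact ⟨x +ᵥ S, hS.vadd_set, by
      change x +ᵥ (P : Set (Eucl d)) = _
      rw [h, convexHull_vadd]⟩⟩

end Polytope

/-! ### Faces -/

/-- `Face j P` is the finite set `ℱ_j(P)` of the `j`-dimensional (nonempty) faces of `P`. The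
polytope itself is a face of its own dimension. -/
def Face {d : ℕ} (j : ℕ) (P : Polytope d) : Type :=
  {F : Set (Eucl d) // F.Nonempty ∧ IsExposed ℝ (P : Set (Eucl d)) F ∧
    Module.finrank ℝ (vectorSpan ℝ F) = j}

namespace Face

variable {d j : ℕ} {P : Polytope d}

/-- The underlying set of points of a face. -/
def carrier (F : Face j P) : Set (Eucl d) := F.1

instance : CoeOut (Face j P) (Set (Eucl d)) := ⟨carrier⟩

theorem nonempty (F : Face j P) : (F : Set (Eucl d)).Nonempty := F.2.1

theorem isExposed (F : Face j P) : IsExposed ℝ (P : Set (Eucl d)) F := F.2.2.1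

theorem isCompact (F : Face j P) : IsCompact (F : Set (Eucl d)) :=
  F.isExposed.isCompact P.isCompact

theorem convex (F : Face j P) : Convex ℝ (F : Set (Eucl d)) := by
  obtain ⟨S, -, h⟩ := P.eq_convexHull
  exact F.isExposed.convex (h ▸ convex_convexHull ℝ S)

instance : Finite (Face j P) := by
  obtain ⟨S, hS, h⟩ := P.eq_convexHull
  have hfin : Finite (Set.powerset S) := hS.finite_subsets.to_subtype
  refine Finite.of_injective (β := Set.powerset S)
    (fun F => ⟨(F : Set (Eucl d)).extremePoints ℝ, ?_⟩) ?_
  · refine (F.isExposed.isExtreme.extremePoints_subset_extremePoints).trans ?_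
    rw [h]
    exact extremePoints_convexHull_subset
  · intro F G hFG
    have hFG' : (F : Set (Eucl d)).extremePoints ℝ = (G : Set (Eucl d)).extremePoints ℝ :=
      congrArg Subtype.val hFG
    have hF := closure_convexHull_extremePoints F.isCompact F.convex
    have hG := closure_convexHull_extremePoints G.isCompact G.convex
    rw [hFG', hG] at hF
    exact Subtype.ext hF.symm

instance : Fintype (Face j P) := Fintype.ofFinite _

/-- `λ_F`: the restriction to the `j`-face `F` of the `j`-dimensional Lebesgue measure in the
affine hull of `F` (the Lebesgue measure of the direction space of `F`, moved to the affine hull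
by a translation through a point of `F`). -/
def lebesgue (F : Face j P) : Measure (Eucl d) :=
  (Measure.map (fun v : vectorSpan ℝ (F : Set (Eucl d)) => (v : Eucl d) + F.nonempty.some)
    volume).restrict F

instance (F : Face j P) : IsFiniteMeasure F.lebesgue := by
  refine ⟨?_⟩
  rw [lebesgue, Measure.restrict_apply_univ, Measure.map_apply (by fun_prop)
    F.isCompact.measurableSet]
  refine Bornology.IsBounded.measure_lt_top ?_
  have hiso : Isometry
      (fun v : vectorSpan ℝ (F : Set (Eucl d)) => (v : Eucl d) + F.nonempty.some) :=
    (isometry_add_right _).comp isometry_subtype_coe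
  exact hiso.antilipschitz.isBounded_preimage F.isCompact.isBounded

/-- `V_j(F)` for a `j`-face `F`: the `j`th intrinsic volume of a `j`-dimensional polytope is its
`j`-dimensional volume `λ_F(ℝ^d)`. -/
def vol (F : Face j P) : ℝ := F.lebesgue.real univ

end Face

/-- `n(P, F)`: the intersection with the unit sphere of the normal cone of `P` at `F`, i.e. of the
set of all `u` such that every point of `F` maximizes `⟪u, ·⟫` over `P`. -/
def sphericalNormals {d : ℕ} (P F : Set (Eucl d)) : Set (Eucl d) :=
  {u | ∀ y ∈ F, ∀ z ∈ P, ⟪u, z - y⟫ ≤ 0} ∩ Metric.sphere 0 1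

/-- The mixed spherical polytope `n(P₁, …, P_k; F₁, …, F_k)`: translate all pairs `(P_i, F_i)` by
vectors `x_i` such that the translated faces meet in relative interior points, and take
`n(⋂ (P_i + x_i), ⋂ (F_i + x_i))`. For faces in general relative position the
result does not depend on the choice of the `x_i`. -/
def mixedNormals {d k : ℕ} (P F : Fin k → Set (Eucl d)) : Set (Eucl d) :=
  let x : Fin k → Eucl d :=
    Classical.epsilon fun x => (⋂ i, intrinsicInterior ℝ (x i +ᵥ F i)).Nonempty
  sphericalNormals (⋂ i, x i +ᵥ P i) (⋂ i, x i +ᵥ F i)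

/-- The determinant `[F₁, …, F_k]` of faces (in the case that the sum of the codimensions is at
most `d`): choose an orthonormal basis of the orthogonal complement of the direction space of
each `F_i`; then `[F₁, …, F_k]` is the volume of the parallelepiped spanned by the
union of these bases, that is, the square root of the Gram determinant. -/
def faceDet {d k : ℕ} (F : Fin k → Set (Eucl d)) : ℝ :=
  Real.sqrt (Matrix.gram ℝ
    (fun a : (Σ i : Fin k, Fin (Module.finrank ℝ ((vectorSpan ℝ (F i))ᗮ : Submodule ℝ (Eucl d)))) =>
      ((stdOrthonormalBasis ℝ ((vectorSpan ℝ (F a.1))ᗮ : Submodule ℝ (Eucl d)) a.2 :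
        ((vectorSpan ℝ (F a.1))ᗮ : Submodule ℝ (Eucl d))) : Eucl d))).det

/-! ### Local functionals -/

/-- `Φ` is a local extension of the functional `φ` on polytopes: a measurable kernel of finite
signed Borel measures with total mass `φ`, translation covariant and locally determined. -/
structure IsLocalExtension {d : ℕ} (φ : Polytope d → ℝ)
    (Φ : Polytope d → SignedMeasure (Eucl d)) : Prop where
  measurable : ∀ A : Set (Eucl d), MeasurableSet A → Measurable fun P => Φ P A
  total : ∀ P, φ P = Φ P univ
  covariant : ∀ (P : Polytope d) (x : Eucl d) (A : Set (Eucl d)), MeasurableSet A →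
    Φ (P.translate x) (x +ᵥ A) = Φ P A
  locallyDetermined : ∀ (P Q : Polytope d) (A U : Set (Eucl d)), MeasurableSet A → IsOpen U →
    A ⊆ U → (P : Set (Eucl d)) ∩ U = (Q : Set (Eucl d)) ∩ U → Φ P A = Φ Q A

/-- Homogeneity of degree `k`, for all `α > 0`, and also for `α = 0` if `k > 0`. -/
def IsHomogeneous {d : ℕ} (k : ℕ) (φ : Polytope d → ℝ) : Prop :=
  ∀ (α : ℝ) (P : Polytope d), 0 ≤ α → (α ≠ 0 ∨ k ≠ 0) → φ (P.dilate α) = α ^ k * φ P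

/-- Homogeneity of degree `k` of a measure-valued functional. -/
def IsHomogeneousKernel {d : ℕ} (k : ℕ) (Φ : Polytope d → SignedMeasure (Eucl d)) : Prop :=
  ∀ (α : ℝ) (P : Polytope d) (A : Set (Eucl d)), 0 ≤ α → (α ≠ 0 ∨ k ≠ 0) → MeasurableSet A →
    Φ (P.dilate α) (α • A) = α ^ k * Φ P A

/-- `φpart j` and `Φpart j` (`j = 0, …, d`) are the `j`-homogeneous parts of the local functional
`φ` and of its local extension `Φ`: `j`-homogeneous local functionals with `j`-homogeneous local
extensions that sum up to `φ` and `Φ`. (Values at indices `j > d` play no role.) -/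
structure AreHomogeneousParts {d : ℕ} (φ : Polytope d → ℝ)
    (Φ : Polytope d → SignedMeasure (Eucl d)) (φpart : ℕ → Polytope d → ℝ)
    (Φpart : ℕ → Polytope d → SignedMeasure (Eucl d)) : Prop where
  sum_functional : ∀ P, φ P = ∑ j ∈ Finset.range (d + 1), φpart j P
  sum_kernel : ∀ P, Φ P = ∑ j ∈ Finset.range (d + 1), Φpart j P
  localExtension : ∀ j ≤ d, IsLocalExtension (φpart j) (Φpart j)
  homogeneous : ∀ j ≤ d, IsHomogeneous j (φpart j)
  homogeneous_kernel : ∀ j ≤ d, IsHomogeneousKernel j (Φpart j)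

/-- `f` is the associated function of the `j`-homogeneous kernel `Φj`:
`Φj(P, ·) = ∑_{F ∈ ℱ_j(P)} f(n(P, F)) λ_F`. Only the values of `f` at the sets `n(P, F)` matter.
For `j = d` this reads `Φj(P, ·) = f(∅) λ(P ∩ ·)`, so `f` stands for the constant `f(∅)`. -/
def IsAssociatedFunction {d : ℕ} (j : ℕ) (Φj : Polytope d → SignedMeasure (Eucl d))
    (f : Set (Eucl d) → ℝ) : Prop :=
  ∀ P : Polytope d, Φj P = ∑ F : Face j P, f (sphericalNormals P F) • F.lebesgue.toSignedMeasure

/-- The value of a functional on polytopes at a set that is a polytope or empty, with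
value `0` at the empty set. -/
def evalAt {d : ℕ} (φ : Polytope d → ℝ) (S : Set (Eucl d)) : ℝ :=
  open Classical in
  if h : ∃ K : Polytope d, (K : Set (Eucl d)) = S then φ h.choose else 0

/-- The mixed measure `Φ_{m₁,…,m_k}(P₁, …, P_k; ·)` on `(ℝ^d)^k` built from the associated
function `f`. -/
def mixedMeasure {d k : ℕ} (f : Set (Eucl d) → ℝ) (m : Fin k → ℕ) (P : Fin k → Polytope d) :
    SignedMeasure (Fin k → Eucl d) :=
  ∑ F : ((i : Fin k) → Face (m i) (P i)),
    (f (mixedNormals (fun i => (P i : Set (Eucl d))) (fun i => (F i : Set (Eucl d))))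
      * faceDet (fun i => (F i : Set (Eucl d)))) •
      (Measure.pi fun i => (F i).lebesgue).toSignedMeasure

/-- The mixed functional `φ_{m₁,…,m_k}(P₁, …, P_k)` built from the associated function `f`. -/
def mixedFunctional {d k : ℕ} (f : Set (Eucl d) → ℝ) (m : Fin k → ℕ) (P : Fin k → Polytope d) :
    ℝ :=
  ∑ F : ((i : Fin k) → Face (m i) (P i)),
    f (mixedNormals (fun i => (P i : Set (Eucl d))) (fun i => (F i : Set (Eucl d))))
      * faceDet (fun i => (F i : Set (Eucl d))) * ∏ i, (F i).vol

/-- The kernel `(P_i, A) ↦ Φ_{m₁,…,m_k}(P₁, …, P_i, …, P_k; ℝ^d × ⋯ × A × ⋯ × ℝ^d)` with `A` in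
position `i`: the image of the mixed measure under the `i`th coordinate projection. -/
def mixedKernel {d k : ℕ} (f : Set (Eucl d) → ℝ) (m : Fin k → ℕ) (P : Fin k → Polytope d)
    (i : Fin k) (K : Polytope d) : SignedMeasure (Eucl d) :=
  (mixedMeasure f m (Function.update P i K)).map fun y => y i

/-- The index tuples `(m₁, …, m_k)` with `m_i ∈ {j, …, d}` and `m₁ + ⋯ + m_k = (k - 1) d + j`. -/
def mixedIndices (d k j : ℕ) : Finset (Fin k → ℕ) :=
  (Fintype.piFinset fun _ : Fin k => Finset.Icc j d).filter
    fun m => ∑ i, m i = (k - 1) * d + j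

end PolytopeIntegral

end

open PolytopeIntegral

noncomputable section

namespace PolytopeIntegral

variable {d : ℕ}

/-! ### Pointwise description of faces -/

/-! Everything is read off from feasible cones at points. A polytope agrees near `p` with `p` plus
its feasible cone, so it is the disjoint union of the relative interiors of its faces, the cone is
constant on each relative interior, and by the bipolar theorem the cone and the set n(P, F)
determine each other.

Existence of the parts and of f_j. On the relative interior of a face, covariance and local
determination make Φ(P, ·) invariant under all translations that stay inside. A Fubini argument
(`signedMeasure_mul_flatMeasure_comm`) forces it to be a multiple of λ_F, and the factor depends
only on n(P, F) (`IsLocalExtension.density_eq`). The same argument on the complement of P, which has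
infinite volume when d > 0, shows that there is no mass there. So Φ(P, ·) is a sum over all faces of
constant densities, and the j-faces give the part of degree j. By inverting a Vandermonde matrix
this part is a finite linear combination of the kernels Φ(aP, a ·), a = 1, …, d + 1. It is therefore
again a local extension, and any j-homogeneous local extension has an associated function.

Translative formula. For almost all translations the faces of the P_i meet only in general position:
the exceptional translations lie in finitely many hyperplanes or empty sets (`ae_isGeneric`). Then
each j-face of the intersection is an intersection of translated faces F_i, the tuple (F_i) is
unique, its dimensions satisfy m_1 + … + m_k = (k - 1)d + j, and the normals are the mixed normals
(`IsAssociatedFunction.evalAt_iInter`). The integral of the j-volume of such an intersection is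
[F_1, …, F_k] times the product of the face volumes. This is a linear coarea formula with the Gram
determinant as Jacobian (`lintegral_sectionMeasure`). For k = 2 the extreme indices (j, d) and (d,
j) reduce to φ times a volume.

Locality of the mixed functionals. The sum over all index tuples is an integral of Φ over
intersections. Dilating each P_i by its own factor and applying the Vandermonde weights in each
variable isolates one tuple (`IsAssociatedFunction.mixedKernel_eq`). The polytope in position i then
enters only through values of Φ at intersections, and measurability, covariance and local
determination pass through the integral. -/

/-- The cone of feasible directions of `K` at `p`. -/
def feasibleCone (K : Set (Eucl d)) (p : Eucl d) : Set (Eucl d) :=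
  {v | ∃ t : ℝ, 0 < t ∧ p + t • v ∈ K}

/-- The smallest face of `K` containing `p`. -/
def minFace (K : Set (Eucl d)) (p : Eucl d) : Set (Eucl d) :=
  {x ∈ K | ∃ t : ℝ, 0 < t ∧ p + t • (p - x) ∈ K}

theorem exists_pos_forall_le {ι : Type*} [Finite ι] (f : ι → ℝ) (hf : ∀ i, 0 < f i) :
    ∃ r : ℝ, 0 < r ∧ ∀ i, r ≤ f i := by
  cases isEmpty_or_nonempty ι
  · exact ⟨1, one_pos, fun i => isEmptyElim i⟩
  · obtain ⟨i, hi⟩ := Finite.exists_min f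
    exact ⟨f i, hf i, hi⟩

theorem add_smul_mem_of_le {K : Set (Eucl d)} (hK : Convex ℝ K) {p v : Eucl d} (hp : p ∈ K)
    {s t : ℝ} (hs : 0 ≤ s) (hst : s ≤ t) (h : p + t • v ∈ K) : p + s • v ∈ K := by
  rcases hs.eq_or_lt with rfl | hs'
  · simpa using hp
  have ht : 0 < t := hs'.trans_le hst
  have := hK.add_smul_mem hp h (t := s / t) ⟨by positivity, by rw [div_le_one ht]; exact hst⟩
  rwa [smul_smul, div_mul_cancel₀ _ ht.ne'] at this

theorem mem_minFace_self {K : Set (Eucl d)} {p : Eucl d} (hp : p ∈ K) : p ∈ minFace K p :=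
  ⟨hp, 1, one_pos, by simpa using hp⟩

theorem sub_mem_feasibleCone {K : Set (Eucl d)} {p x : Eucl d} (hx : x ∈ K) :
    x - p ∈ feasibleCone K p := ⟨1, one_pos, by simpa using hx⟩

theorem zero_mem_feasibleCone {K : Set (Eucl d)} {p : Eucl d} (hp : p ∈ K) :
    0 ∈ feasibleCone K p := ⟨1, one_pos, by simpa using hp⟩

theorem smul_mem_feasibleCone {K : Set (Eucl d)} {p : Eucl d} (hp : p ∈ K) {a : ℝ}
    (ha : 0 ≤ a) {v : Eucl d} (hv : v ∈ feasibleCone K p) : a • v ∈ feasibleCone K p := by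
  rcases ha.eq_or_lt with rfl | ha'
  · simpa using zero_mem_feasibleCone hp
  obtain ⟨t, ht, h⟩ := hv
  refine ⟨t / a, by positivity, ?_⟩
  rwa [smul_smul, div_mul_cancel₀ _ ha'.ne']

theorem add_mem_feasibleCone {K : Set (Eucl d)} (hK : Convex ℝ K) {p : Eucl d} (hp : p ∈ K)
    {v w : Eucl d} (hv : v ∈ feasibleCone K p) (hw : w ∈ feasibleCone K p) :
    v + w ∈ feasibleCone K p := by
  obtain ⟨s, hs, h⟩ := hv
  obtain ⟨t, ht, h'⟩ := hw
  have hm : 0 < min s t := lt_min hs ht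
  have h1 := add_smul_mem_of_le hK hp hm.le (min_le_left s t) h
  have h2 := add_smul_mem_of_le hK hp hm.le (min_le_right s t) h'
  refine ⟨min s t / 2, by positivity, ?_⟩
  have := hK h1 h2 (a := 1/2) (b := 1/2) (by norm_num) (by norm_num) (by norm_num)
  convert this using 1
  module

theorem sum_mem_feasibleCone {K : Set (Eucl d)} (hK : Convex ℝ K) {p : Eucl d} (hp : p ∈ K)
    {ι : Type*} (s : Finset ι) (f : ι → Eucl d) (h : ∀ i ∈ s, f i ∈ feasibleCone K p) :
    ∑ i ∈ s, f i ∈ feasibleCone K p := by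
  classical
  induction s using Finset.induction_on with
  | empty => simpa using zero_mem_feasibleCone hp
  | insert a s ha ih =>
    rw [Finset.sum_insert ha]
    exact add_mem_feasibleCone hK hp (h a (by simp)) (ih fun i hi => h i (by simp [hi]))

/-- The directions in which one can move from `p` both ways inside `K`. -/
def lineality {K : Set (Eucl d)} (hK : Convex ℝ K) {p : Eucl d} (hp : p ∈ K) :
    Submodule ℝ (Eucl d) where
  carrier := {v | v ∈ feasibleCone K p ∧ -v ∈ feasibleCone K p}
  zero_mem' := ⟨zero_mem_feasibleCone hp, by simpa using zero_mem_feasibleCone hp⟩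
  add_mem' := fun ha hb => ⟨add_mem_feasibleCone hK hp ha.1 hb.1, by
    rw [neg_add]; exact add_mem_feasibleCone hK hp ha.2 hb.2⟩
  smul_mem' := fun c v hv => by
    rcases le_total 0 c with hc | hc
    · exact ⟨smul_mem_feasibleCone hp hc hv.1, by
        rw [← smul_neg]; exact smul_mem_feasibleCone hp hc hv.2⟩
    · have hc' : 0 ≤ -c := by linarith
      refine ⟨?_, ?_⟩
      · have := smul_mem_feasibleCone hp hc' hv.2
        simpa using this
      · have := smul_mem_feasibleCone hp hc' hv.1
        simpa using this

/-- Turns a linear span into a two-sided feasibility condition, so that direction spaces of faces of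
intersections and dilates can be computed from feasible cones. -/
theorem vectorSpan_minFace {K : Set (Eucl d)} (hK : Convex ℝ K) {p : Eucl d} (hp : p ∈ K) :
    vectorSpan ℝ (minFace K p) = lineality hK hp := by
  have key : ∀ x ∈ minFace K p, x - p ∈ lineality hK hp := by
    rintro x ⟨hx, t, ht, h⟩
    exact ⟨sub_mem_feasibleCone hx, t, ht, by simpa using h⟩
  apply le_antisymm
  · rw [vectorSpan_def, Submodule.span_le]
    rintro _ ⟨x, hx, y, hy, rfl⟩
    have := (lineality hK hp).sub_mem (key x hx) (key y hy)
    simpa using this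
  · rintro v ⟨⟨s, hs, h⟩, ⟨t, ht, h'⟩⟩
    have h1 : p + s • v ∈ minFace K p := by
      refine ⟨h, t / s, by positivity, ?_⟩
      convert h' using 1
      rw [sub_add_cancel_left, ← smul_neg, smul_smul, div_mul_cancel₀ _ hs.ne']
    have h2 := vsub_mem_vectorSpan ℝ h1 (mem_minFace_self hp)
    rw [vsub_eq_sub, add_sub_cancel_left] at h2
    have := (vectorSpan ℝ (minFace K p)).smul_mem s⁻¹ h2
    rwa [smul_smul, inv_mul_cancel₀ hs.ne', one_smul] at this

theorem mem_minFace_iff {K : Set (Eucl d)} (hK : Convex ℝ K) {p x : Eucl d} (hp : p ∈ K) :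
    x ∈ minFace K p ↔ x ∈ K ∧ x - p ∈ vectorSpan ℝ (minFace K p) := by
  constructor
  · intro hx
    exact ⟨hx.1, vsub_mem_vectorSpan ℝ hx (mem_minFace_self hp)⟩
  · rintro ⟨hx, h⟩
    rw [vectorSpan_minFace hK hp] at h
    obtain ⟨t, ht, h'⟩ := h.2
    exact ⟨hx, t, ht, by simpa using h'⟩

/-! ### Intrinsic interiors -/

/-- Replaces the topology of the affine span by balls in the direction space, the form in which
relative interiors are used later. -/
theorem mem_intrinsicInterior_iff {F : Set (Eucl d)} {p : Eucl d} :
    p ∈ intrinsicInterior ℝ F ↔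
      p ∈ F ∧ ∃ r : ℝ, 0 < r ∧ ∀ v ∈ vectorSpan ℝ F, ‖v‖ < r → p + v ∈ F := by
  constructor
  · intro hp
    have hpF := intrinsicInterior_subset hp
    refine ⟨hpF, ?_⟩
    obtain ⟨y, hy, rfl⟩ := mem_intrinsicInterior.1 hp
    rw [mem_interior_iff_mem_nhds, Metric.mem_nhds_iff] at hy
    obtain ⟨r, hr, hb⟩ := hy
    refine ⟨r, hr, fun v hv hvr => ?_⟩
    have hmem : v +ᵥ (y : Eucl d) ∈ affineSpan ℝ F :=
      AffineSubspace.vadd_mem_of_mem_direction (by rwa [direction_affineSpan]) y.2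
    have : (⟨v +ᵥ (y : Eucl d), hmem⟩ : affineSpan ℝ F) ∈ Metric.ball y r := by
      rw [Metric.mem_ball, Subtype.dist_eq]
      simpa using hvr
    have := hb this
    rw [add_comm]
    simpa using this
  · rintro ⟨hpF, r, hr, h⟩
    have hpa : p ∈ affineSpan ℝ F := subset_affineSpan ℝ F hpF
    refine mem_intrinsicInterior.2 ⟨⟨p, hpa⟩, ?_, rfl⟩
    rw [mem_interior_iff_mem_nhds, Metric.mem_nhds_iff]
    refine ⟨r, hr, fun y hy => ?_⟩
    rw [Metric.mem_ball, Subtype.dist_eq, dist_eq_norm] at hy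
    have hv : (y : Eucl d) - p ∈ vectorSpan ℝ F := by
      rw [← direction_affineSpan]
      exact AffineSubspace.vsub_mem_direction y.2 hpa
    have := h _ hv hy
    simpa using this

/-- The exposing functional is maximal at `p`; if `p` lies between `x` and another point of `K`, it
cannot be smaller at `x`, so `x ∈ F`. Conversely a segment from `x ∈ F` can be prolonged beyond the
relative interior point `p`. In particular a relative interior point determines its face. -/
theorem IsExposed.minFace_eq {K F : Set (Eucl d)} (hF : IsExposed ℝ K F) {p : Eucl d}
    (hp : p ∈ intrinsicInterior ℝ F) : minFace K p = F := by
  obtain ⟨hpF, r, hr, hball⟩ := mem_intrinsicInterior_iff.1 hp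
  obtain ⟨l, hl⟩ := hF ⟨p, hpF⟩
  have hpF' := hpF
  rw [hl] at hpF'
  ext x
  constructor
  · rintro ⟨hx, t, ht, h⟩
    rw [hl]
    have h1 := hpF'.2 _ h
    rw [map_add, map_smul, map_sub, smul_eq_mul] at h1
    have h2 : l p ≤ l x := by nlinarith
    exact ⟨hx, fun y hy => (hpF'.2 y hy).trans h2⟩
  · intro hx
    have hxK : x ∈ K := by rw [hl] at hx; exact hx.1
    have hv : p - x ∈ vectorSpan ℝ F := vsub_mem_vectorSpan ℝ hpF hx
    -- Small enough that `t * ‖p - x‖ < r`; the `+ 1` keeps the denominator positive when `x = p`.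
    set t := r / (2 * (‖p - x‖ + 1)) with ht
    have ht0 : 0 < t := by positivity
    refine ⟨hxK, t, ht0, hF.subset (hball _ (Submodule.smul_mem _ _ hv) ?_)⟩
    rw [norm_smul, Real.norm_of_nonneg ht0.le, ht, div_mul_eq_mul_div, div_lt_iff₀ (by positivity)]
    nlinarith [norm_nonneg (p - x)]

/-! ### Local conicity of polytopes -/

/-- The ray from `p` in a feasible direction leaves the hull at a point in the hull of some `T ⊆ S`
with all weights positive. Then `p` is not in the hull of `T`, since otherwise the ray could be
continued. Only finitely many `T` occur, so the distances from `p` to those hulls that avoid `p`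
have a positive lower bound, which serves as `r`. -/
theorem exists_forall_feasible_add_mem {S : Set (Eucl d)} (hS : S.Finite) {p : Eucl d}
    (hp : p ∈ convexHull ℝ S) :
    ∃ r : ℝ, 0 < r ∧ ∀ v ∈ feasibleCone (convexHull ℝ S) p, ‖v‖ ≤ r → p + v ∈ convexHull ℝ S := by
  classical
  lift S to Finset (Eucl d) using hS
  set K := convexHull ℝ (S : Set (Eucl d)) with hKdef
  have hKc : IsCompact K := S.finite_toSet.isCompact_convexHull (𝕜 := ℝ)
  have hKconv : Convex ℝ K := convex_convexHull ℝ _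
  have hdist : ∀ T : {T // T ∈ S.powerset}, ∃ r : ℝ, 0 < r ∧
      (p ∉ convexHull ℝ (T.1 : Set (Eucl d)) → ∀ q ∈ convexHull ℝ (T.1 : Set (Eucl d)),
        r ≤ dist p q) := by
    rintro ⟨T, hT⟩
    by_cases hpT : p ∈ convexHull ℝ (T : Set (Eucl d))
    · exact ⟨1, one_pos, fun h => absurd hpT h⟩
    have hcl : IsClosed (convexHull ℝ (T : Set (Eucl d))) :=
      (T.finite_toSet.isCompact_convexHull (𝕜 := ℝ)).isClosed
    obtain ⟨r, hr, hb⟩ := Metric.isOpen_iff.1 hcl.isOpen_compl p hpT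
    refine ⟨r, hr, fun _ q hq => ?_⟩
    by_contra! hlt
    exact hb (by rwa [Metric.mem_ball, dist_comm]) hq
  choose ρ hρ0 hρ using hdist
  obtain ⟨r, hr, hrle⟩ := exists_pos_forall_le ρ hρ0
  refine ⟨r, hr, fun v hv hvr => ?_⟩
  by_cases hv0 : v = 0
  · simpa [hv0] using hp
  have hvpos : 0 < ‖v‖ := norm_pos_iff.2 hv0
  have hcont : Continuous fun t : ℝ => p + t • v := by fun_prop
  have hI : IsCompact {t : ℝ | p + t • v ∈ K} := by
    have hanti : Topology.IsClosedEmbedding fun t : ℝ => p + t • v := by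
      have := (isClosedEmbedding_smul_left (𝕜 := ℝ) hv0)
      exact (Homeomorph.addLeft p).isClosedEmbedding.comp this
    exact hanti.isCompact_preimage hKc
  obtain ⟨t₁, ht₁, hmem₁⟩ := hv
  -- `t₀` is the exit time of the ray, and `T` below collects the generators with positive weight at
  -- the exit point.
  obtain ⟨t₀, ht₀mem, ht₀max⟩ := hI.exists_isGreatest ⟨t₁, hmem₁⟩
  have ht₀ : 0 < t₀ := ht₁.trans_le (ht₀max hmem₁)
  obtain ⟨w, hw0, hw1, hwq⟩ := (Finset.mem_convexHull' (R := ℝ)).1 ht₀mem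
  set T := S.filter fun s => 0 < w s with hT
  have hTS : T ⊆ S := Finset.filter_subset _ _
  have hwT : ∀ s ∈ S, s ∉ T → w s = 0 := by
    intro s hs hsT
    simp only [hT, Finset.mem_filter, hs, true_and, not_lt] at hsT
    exact le_antisymm hsT (hw0 s hs)
  have hw1' : ∑ s ∈ T, w s = 1 := by rw [Finset.sum_subset hTS hwT, hw1]
  have hwq' : ∑ s ∈ T, w s • s = p + t₀ • v := by
    rw [Finset.sum_subset hTS (fun s hs hsT => by rw [hwT s hs hsT, zero_smul]), hwq]
  have hqT : p + t₀ • v ∈ convexHull ℝ (T : Set (Eucl d)) :=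
    (Finset.mem_convexHull' (R := ℝ)).2
      ⟨w, fun s hs => (Finset.mem_filter.1 hs).2.le, hw1', hwq'⟩
  have hpT : p ∉ convexHull ℝ (T : Set (Eucl d)) := by
    intro hpT
    obtain ⟨m, hm0, hm1, hmp⟩ := (Finset.mem_convexHull' (R := ℝ)).1 hpT
    obtain ⟨e, he, hle⟩ := exists_pos_forall_le (fun s : {s // s ∈ T} => w s.1)
      (fun s => (Finset.mem_filter.1 s.2).2)
    have hmle : ∀ s ∈ T, m s ≤ 1 := fun s hs => hm1 ▸ Finset.single_le_sum hm0 hs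
    -- Pushing the weights `w` of the exit point away from the weights `m` of `p` yields a later
    -- point of the ray. The new weights stay nonnegative because `e ≤ w s` and `m s ≤ 1`.
    have hmem : p + (t₀ + e * t₀) • v ∈ convexHull ℝ (T : Set (Eucl d)) := by
      refine (Finset.mem_convexHull' (R := ℝ)).2 ⟨fun s => w s + e * (w s - m s), ?_, ?_, ?_⟩
      · intro s hs
        have h1 := hle ⟨s, hs⟩
        have h2 := hmle s hs
        have h3 := (Finset.mem_filter.1 hs).2
        simp only at h1
        nlinarith
      · rw [Finset.sum_add_distrib, ← Finset.mul_sum, Finset.sum_sub_distrib, hw1', hm1]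
        ring
      · simp only [add_smul, mul_smul, sub_smul]
        rw [Finset.sum_add_distrib, ← Finset.smul_sum, Finset.sum_sub_distrib, hwq', hmp]
        module
    have := ht₀max (show p + (t₀ + e * t₀) • v ∈ K from
      convexHull_mono (Finset.coe_subset.2 hTS) hmem)
    nlinarith [mul_pos he ht₀]
  have h1 := hρ ⟨T, Finset.mem_powerset.2 hTS⟩ hpT _ hqT
  have h2 := (hrle ⟨T, Finset.mem_powerset.2 hTS⟩).trans h1
  rw [dist_eq_norm, sub_add_cancel_left, norm_neg, norm_smul, Real.norm_of_nonneg ht₀.le] at h2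
  have h3 : 1 ≤ t₀ := by
    by_contra! hlt
    nlinarith
  simpa using add_smul_mem_of_le hKconv hp zero_le_one h3 ht₀mem

/-- The set is the convex hull of finitely many points. -/
def IsPolytopal (K : Set (Eucl d)) : Prop :=
  ∃ S : Set (Eucl d), S.Finite ∧ K = convexHull ℝ S

theorem Polytope.isPolytopal (P : Polytope d) : IsPolytopal (P : Set (Eucl d)) := P.2

namespace IsPolytopal

variable {K : Set (Eucl d)} {p : Eucl d}

theorem isCompact (hK : IsPolytopal K) : IsCompact K := by
  obtain ⟨S, hS, rfl⟩ := hK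
  exact hS.isCompact_convexHull (𝕜 := ℝ)

theorem convex (hK : IsPolytopal K) : Convex ℝ K := by
  obtain ⟨S, hS, rfl⟩ := hK
  exact convex_convexHull ℝ S

theorem exists_add_mem (hK : IsPolytopal K) (hp : p ∈ K) :
    ∃ r : ℝ, 0 < r ∧ ∀ v ∈ feasibleCone K p, ‖v‖ ≤ r → p + v ∈ K := by
  obtain ⟨S, hS, rfl⟩ := hK
  exact exists_forall_feasible_add_mem hS hp

/-- Rescaling `v` to norm at most `r` reduces feasibility to membership in `K`, so the cone is the
preimage of the compact set `K` under a continuous map. -/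
theorem isClosed_feasibleCone (hK : IsPolytopal K) (hp : p ∈ K) :
    IsClosed (feasibleCone K p) := by
  obtain ⟨r, hr, h⟩ := hK.exists_add_mem hp
  have hg : ∀ v : Eucl d, 0 < r / (1 + ‖v‖) := fun v => by positivity
  have : feasibleCone K p = (fun v : Eucl d => p + (r / (1 + ‖v‖)) • v) ⁻¹' K := by
    ext v
    constructor
    · intro hv
      refine h _ (smul_mem_feasibleCone hp (hg v).le hv) ?_
      rw [norm_smul, Real.norm_of_nonneg (hg v).le, div_mul_eq_mul_div, div_le_iff₀ (by positivity)]
      nlinarith [norm_nonneg v]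
    · intro hv
      exact ⟨_, hg v, hv⟩
  rw [this]
  refine hK.isCompact.isClosed.preimage ?_
  have : ∀ v : Eucl d, 1 + ‖v‖ ≠ 0 := fun v => by positivity
  fun_prop (disch := exact this _)

theorem exists_separating (hK : IsPolytopal K) (hp : p ∈ K) {v : Eucl d}
    (hv : v ∉ feasibleCone K p) :
    ∃ u : Eucl d, (∀ x ∈ feasibleCone K p, ⟪u, x⟫ ≤ 0) ∧ 0 < ⟪u, v⟫ := by
  let C : ProperCone ℝ (Eucl d) :=
    ⟨PointedCone.ofConeComb (feasibleCone K p) ⟨0, zero_mem_feasibleCone hp⟩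
      (fun x hx y hy a ha b hb => add_mem_feasibleCone hK.convex hp
        (smul_mem_feasibleCone hp ha hx) (smul_mem_feasibleCone hp hb hy)),
      hK.isClosed_feasibleCone hp⟩
  obtain ⟨y, hy, hlt⟩ := ProperCone.hyperplane_separation' C (x₀ := v) hv
  refine ⟨-y, fun x hx => ?_, ?_⟩
  · have := hy x hx
    rw [inner_neg_left, real_inner_comm]
    linarith
  · rw [inner_neg_left, real_inner_comm]
    linarith

/-- For each generator `s` with `-(s - p)` not feasible, choose a functional that is nonpositive on
the cone and negative at `s - p`. The sum `ℓ` of these is maximal over `K` at `p`. A maximizer `x`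
puts weight only on generators with `-(s - p)` feasible, hence `p - x` is feasible, which is
membership in the minimal face. -/
theorem isExposed_minFace (hK : IsPolytopal K) (hp : p ∈ K) : IsExposed ℝ K (minFace K p) := by
  classical
  intro _
  have hsep : ∀ s : Eucl d, ∃ u : Eucl d, (∀ x ∈ feasibleCone K p, ⟪u, x⟫ ≤ 0) ∧
      (-(s - p) ∉ feasibleCone K p → ⟪u, s - p⟫ < 0) := by
    intro s
    by_cases hs : -(s - p) ∈ feasibleCone K p
    · exact ⟨0, by simp, fun h => absurd hs h⟩
    · obtain ⟨u, hu, hlt⟩ := hK.exists_separating hp hs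
      rw [inner_neg_right] at hlt
      exact ⟨u, hu, fun _ => by linarith⟩
  choose u hu hu' using hsep
  obtain ⟨S, hS, hKS⟩ := id hK
  lift S to Finset (Eucl d) using hS
  set ℓ : Eucl d := ∑ s ∈ S, u s with hℓ
  have hle : ∀ x ∈ feasibleCone K p, ⟪ℓ, x⟫ ≤ 0 := by
    intro x hx
    rw [hℓ, sum_inner]
    exact Finset.sum_nonpos fun s _ => hu s x hx
  have hSK : ∀ s ∈ S, s ∈ K := fun s hs => by
    rw [hKS]; exact subset_convexHull ℝ _ hs
  have hlt : ∀ s ∈ S, ⟪ℓ, s - p⟫ = 0 → -(s - p) ∈ feasibleCone K p := by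
    intro s hs h0
    by_contra hne
    have h1 := hu' s hne
    have h2 : ⟪ℓ, s - p⟫ ≤ ⟪u s, s - p⟫ := by
      rw [hℓ, sum_inner, ← Finset.add_sum_erase _ _ hs]
      have : ∑ x ∈ S.erase s, ⟪u x, s - p⟫ ≤ 0 :=
        Finset.sum_nonpos fun x _ => hu x _ (sub_mem_feasibleCone (hSK s hs))
      linarith
    linarith
  refine ⟨innerSL ℝ ℓ, ?_⟩
  have hmax : ∀ x ∈ K, ⟪ℓ, x - p⟫ ≤ 0 := fun x hx => hle _ (sub_mem_feasibleCone hx)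
  ext x
  simp only [mem_ofPred_eq, innerSL_apply_apply]
  constructor
  · rintro ⟨hx, t, ht, h⟩
    refine ⟨hx, fun y hy => ?_⟩
    have h1 := hmax y hy
    have h2 := hle (p - x) ⟨t, ht, h⟩
    rw [inner_sub_right] at h1 h2
    linarith
  · rintro ⟨hx, hxmax⟩
    refine ⟨hx, ?_⟩
    have h0 : ⟪ℓ, x - p⟫ = 0 := by
      have h1 := hmax x hx
      have h2 := hxmax p hp
      rw [inner_sub_right] at h1 ⊢
      linarith
    have hx' := hx
    rw [hKS] at hx'
    obtain ⟨w, hw0, hw1, hwx⟩ := (Finset.mem_convexHull' (R := ℝ)).1 hx'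
    have hxp : x - p = ∑ s ∈ S, w s • (s - p) := by
      simp_rw [smul_sub]
      rw [Finset.sum_sub_distrib, hwx, ← Finset.sum_smul, hw1, one_smul]
    have hsum : ∑ s ∈ S, w s * ⟪ℓ, s - p⟫ = 0 := by
      rw [hxp, inner_sum] at h0
      simpa [inner_smul_right] using h0
    have hz := (Finset.sum_eq_zero_iff_of_nonpos (fun s hs =>
      mul_nonpos_of_nonneg_of_nonpos (hw0 s hs) (hmax s (hSK s hs)))).1 hsum
    have hpx : p - x = ∑ s ∈ S, w s • (-(s - p)) := by
      rw [← neg_sub, hxp, ← Finset.sum_neg_distrib]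
      exact Finset.sum_congr rfl fun s _ => (smul_neg _ _).symm
    change p - x ∈ feasibleCone K p
    rw [hpx]
    refine sum_mem_feasibleCone hK.convex hp _ _ fun s hs => ?_
    rcases mul_eq_zero.1 (hz s hs) with h | h
    · rw [h, zero_smul]; exact zero_mem_feasibleCone hp
    · exact smul_mem_feasibleCone hp (hw0 s hs) (hlt s hs h)

/-- By local conicity, every short vector of the direction space can be added to `p` inside `K`. -/
theorem mem_intrinsicInterior_minFace (hK : IsPolytopal K) (hp : p ∈ K) :
    p ∈ intrinsicInterior ℝ (minFace K p) := by
  obtain ⟨r, hr, h⟩ := hK.exists_add_mem hp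
  refine mem_intrinsicInterior_iff.2 ⟨mem_minFace_self hp, r, hr, fun v hv hvr => ?_⟩
  refine (mem_minFace_iff hK.convex hp).2 ⟨h v ?_ hvr.le, by simpa using hv⟩
  rw [vectorSpan_minFace hK.convex hp] at hv
  exact hv.1

end IsPolytopal

end PolytopeIntegral

end

noncomputable section

namespace PolytopeIntegral

variable {d : ℕ}

/-! ### Intersections, translates and dilates -/

theorem mem_vadd_set_iff_sub_mem {x z : Eucl d} {K : Set (Eucl d)} : z ∈ x +ᵥ K ↔ z - x ∈ K := by
  rw [mem_vadd_set_iff_neg_vadd_mem, vadd_eq_add, neg_add_eq_sub]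

theorem feasibleCone_vadd (x p : Eucl d) (K : Set (Eucl d)) :
    feasibleCone (x +ᵥ K) p = feasibleCone K (p - x) := by
  ext v
  simp only [feasibleCone, mem_ofPred_eq, mem_vadd_set_iff_sub_mem, sub_add_eq_add_sub]

theorem minFace_vadd (x p : Eucl d) (K : Set (Eucl d)) :
    minFace (x +ᵥ K) p = x +ᵥ minFace K (p - x) := by
  ext v
  simp only [minFace, mem_ofPred_eq, mem_vadd_set_iff_sub_mem, sub_add_eq_add_sub,
    sub_sub_sub_cancel_right]

theorem feasibleCone_smul {a : ℝ} (ha : 0 < a) (p : Eucl d) {K : Set (Eucl d)} :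
    feasibleCone (a • K) (a • p) = feasibleCone K p := by
  ext v
  simp only [feasibleCone, mem_ofPred_eq, mem_smul_set_iff_inv_smul_mem₀ ha.ne', smul_add,
    inv_smul_smul₀ ha.ne', smul_smul]
  constructor
  · rintro ⟨t, ht, h⟩
    exact ⟨a⁻¹ * t, by positivity, h⟩
  · rintro ⟨t, ht, h⟩
    exact ⟨a * t, by positivity, by rwa [inv_mul_cancel_left₀ ha.ne']⟩

theorem minFace_smul {a : ℝ} (ha : 0 < a) (p : Eucl d) (K : Set (Eucl d)) :
    minFace (a • K) (a • p) = a • minFace K p := by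
  ext v
  simp only [minFace, mem_ofPred_eq, mem_smul_set_iff_inv_smul_mem₀ ha.ne', smul_add, smul_sub,
    inv_smul_smul₀ ha.ne', smul_comm a⁻¹ _ _]

theorem feasibleCone_iInter {ι : Type*} [Finite ι] {K : ι → Set (Eucl d)}
    (hK : ∀ i, Convex ℝ (K i)) {p : Eucl d} (hp : ∀ i, p ∈ K i) :
    feasibleCone (⋂ i, K i) p = ⋂ i, feasibleCone (K i) p := by
  ext v
  simp only [feasibleCone, mem_iInter, mem_ofPred_eq]
  constructor
  · rintro ⟨t, ht, h⟩ i
    exact ⟨t, ht, h i⟩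
  · intro h
    choose t ht htK using h
    obtain ⟨r, hr, hle⟩ := exists_pos_forall_le t ht
    exact ⟨r, hr, fun i => add_smul_mem_of_le (hK i) (hp i) hr.le (hle i) (htK i)⟩

theorem minFace_iInter {ι : Type*} [Finite ι] {K : ι → Set (Eucl d)}
    (hK : ∀ i, Convex ℝ (K i)) {p : Eucl d} (hp : ∀ i, p ∈ K i) :
    minFace (⋂ i, K i) p = ⋂ i, minFace (K i) p := by
  ext x
  have h := feasibleCone_iInter hK hp
  rw [Set.ext_iff] at h
  have h' := h (p - x)
  simp only [feasibleCone, minFace, mem_iInter, mem_ofPred_eq] at h' ⊢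
  rw [h', forall_and]

theorem intrinsicInterior_vadd (x : Eucl d) (F : Set (Eucl d)) {p : Eucl d} :
    p ∈ intrinsicInterior ℝ (x +ᵥ F) ↔ p - x ∈ intrinsicInterior ℝ F := by
  simp only [mem_intrinsicInterior_iff, mem_vadd_set_iff_sub_mem, vectorSpan_vadd,
    sub_add_eq_add_sub]

theorem mem_minFace_comm {K : Set (Eucl d)} {p q : Eucl d} (hp : p ∈ K) (hq : q ∈ K)
    (h : minFace K p = minFace K q) : p ∈ minFace K q ∧ q ∈ minFace K p :=
  ⟨h ▸ mem_minFace_self hp, h ▸ mem_minFace_self hq⟩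

/-- The point `q` is a convex combination of `p` and `q + t • (q - p)`; replacing `p` by `p + s • v`
in it moves `q` in direction `v` within `K`. -/
theorem feasibleCone_subset_of_mem_minFace {K : Set (Eucl d)} (hK : Convex ℝ K) {p q : Eucl d}
    (h : p ∈ minFace K q) : feasibleCone K p ⊆ feasibleCone K q := by
  rintro v ⟨s, hs, hv⟩
  obtain ⟨hp, t, ht, hqt⟩ := h
  refine ⟨t / (1 + t) * s, by positivity, ?_⟩
  have := hK hv hqt (a := t / (1 + t)) (b := 1 / (1 + t)) (by positivity) (by positivity)
    (by field_simp; ring)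
  convert this using 1
  have h1 : q = (t / (1 + t)) • p + (1 / (1 + t)) • (q + t • (q - p)) := by
    rw [smul_add, smul_smul, smul_sub]
    have e1 : (1 / (1 + t)) • q + ((1 / (1 + t) * t) • q) = q := by
      rw [← add_smul]
      have : 1 / (1 + t) + 1 / (1 + t) * t = 1 := by field_simp
      rw [this, one_smul]
    have e2 : 1 / (1 + t) * t = t / (1 + t) := by ring
    rw [e2] at e1 ⊢
    calc q = (1 / (1 + t)) • q + (t / (1 + t)) • q := e1.symm
      _ = _ := by abel
  nth_rw 1 [h1]
  rw [smul_add (t / (1 + t)) p, smul_smul]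
  abel

theorem feasibleCone_eq_of_minFace_eq {K : Set (Eucl d)} (hK : Convex ℝ K) {p q : Eucl d}
    (hp : p ∈ K) (hq : q ∈ K) (h : minFace K p = minFace K q) :
    feasibleCone K p = feasibleCone K q :=
  (feasibleCone_subset_of_mem_minFace hK (mem_minFace_comm hp hq h).1).antisymm
    (feasibleCone_subset_of_mem_minFace hK (mem_minFace_comm hp hq h).2)

/-! ### Normals -/

/-- The unit vectors in the polar cone of `T`. -/
def sphericalPolar (T : Set (Eucl d)) : Set (Eucl d) :=
  {u | ∀ v ∈ T, ⟪u, v⟫ ≤ 0} ∩ Metric.sphere 0 1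

/-- Normals of a face are computed at a single point: for `y` in the face `p - y` is feasible, and
`z - y = (z - p) + (p - y)`. -/
theorem sphericalNormals_minFace {K : Set (Eucl d)} {p : Eucl d} (hp : p ∈ K) :
    sphericalNormals K (minFace K p) = sphericalPolar (feasibleCone K p) := by
  unfold sphericalNormals sphericalPolar
  congr 1
  ext u
  simp only [mem_ofPred_eq]
  constructor
  · rintro h v ⟨t, ht, hv⟩
    have := h p (mem_minFace_self hp) _ hv
    rw [add_sub_cancel_left, inner_smul_right] at this
    exact nonpos_of_mul_nonpos_right this ht
  · rintro h y ⟨hy, t, ht, hty⟩ z hz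
    have h1 := h _ (sub_mem_feasibleCone hz)
    have h2 := h (p - y) ⟨t, ht, hty⟩
    have : z - y = (z - p) + (p - y) := by abel
    rw [this, inner_add_right]
    linarith

/-- Bipolar theorem for the closed feasible cone, with the separating functional normalized to a
unit vector. -/
theorem IsPolytopal.mem_feasibleCone_iff {K : Set (Eucl d)} (hK : IsPolytopal K) {p v : Eucl d}
    (hp : p ∈ K) : v ∈ feasibleCone K p ↔ ∀ u ∈ sphericalPolar (feasibleCone K p), ⟪u, v⟫ ≤ 0 := by
  constructor
  · intro hv u hu
    exact hu.1 v hv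
  · intro h
    by_contra hv
    obtain ⟨u, hu, hlt⟩ := hK.exists_separating hp hv
    have hu0 : 0 < ‖u‖ := norm_pos_iff.2 fun h0 => by simp [h0] at hlt
    have := h (‖u‖⁻¹ • u) ⟨fun x hx => ?_, ?_⟩
    · rw [real_inner_smul_left] at this
      have h2 : 0 < ‖u‖⁻¹ * ⟪u, v⟫ := by positivity
      linarith
    · rw [real_inner_smul_left]
      exact mul_nonpos_of_nonneg_of_nonpos (by positivity) (hu x hx)
    · rw [mem_sphere_zero_iff_norm, norm_smul, norm_inv, norm_norm, inv_mul_cancel₀ hu0.ne']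

theorem IsPolytopal.feasibleCone_eq_of_sphericalPolar_eq {K K' : Set (Eucl d)}
    (hK : IsPolytopal K) (hK' : IsPolytopal K') {p p' : Eucl d} (hp : p ∈ K) (hp' : p' ∈ K')
    (h : sphericalPolar (feasibleCone K p) = sphericalPolar (feasibleCone K' p')) :
    feasibleCone K p = feasibleCone K' p' := by
  ext v
  rw [hK.mem_feasibleCone_iff hp, hK'.mem_feasibleCone_iff hp', h]

/-- Removes the arbitrary choice of translations. At a common relative interior point of the
translated faces, the cone of the intersection is the intersection of the cones, and each of these
is constant along the relative interior of its face. General position is not needed. -/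
theorem mixedNormals_eq {k : ℕ} {P : Fin k → Set (Eucl d)} (hP : ∀ i, IsPolytopal (P i))
    {p : Fin k → Eucl d} (hp : ∀ i, p i ∈ P i) :
    mixedNormals P (fun i => minFace (P i) (p i)) =
      sphericalPolar (⋂ i, feasibleCone (P i) (p i)) := by
  unfold mixedNormals
  simp only
  have hex : ∃ x : Fin k → Eucl d,
      (⋂ i, intrinsicInterior ℝ (x i +ᵥ minFace (P i) (p i))).Nonempty := by
    -- Translating each `p i` to the origin shows that an admissible choice exists.
    refine ⟨fun i => -p i, 0, mem_iInter.2 fun i => ?_⟩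
    rw [intrinsicInterior_vadd]
    simpa using (hP i).mem_intrinsicInterior_minFace (hp i)
  have hx := Classical.epsilon_spec hex
  generalize Classical.epsilon (fun x : Fin k → Eucl d =>
    (⋂ i, intrinsicInterior ℝ (x i +ᵥ minFace (P i) (p i))).Nonempty) = x at hx
  obtain ⟨z, hz⟩ := hx
  simp only [mem_iInter, intrinsicInterior_vadd] at hz
  have hzP : ∀ i, z - x i ∈ P i := fun i => (intrinsicInterior_subset (hz i)).1
  have hF : ∀ i, minFace (P i) (z - x i) = minFace (P i) (p i) := fun i =>
    IsExposed.minFace_eq ((hP i).isExposed_minFace (hp i)) (hz i)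
  have hzK : ∀ i, z ∈ x i +ᵥ P i := fun i => mem_vadd_set_iff_sub_mem.2 (hzP i)
  have hconv : ∀ i, Convex ℝ (x i +ᵥ P i) := fun i => (hP i).convex.vadd _
  have h1 : (⋂ i, x i +ᵥ minFace (P i) (p i)) = minFace (⋂ i, x i +ᵥ P i) z := by
    rw [minFace_iInter hconv hzK]
    simp only [minFace_vadd, hF]
  rw [h1, sphericalNormals_minFace (mem_iInter.2 hzK), feasibleCone_iInter hconv hzK]
  congr 1
  refine iInter_congr fun i => ?_
  rw [feasibleCone_vadd]
  exact feasibleCone_eq_of_minFace_eq (hP i).convex (hzP i) (hp i) (hF i)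

/-! ### Finiteness and intersections of polytopes -/

/-- By Krein–Milman an exposed face is determined by its extreme points, which belong to the finite
generating set. -/
theorem IsPolytopal.finite_isExposed {K : Set (Eucl d)} (hK : IsPolytopal K) :
    {F | IsExposed ℝ K F}.Finite := by
  have hc := hK.convex
  have hk := hK.isCompact
  obtain ⟨S, hS, h⟩ := hK
  refine Set.Finite.of_injOn (f := fun F : Set (Eucl d) => F.extremePoints ℝ) (t := S.powerset)
    ?_ ?_ hS.finite_subsets
  · intro F hF
    refine (IsExposed.isExtreme hF).extremePoints_subset_extremePoints.trans ?_
    rw [h]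
    exact extremePoints_convexHull_subset
  · intro F hF G hG hFG
    have hF' := closure_convexHull_extremePoints (IsExposed.isCompact hF hk) (IsExposed.convex hF hc)
    have hG' := closure_convexHull_extremePoints (IsExposed.isCompact hG hk) (IsExposed.convex hG hc)
    simp only at hFG
    rw [hFG, hG'] at hF'
    exact hF'.symm

theorem IsPolytopal.vadd {K : Set (Eucl d)} (hK : IsPolytopal K) (x : Eucl d) :
    IsPolytopal (x +ᵥ K) := by
  obtain ⟨S, hS, rfl⟩ := hK
  exact ⟨x +ᵥ S, hS.vadd_set, (convexHull_vadd x S).symm⟩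

/-- By Krein–Milman it suffices to bound the number of extreme points. The tuple of minimal faces of
the `K i` at a point determines its minimal face in the intersection, and an extreme point is the
only point of its own minimal face. -/
theorem IsPolytopal.iInter {ι : Type*} [Finite ι] [Nonempty ι] {K : ι → Set (Eucl d)}
    (hK : ∀ i, IsPolytopal (K i)) : IsPolytopal (⋂ i, K i) := by
  have hconv : Convex ℝ (⋂ i, K i) := convex_iInter fun i => (hK i).convex
  have hcomp : IsCompact (⋂ i, K i) := by
    obtain ⟨i⟩ := ‹Nonempty ι›
    exact (hK i).isCompact.of_isClosed_subset
      (isClosed_iInter fun i => (hK i).isCompact.isClosed) (iInter_subset _ i)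
  have hfin : ((⋂ i, K i).extremePoints ℝ).Finite := by
    refine Set.Finite.of_injOn (f := fun z i => minFace (K i) z)
      (t := Set.pi univ fun i => {F | IsExposed ℝ (K i) F}) ?_ ?_
      (Set.Finite.pi fun i => (hK i).finite_isExposed)
    · intro z hz i _
      exact (hK i).isExposed_minFace (mem_iInter.1 (extremePoints_subset hz) i)
    · intro z hz y hy h
      have hzK := extremePoints_subset hz
      have hyK := extremePoints_subset hy
      have h2 : minFace (⋂ i, K i) z = minFace (⋂ i, K i) y := by
        rw [minFace_iInter (fun i => (hK i).convex) (mem_iInter.1 hzK),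
          minFace_iInter (fun i => (hK i).convex) (mem_iInter.1 hyK)]
        exact iInter_congr fun i => congrFun h i
      obtain ⟨-, t, ht, h'⟩ := (mem_minFace_comm hzK hyK h2).2
      -- `z` is a proper convex combination of `y` and `z + t • (z - y)`, so extremality gives `y =
      -- z`.
      have := (mem_extremePoints.1 hz).2 y hyK _ h' ⟨t / (1 + t), 1 / (1 + t), by positivity,
        by positivity, by field_simp; ring, ?_⟩
      · exact this.1.symm
      · have e : t / (1 + t) = 1 / (1 + t) * t := by ring
        have e1 : (1 / (1 + t)) + 1 / (1 + t) * t = 1 := by field_simp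
        have : (t / (1 + t)) • y + (1 / (1 + t)) • (z + t • (z - y)) =
          ((1 / (1 + t)) + 1 / (1 + t) * t) • z := by
          rw [e]; module
        rw [this, e1, one_smul]
  refine ⟨_, hfin, ?_⟩
  have := closure_convexHull_extremePoints hcomp hconv
  rw [(hfin.isCompact_convexHull (𝕜 := ℝ)).isClosed.closure_eq] at this
  exact this.symm

/-! ### Faces through points -/

namespace Polytope

/-- The polytope with a given nonempty polytopal carrier. -/
def mk' (K : Set (Eucl d)) (hK : IsPolytopal K) (hne : K.Nonempty) : Polytope d :=
  ⟨⟨⟨K, hK.isCompact⟩, hne⟩, hK⟩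

@[simp] theorem coe_mk' (K : Set (Eucl d)) (hK : IsPolytopal K) (hne : K.Nonempty) :
    (mk' K hK hne : Set (Eucl d)) = K := rfl

@[ext] theorem ext {P Q : Polytope d} (h : (P : Set (Eucl d)) = Q) : P = Q :=
  Subtype.ext (SetLike.coe_injective h)

@[simp] theorem coe_translate (x : Eucl d) (P : Polytope d) :
    (P.translate x : Set (Eucl d)) = x +ᵥ (P : Set (Eucl d)) := rfl

@[simp] theorem coe_dilate (a : ℝ) (P : Polytope d) :
    (P.dilate a : Set (Eucl d)) = a • (P : Set (Eucl d)) := rfl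

end Polytope

namespace Face

variable {j : ℕ} {P : Polytope d}

@[ext] theorem ext {F G : Face j P} (h : (F : Set (Eucl d)) = G) : F = G := Subtype.ext h

theorem finrank_vectorSpan (F : Face j P) :
    Module.finrank ℝ (vectorSpan ℝ (F : Set (Eucl d))) = j := F.2.2.2

theorem subset (F : Face j P) : (F : Set (Eucl d)) ⊆ P := F.isExposed.subset

theorem exists_mem_intrinsicInterior (F : Face j P) :
    ∃ p, p ∈ intrinsicInterior ℝ (F : Set (Eucl d)) := F.nonempty.intrinsicInterior F.convex

theorem minFace_eq (F : Face j P) {p : Eucl d} (hp : p ∈ intrinsicInterior ℝ (F : Set (Eucl d))) :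
    minFace (P : Set (Eucl d)) p = F := IsExposed.minFace_eq F.isExposed hp

theorem le_dim (F : Face j P) : j ≤ d := by
  rw [← F.finrank_vectorSpan]
  simpa using Submodule.finrank_le (vectorSpan ℝ (F : Set (Eucl d)))

/-- The smallest face of `P` containing the point `p`. -/
def ofPoint (P : Polytope d) {p : Eucl d} (hp : p ∈ (P : Set (Eucl d)))
    (hj : Module.finrank ℝ (vectorSpan ℝ (minFace (P : Set (Eucl d)) p)) = j) : Face j P :=
  ⟨minFace P p, ⟨p, mem_minFace_self hp⟩, P.isPolytopal.isExposed_minFace hp, hj⟩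

@[simp] theorem coe_ofPoint (P : Polytope d) {p : Eucl d} (hp : p ∈ (P : Set (Eucl d)))
    (hj : Module.finrank ℝ (vectorSpan ℝ (minFace (P : Set (Eucl d)) p)) = j) :
    (ofPoint P hp hj : Set (Eucl d)) = minFace P p := rfl

end Face

/-- The stratum of `p` is the relative interior of its smallest face. -/
theorem Polytope.mem_intrinsicInterior_minFace_iff (P : Polytope d) {p q : Eucl d}
    (hp : p ∈ (P : Set (Eucl d))) :
    q ∈ intrinsicInterior ℝ (minFace (P : Set (Eucl d)) p) ↔
      q ∈ (P : Set (Eucl d)) ∧ minFace (P : Set (Eucl d)) q = minFace P p := by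
  constructor
  · intro hq
    exact ⟨(intrinsicInterior_subset hq).1,
      IsExposed.minFace_eq (P.isPolytopal.isExposed_minFace hp) hq⟩
  · rintro ⟨hq, h⟩
    rw [← h]
    exact P.isPolytopal.mem_intrinsicInterior_minFace hq

end PolytopeIntegral

end

noncomputable section

namespace PolytopeIntegral

variable {d : ℕ}

/-! ### Lebesgue measure on flats -/

/-- Lebesgue measure on the flat `L + p`. -/
def flatMeasure (L : Submodule ℝ (Eucl d)) (p : Eucl d) : Measure (Eucl d) :=
  Measure.map (fun v : L => (v : Eucl d) + p) volume

section flatMeasure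

variable (L : Submodule ℝ (Eucl d)) (p : Eucl d)

theorem flatMeasure_apply {A : Set (Eucl d)} (hA : MeasurableSet A) :
    flatMeasure L p A = volume {v : L | (v : Eucl d) + p ∈ A} :=
  Measure.map_apply (by fun_prop) hA

variable {L p}

theorem flatMeasure_eq {q : Eucl d} (h : q - p ∈ L) : flatMeasure L p = flatMeasure L q := by
  have h1 := (measurePreserving_add_right (volume : Measure L) ⟨q - p, h⟩).map_eq
  unfold flatMeasure
  nth_rw 1 [← h1]
  rw [Measure.map_map (by fun_prop) (by fun_prop)]
  congr 1
  ext1 v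
  simp [add_assoc]

theorem flatMeasure_vadd_apply (x : Eucl d) {A : Set (Eucl d)} (hA : MeasurableSet A) :
    flatMeasure L (x + p) (x +ᵥ A) = flatMeasure L p A := by
  rw [flatMeasure_apply _ _ hA, flatMeasure_apply _ _ (hA.const_vadd x)]
  congr 1
  ext v
  simp only [mem_ofPred_eq, mem_vadd_set_iff_sub_mem]
  congr! 1
  abel

theorem flatMeasure_lt_top {F : Set (Eucl d)} (hF : IsCompact F) : flatMeasure L p F < ⊤ := by
  rw [flatMeasure_apply _ _ hF.measurableSet]
  refine Bornology.IsBounded.measure_lt_top ?_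
  have hiso : Isometry (fun v : L => (v : Eucl d) + p) :=
    (isometry_add_right _).comp isometry_subtype_coe
  exact hiso.antilipschitz.isBounded_preimage hF.isBounded

theorem measurableSet_intrinsicInterior (F : Set (Eucl d)) :
    MeasurableSet (intrinsicInterior ℝ F) := by
  have h : intrinsicInterior ℝ F = intrinsicClosure ℝ F \ intrinsicFrontier ℝ F :=
    (intrinsicClosure_sdiff_intrinsicFrontier F).symm
  have hcl : IsClosed (affineSpan ℝ F : Set (Eucl d)) := AffineSubspace.closed_of_finiteDimensional _
  rw [h]
  exact (isClosed_intrinsicClosure hcl).measurableSet.diff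
    (isClosed_intrinsicFrontier hcl).measurableSet

/-- Pulled back to the direction space, the face is a convex set whose frontier is null and whose
interior points correspond to relative interior points. -/
theorem flatMeasure_sdiff_intrinsicInterior {F : Set (Eucl d)} (hF : IsCompact F)
    (hFc : Convex ℝ F) :
    flatMeasure (vectorSpan ℝ F) p (F \ intrinsicInterior ℝ F) = 0 := by
  rw [flatMeasure_apply _ _ (hF.measurableSet.diff (measurableSet_intrinsicInterior F))]
  set C : Set (vectorSpan ℝ F) := {v | (v : Eucl d) + p ∈ F} with hC
  have hconv : Convex ℝ C := by
    intro v hv w hw a b ha hb hab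
    have := hFc hv hw ha hb hab
    simp only [hC, mem_ofPred_eq, Submodule.coe_add, Submodule.coe_smul]
    convert this using 1
    have : p = a • p + b • p := by rw [← add_smul, hab, one_smul]
    nth_rw 1 [this]
    module
  refine measure_mono_null (fun v hv => ?_) (hconv.addHaar_frontier volume)
  refine ⟨subset_closure hv.1, fun hint => hv.2 ?_⟩
  rw [mem_interior_iff_mem_nhds, Metric.mem_nhds_iff] at hint
  obtain ⟨r, hr, hb⟩ := hint
  refine mem_intrinsicInterior_iff.2 ⟨hv.1, r, hr, fun w hw hwr => ?_⟩
  have : v + ⟨w, hw⟩ ∈ Metric.ball v r := by simpa using hwr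
  have := hb this
  simp only [hC, mem_ofPred_eq, Submodule.coe_add] at this
  convert this using 1
  abel

theorem flatMeasure_pos {X : Set (Eucl d)} (hX : MeasurableSet X)
    (h : ∃ r : ℝ, 0 < r ∧ ∀ v ∈ L, ‖v‖ < r → p + v ∈ X) : 0 < flatMeasure L p X := by
  obtain ⟨r, hr, h⟩ := h
  rw [flatMeasure_apply _ _ hX]
  refine (Metric.measure_ball_pos (volume : Measure L) 0 hr).trans_le (measure_mono ?_)
  intro v hv
  rw [mem_ball_zero_iff] at hv
  simp only [mem_ofPred_eq]
  rw [add_comm]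
  exact h v v.2 (by simpa using hv)

end flatMeasure

namespace Face

variable {j : ℕ} {P : Polytope d}

theorem lebesgue_eq (F : Face j P) {p : Eucl d} (hp : p ∈ (F : Set (Eucl d))) :
    F.lebesgue = (flatMeasure (vectorSpan ℝ (F : Set (Eucl d))) p).restrict F := by
  rw [flatMeasure_eq (q := F.nonempty.some) (vsub_mem_vectorSpan ℝ F.nonempty.some_mem hp)]
  rfl

/-- The relative boundary is null, so the overlapping faces may be replaced by their disjoint
relative interiors. -/
theorem lebesgue_apply (F : Face j P) {p : Eucl d} (hp : p ∈ (F : Set (Eucl d)))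
    {A : Set (Eucl d)} (hA : MeasurableSet A) :
    F.lebesgue A = flatMeasure (vectorSpan ℝ (F : Set (Eucl d))) p
      (A ∩ intrinsicInterior ℝ (F : Set (Eucl d))) := by
  rw [F.lebesgue_eq hp, Measure.restrict_apply hA]
  refine le_antisymm ?_ (measure_mono (inter_subset_inter_right _ intrinsicInterior_subset))
  have h : A ∩ (F : Set (Eucl d)) ⊆ A ∩ ((F : Set (Eucl d)) \ intrinsicInterior ℝ F) ∪
      A ∩ intrinsicInterior ℝ (F : Set (Eucl d)) := by
    rw [← inter_union_distrib_left, sdiff_union_of_subset intrinsicInterior_subset]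
  refine (measure_mono h).trans ((measure_union_le _ _).trans ?_)
  rw [measure_mono_null inter_subset_right
    (flatMeasure_sdiff_intrinsicInterior F.isCompact F.convex), zero_add]

theorem measurableSet_intrinsicInterior (F : Face j P) :
    MeasurableSet (intrinsicInterior ℝ (F : Set (Eucl d))) :=
  PolytopeIntegral.measurableSet_intrinsicInterior _

theorem vol_pos (F : Face j P) : 0 < F.vol := by
  obtain ⟨p, hp⟩ := F.exists_mem_intrinsicInterior
  have h1 : 0 < F.lebesgue univ := by
    rw [F.lebesgue_apply (intrinsicInterior_subset hp) MeasurableSet.univ, univ_inter]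
    refine flatMeasure_pos F.measurableSet_intrinsicInterior ?_
    have hF := F.minFace_eq hp
    obtain ⟨hpF, r, hr, h⟩ := mem_intrinsicInterior_iff.1 hp
    refine ⟨r / 2, by positivity, fun v hv hvr => ?_⟩
    refine mem_intrinsicInterior_iff.2 ⟨h v hv (by linarith), r / 2, by positivity,
      fun w hw hwr => ?_⟩
    rw [add_assoc]
    exact h _ (Submodule.add_mem _ hv hw) ((norm_add_le _ _).trans_lt (by linarith))
  exact ENNReal.toReal_pos h1.ne' (measure_ne_top _ _)

end Face

/-! ### Translation invariant signed measures on flats -/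

/-- Tonelli on `L × Eucl d`: for `x ∈ A` the vectors `y ∈ L` with `x + y ∈ B` have measure
`flatMeasure L p B`, because `x` lies in the flat. -/
theorem integral_measureReal_inter_shift (ν : Measure (Eucl d)) [IsFiniteMeasure ν]
    {L : Submodule ℝ (Eucl d)} {p : Eucl d} {A B : Set (Eucl d)} (hA : MeasurableSet A)
    (hB : MeasurableSet B) (hAL : ∀ x ∈ A, x - p ∈ L) (hBfin : flatMeasure L p B ≠ ⊤) :
    Integrable (fun y : L => ν.real (A ∩ {x | x + y ∈ B})) ∧
      ∫ y : L, ν.real (A ∩ {x | x + y ∈ B}) = ν.real A * (flatMeasure L p).real B := by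
  set S : Set (L × Eucl d) := {q | q.2 ∈ A ∧ q.2 + q.1 ∈ B} with hS
  have hSm : MeasurableSet S :=
    (measurable_snd hA).inter ((measurable_snd.add (measurable_subtype_coe.comp measurable_fst)) hB)
  have hmeas : Measurable fun y : L => ν (A ∩ {x | x + y ∈ B}) := measurable_measure_prodMk_left hSm
  have hl : ∫⁻ y : L, ν (A ∩ {x | x + y ∈ B}) = ν A * flatMeasure L p B := by
    have h1 := Measure.prod_apply (μ := (volume : Measure L)) (ν := ν) hSm
    rw [Measure.prod_apply_symm hSm] at h1
    change _ = ∫⁻ y : L, ν (A ∩ {x | x + y ∈ B}) at h1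
    rw [← h1, mul_comm, ← setLIntegral_const, ← lintegral_indicator hA]
    refine lintegral_congr fun x => ?_
    by_cases hx : x ∈ A
    · rw [indicator_of_mem hx, flatMeasure_eq (hAL x hx), flatMeasure_apply _ _ hB]
      congr 1
      ext y
      simp [hS, hx, add_comm]
    · rw [indicator_of_notMem hx]
      simp [hS, hx]
  have hfin : ∫⁻ y : L, ν (A ∩ {x | x + y ∈ B}) ≠ ⊤ := by
    rw [hl]; exact ENNReal.mul_ne_top (measure_ne_top _ _) hBfin
  refine ⟨integrable_toReal_of_lintegral_ne_top hmeas.aemeasurable hfin, ?_⟩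
  simp only [Measure.real]
  rw [integral_toReal hmeas.aemeasurable (ae_of_all _ fun y => measure_lt_top _ _), hl,
    ENNReal.toReal_mul]

theorem signedMeasure_apply_eq (μ : SignedMeasure (Eucl d)) {A : Set (Eucl d)}
    (hA : MeasurableSet A) :
    μ A = μ.toJordanDecomposition.posPart.real A - μ.toJordanDecomposition.negPart.real A := by
  nth_rw 1 [← μ.toSignedMeasure_toJordanDecomposition]
  rw [JordanDecomposition.toSignedMeasure, Measure.toSignedMeasure_sub_apply hA]

theorem integral_signedMeasure_inter_shift (μ : SignedMeasure (Eucl d))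
    {L : Submodule ℝ (Eucl d)} {p : Eucl d} {A B : Set (Eucl d)} (hA : MeasurableSet A)
    (hB : MeasurableSet B) (hAL : ∀ x ∈ A, x - p ∈ L) (hBfin : flatMeasure L p B ≠ ⊤) :
    ∫ y : L, μ (A ∩ {x | x + y ∈ B}) = μ A * (flatMeasure L p).real B := by
  obtain ⟨i1, e1⟩ := integral_measureReal_inter_shift μ.toJordanDecomposition.posPart hA hB hAL hBfin
  obtain ⟨i2, e2⟩ := integral_measureReal_inter_shift μ.toJordanDecomposition.negPart hA hB hAL hBfin
  have hm : ∀ y : L, MeasurableSet (A ∩ {x | x + y ∈ B}) := fun y =>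
    hA.inter ((measurable_id.add_const _) hB)
  simp_rw [fun y : L => signedMeasure_apply_eq μ (hm y)]
  rw [integral_sub i1 i2, e1, e2, signedMeasure_apply_eq μ hA]
  ring

/-- A finite signed measure on a Borel subset of a flat that is invariant under the translations
which do not lead out of this subset is proportional to Lebesgue measure. -/
theorem signedMeasure_mul_flatMeasure_comm (μ : SignedMeasure (Eucl d))
    {L : Submodule ℝ (Eucl d)} {p : Eucl d} {A B : Set (Eucl d)} (hA : MeasurableSet A)
    (hB : MeasurableSet B) (hAL : ∀ x ∈ A, x - p ∈ L) (hBL : ∀ x ∈ B, x - p ∈ L)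
    (hAfin : flatMeasure L p A ≠ ⊤) (hBfin : flatMeasure L p B ≠ ⊤)
    (hinv : ∀ X ⊆ A, MeasurableSet X → ∀ v ∈ L, v +ᵥ X ⊆ B → μ (v +ᵥ X) = μ X) :
    μ A * (flatMeasure L p).real B = μ B * (flatMeasure L p).real A := by
  -- Both sides are integrals over `L` of `μ` on sets `A ∩ (B - y)` and `B ∩ (A - y)`. After `y ↦
  -- -y` in the second, its set is the translate by `y` of the first, inside `B`, so invariance
  -- equates the integrands.
  rw [← integral_signedMeasure_inter_shift μ hA hB hAL hBfin,
    ← integral_signedMeasure_inter_shift μ hB hA hBL hAfin,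
    ← integral_neg_eq_self (fun y : L => μ (B ∩ {x | x + y ∈ A}))]
  refine integral_congr_ae (ae_of_all _ fun y => ?_)
  simp only
  have hm : MeasurableSet (A ∩ {x | x + (y : Eucl d) ∈ B}) :=
    hA.inter ((measurable_id.add_const _) hB)
  have hX : ((y : Eucl d) +ᵥ (A ∩ {x | x + (y : Eucl d) ∈ B})) =
      B ∩ {x | x + ((-y : L) : Eucl d) ∈ A} := by
    ext z
    simp only [mem_vadd_set_iff_sub_mem, mem_inter_iff, mem_ofPred_eq, sub_add_cancel,
      Submodule.coe_neg, ← sub_eq_add_neg]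
    exact and_comm
  rw [← hX]
  refine (hinv _ inter_subset_left hm y y.2 ?_).symm
  rw [hX]
  exact inter_subset_left

end PolytopeIntegral

end

noncomputable section

namespace PolytopeIntegral

variable {d : ℕ}

/-! ### Local extensions have constant densities on faces. -/

theorem flatMeasure_top (p : Eucl d) : flatMeasure ⊤ p = volume := by
  have h0 : flatMeasure (⊤ : Submodule ℝ (Eucl d)) 0 = volume := by
    have := (LinearIsometryEquiv.ofTop (Eucl d) (⊤ : Submodule ℝ (Eucl d)) rfl).measurePreserving.map_eq
    rw [← this]
    unfold flatMeasure
    congr 1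
    ext1 v
    simp
  rw [← h0]
  exact flatMeasure_eq (by simp)

theorem vectorSpan_minFace_congr {K K' : Set (Eucl d)} (hK : Convex ℝ K) (hK' : Convex ℝ K')
    {p p' : Eucl d} (hp : p ∈ K) (hp' : p' ∈ K')
    (h : feasibleCone K p = feasibleCone K' p') :
    vectorSpan ℝ (minFace K p) = vectorSpan ℝ (minFace K' p') := by
  rw [vectorSpan_minFace hK hp, vectorSpan_minFace hK' hp']
  ext v
  change (_ ∧ _) ↔ (_ ∧ _)
  rw [h]

/-- Local conicity makes equality of cones an equality of germs, which is what local determination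
can use. -/
theorem IsPolytopal.exists_inter_ball_eq {K K' : Set (Eucl d)} (hK : IsPolytopal K)
    (hK' : IsPolytopal K') {p : Eucl d} (hp : p ∈ K) (hp' : p ∈ K')
    (h : feasibleCone K p = feasibleCone K' p) :
    ∃ r : ℝ, 0 < r ∧ K ∩ Metric.ball p r = K' ∩ Metric.ball p r := by
  obtain ⟨r, hr, h1⟩ := hK.exists_add_mem hp
  obtain ⟨r', hr', h2⟩ := hK'.exists_add_mem hp'
  have hm : 0 < min r r' := lt_min hr hr'
  refine ⟨min r r', hm, ?_⟩
  ext z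
  simp only [mem_inter_iff, Metric.mem_ball, dist_eq_norm, lt_min_iff]
  constructor
  · rintro ⟨hz, hz1, hz2⟩
    have := h2 (z - p) (h ▸ sub_mem_feasibleCone hz) hz2.le
    exact ⟨by simpa using this, hz1, hz2⟩
  · rintro ⟨hz, hz1, hz2⟩
    have := h1 (z - p) (h ▸ sub_mem_feasibleCone hz) hz1.le
    exact ⟨by simpa using this, hz1, hz2⟩

namespace IsLocalExtension

variable {φ : Polytope d → ℝ} {Φ : Polytope d → SignedMeasure (Eucl d)}

/-- The union of the balls around the points of `X` is an open set on which `P` and `Q` coincide. -/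
theorem apply_congr (h : IsLocalExtension φ Φ) {P Q : Polytope d} {X : Set (Eucl d)}
    (hX : MeasurableSet X)
    (hloc : ∀ z ∈ X, ∃ r : ℝ, 0 < r ∧
      (P : Set (Eucl d)) ∩ Metric.ball z r = (Q : Set (Eucl d)) ∩ Metric.ball z r) :
    Φ P X = Φ Q X := by
  choose! r hr hPQ using hloc
  refine h.locallyDetermined P Q X (⋃ z ∈ X, Metric.ball z (r z)) hX
    (isOpen_biUnion fun _ _ => Metric.isOpen_ball)
    (fun z hz => mem_biUnion hz (Metric.mem_ball_self (hr z hz))) ?_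
  simp only [inter_iUnion₂]
  exact iUnion₂_congr hPQ

theorem apply_congr_of_feasibleCone (h : IsLocalExtension φ Φ) {P Q : Polytope d}
    {X : Set (Eucl d)} (hX : MeasurableSet X)
    (hloc : ∀ z ∈ X, z ∈ (P : Set (Eucl d)) ∧ z ∈ (Q : Set (Eucl d)) ∧
      feasibleCone (P : Set (Eucl d)) z = feasibleCone Q z) :
    Φ P X = Φ Q X :=
  h.apply_congr hX fun z hz => P.isPolytopal.exists_inter_ball_eq Q.isPolytopal
    (hloc z hz).1 (hloc z hz).2.1 (hloc z hz).2.2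

/-- Near the points of `x +ᵥ X` both `P` and its translate are absent, so after covariance the two
polytopes cannot be told apart. -/
theorem apply_vadd_of_disjoint (h : IsLocalExtension φ Φ) (P : Polytope d)
    {X : Set (Eucl d)} (hX : MeasurableSet X) (x : Eucl d)
    (h1 : X ⊆ (P : Set (Eucl d))ᶜ) (h2 : x +ᵥ X ⊆ (P : Set (Eucl d))ᶜ) :
    Φ P (x +ᵥ X) = Φ P X := by
  rw [← h.covariant P x X hX]
  refine h.apply_congr (hX.const_vadd x) fun z hz => ?_
  have hz1 : z ∈ (P : Set (Eucl d))ᶜ := h2 hz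
  have hz2 : z ∈ (P.translate x : Set (Eucl d))ᶜ := by
    rw [mem_vadd_set_iff_sub_mem] at hz
    have := h1 hz
    rwa [mem_compl_iff, Polytope.coe_translate, mem_vadd_set_iff_sub_mem]
  have hopen := P.isCompact.isClosed.isOpen_compl.inter
    (P.translate x).isCompact.isClosed.isOpen_compl
  obtain ⟨r, hr, hb⟩ := Metric.isOpen_iff.1 hopen z ⟨hz1, hz2⟩
  refine ⟨r, hr, ?_⟩
  ext y
  simp only [mem_inter_iff]
  exact ⟨fun ⟨a, b⟩ => absurd a (hb b).1, fun ⟨a, b⟩ => absurd a (hb b).2⟩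

theorem abs_signedMeasure_apply_le (μ : SignedMeasure (Eucl d)) {B : Set (Eucl d)}
    (hB : MeasurableSet B) :
    |μ B| ≤ μ.toJordanDecomposition.posPart.real univ +
      μ.toJordanDecomposition.negPart.real univ := by
  rw [signedMeasure_apply_eq μ hB, abs_le]
  have h1 := measureReal_mono (μ := μ.toJordanDecomposition.posPart) (subset_univ B)
  have h2 := measureReal_mono (μ := μ.toJordanDecomposition.negPart) (subset_univ B)
  have h3 : 0 ≤ μ.toJordanDecomposition.posPart.real B := measureReal_nonneg
  have h4 : 0 ≤ μ.toJordanDecomposition.negPart.real B := measureReal_nonneg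
  constructor <;> linarith

/-- A local extension is concentrated on the polytope. -/
theorem apply_eq_zero (h : IsLocalExtension φ Φ) (P : Polytope d)
    {X : Set (Eucl d)} (hX : MeasurableSet X) (hXP : X ⊆ (P : Set (Eucl d))ᶜ) : Φ P X = 0 := by
  cases subsingleton_or_nontrivial (Eucl d)
  -- In dimension 0 the complement of `P` is empty; the volume argument below needs a space of
  -- infinite volume.
  · obtain ⟨p, hp⟩ := P.nonempty
    have : X = ∅ := eq_empty_of_forall_notMem fun z hz => hXP hz (Subsingleton.elim p z ▸ hp)
    rw [this, VectorMeasure.empty]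
  have hPm : MeasurableSet (P : Set (Eucl d))ᶜ := P.isCompact.measurableSet.compl
  have hPtop : volume (P : Set (Eucl d))ᶜ = ⊤ := by
    have h1 : volume (univ : Set (Eucl d)) = ⊤ := measure_univ_of_isAddLeftInvariant _
    have h2 := measure_add_measure_compl (μ := (volume : Measure (Eucl d)))
      P.isCompact.measurableSet
    rw [h1, ENNReal.add_eq_top] at h2
    exact h2.resolve_left P.isCompact.measure_lt_top.ne
  have hbdd : ∀ n : ℕ, Φ P (X ∩ Metric.closedBall 0 n) = 0 := by
    intro n
    set A := X ∩ Metric.closedBall (0 : Eucl d) n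
    have hA : MeasurableSet A := hX.inter Metric.isClosed_closedBall.measurableSet
    have hAfin : volume A ≠ ⊤ := ne_top_of_le_ne_top
      (isCompact_closedBall (0 : Eucl d) n).measure_lt_top.ne (measure_mono inter_subset_right)
    by_contra hne
    set C := (Φ P).toJordanDecomposition.posPart.real univ +
      (Φ P).toJordanDecomposition.negPart.real univ with hC
    have hpos : 0 < |Φ P A| := abs_pos.2 hne
    -- Off `P` the measure is proportional to volume. If `Φ P A ≠ 0`, a set `B` off `P` of such
    -- large volume would have `|Φ P B|` above the bound `C` on the values of the signed measure.
    obtain ⟨B, hB, hBP, hBlt, hBfin⟩ := Measure.exists_subset_measure_lt_top hPm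
      (show ENNReal.ofReal (C * volume.real A / |Φ P A|) < volume (P : Set (Eucl d))ᶜ by
        rw [hPtop]; exact ENNReal.ofReal_lt_top)
    have key := signedMeasure_mul_flatMeasure_comm (Φ P) (L := ⊤) (p := 0) hA hB (by simp) (by simp)
      (by rwa [flatMeasure_top]) (by rw [flatMeasure_top]; exact hBfin.ne)
      (fun Y hYA hY v _ hv => h.apply_vadd_of_disjoint P hY v
        (hYA.trans (inter_subset_left.trans hXP)) (hv.trans hBP))
    rw [flatMeasure_top] at key
    have h1 : C * volume.real A / |Φ P A| < volume.real B :=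
      (ENNReal.ofReal_lt_iff_lt_toReal (by positivity) hBfin.ne).1 hBlt
    rw [div_lt_iff₀ hpos] at h1
    have h2 := congrArg abs key
    rw [abs_mul, abs_mul, abs_of_nonneg (measureReal_nonneg (μ := volume) (s := B)),
      abs_of_nonneg (measureReal_nonneg (μ := volume) (s := A))] at h2
    have h3 := mul_le_mul_of_nonneg_right (abs_signedMeasure_apply_le (Φ P) hB)
      (measureReal_nonneg (μ := volume) (s := A))
    rw [← hC, ← h2] at h3
    linarith
  -- A general `X` is exhausted by its bounded parts.
  have hlim := VectorMeasure.tendsto_vectorMeasure_iUnion_atTop_nat (v := Φ P)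
    (s := fun n : ℕ => X ∩ Metric.closedBall 0 n)
    (fun m n hmn => inter_subset_inter_right _
      (Metric.closedBall_subset_closedBall (by exact_mod_cast hmn)))
    (fun n => hX.inter Metric.isClosed_closedBall.measurableSet)
  rw [← inter_iUnion, Metric.iUnion_closedBall_nat, inter_univ] at hlim
  simp only [hbdd] at hlim
  exact tendsto_nhds_unique hlim tendsto_const_nhds

/-- A translation within the relative interior of `F` does not change the feasible cone. Covariance
and local determination therefore make `Φ P` translation invariant there, hence a multiple of
Lebesgue measure with the factor read off from the total mass. -/
theorem apply_inter_intrinsicInterior (h : IsLocalExtension φ Φ) {P : Polytope d} {j : ℕ}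
    (F : Face j P) {A : Set (Eucl d)} (hA : MeasurableSet A) :
    Φ P (A ∩ intrinsicInterior ℝ (F : Set (Eucl d))) =
      Φ P (intrinsicInterior ℝ (F : Set (Eucl d))) / F.vol * F.lebesgue.real A := by
  obtain ⟨p, hp⟩ := F.nonempty
  have hO := F.measurableSet_intrinsicInterior
  have hOF : intrinsicInterior ℝ (F : Set (Eucl d)) ⊆ F := intrinsicInterior_subset
  have hfin : ∀ X ⊆ intrinsicInterior ℝ (F : Set (Eucl d)),
      flatMeasure (vectorSpan ℝ (F : Set (Eucl d))) p X ≠ ⊤ := fun X hX =>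
    ne_top_of_le_ne_top (flatMeasure_lt_top F.isCompact).ne (measure_mono (hX.trans hOF))
  have key := signedMeasure_mul_flatMeasure_comm (Φ P) (L := vectorSpan ℝ (F : Set (Eucl d)))
    (p := p) (hA.inter hO) hO (fun x hx => vsub_mem_vectorSpan ℝ (hOF hx.2) hp)
    (fun x hx => vsub_mem_vectorSpan ℝ (hOF hx) hp) (hfin _ inter_subset_right)
    (hfin _ Subset.rfl) (by
      intro X hXA hX v _ hv
      rw [← h.covariant P v X hX]
      refine h.apply_congr_of_feasibleCone (hX.const_vadd v) fun z hz => ?_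
      have hz1 := hv hz
      have hz2 : z - v ∈ intrinsicInterior ℝ (F : Set (Eucl d)) :=
        (hXA (mem_vadd_set_iff_sub_mem.1 hz)).2
      have hzP : z ∈ (P : Set (Eucl d)) := F.subset (hOF hz1)
      have hzP' : z - v ∈ (P : Set (Eucl d)) := F.subset (hOF hz2)
      refine ⟨hzP, mem_vadd_set_iff_sub_mem.2 hzP', ?_⟩
      rw [Polytope.coe_translate, feasibleCone_vadd]
      refine feasibleCone_eq_of_minFace_eq P.isPolytopal.convex hzP hzP' ?_
      rw [F.minFace_eq hz1, F.minFace_eq hz2])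
  have h1 : (flatMeasure (vectorSpan ℝ (F : Set (Eucl d))) p).real
      (intrinsicInterior ℝ (F : Set (Eucl d))) = F.vol := by
    rw [Face.vol, Measure.real, Measure.real, F.lebesgue_apply hp MeasurableSet.univ, univ_inter]
  have h2 : (flatMeasure (vectorSpan ℝ (F : Set (Eucl d))) p).real
      (A ∩ intrinsicInterior ℝ (F : Set (Eucl d))) = F.lebesgue.real A := by
    rw [Measure.real, Measure.real, F.lebesgue_apply hp hA]
  rw [h1, h2] at key
  rw [div_mul_eq_mul_div, eq_div_iff F.vol_pos.ne', key]

/-- The density of a local extension on a face depends only on the normals at the face. -/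
theorem density_eq (h : IsLocalExtension φ Φ) {P P' : Polytope d} {j j' : ℕ}
    (F : Face j P) (F' : Face j' P')
    (hn : sphericalNormals (P : Set (Eucl d)) F = sphericalNormals (P' : Set (Eucl d)) F') :
    Φ P (intrinsicInterior ℝ (F : Set (Eucl d))) / F.vol =
      Φ P' (intrinsicInterior ℝ (F' : Set (Eucl d))) / F'.vol := by
  obtain ⟨p, hp⟩ := F.exists_mem_intrinsicInterior
  obtain ⟨p', hp'⟩ := F'.exists_mem_intrinsicInterior
  have hpP : p ∈ (P : Set (Eucl d)) := F.subset (intrinsicInterior_subset hp)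
  have hpP' : p' ∈ (P' : Set (Eucl d)) := F'.subset (intrinsicInterior_subset hp')
  have hcone : feasibleCone (P : Set (Eucl d)) p = feasibleCone P' p' := by
    refine P.isPolytopal.feasibleCone_eq_of_sphericalPolar_eq P'.isPolytopal hpP hpP' ?_
    rw [← sphericalNormals_minFace hpP, ← sphericalNormals_minFace hpP', F.minFace_eq hp,
      F'.minFace_eq hp', hn]
  have hL : vectorSpan ℝ (F : Set (Eucl d)) = vectorSpan ℝ (F' : Set (Eucl d)) := by
    rw [← F.minFace_eq hp, ← F'.minFace_eq hp']
    exact vectorSpan_minFace_congr P.isPolytopal.convex P'.isPolytopal.convex hpP hpP' hcone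
  set x := p - p' with hx
  -- After `p'` is moved to `p`, the two relative interiors overlap. `X` is this overlap in the
  -- position of `F'`, and the two densities are compared on `X` and `x +ᵥ X`.
  set X : Set (Eucl d) := intrinsicInterior ℝ (F' : Set (Eucl d)) ∩
    (-x +ᵥ intrinsicInterior ℝ (F : Set (Eucl d))) with hX
  have hXm : MeasurableSet X :=
    F'.measurableSet_intrinsicInterior.inter (F.measurableSet_intrinsicInterior.const_vadd _)
  have hXF : X ∩ intrinsicInterior ℝ (F' : Set (Eucl d)) = X :=
    inter_eq_left.2 inter_subset_left
  have hxX : x +ᵥ X ⊆ intrinsicInterior ℝ (F : Set (Eucl d)) := by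
    intro z hz
    rw [mem_vadd_set_iff_sub_mem] at hz
    have := hz.2
    rw [mem_vadd_set_iff_sub_mem] at this
    simpa using this
  have hXF' : (x +ᵥ X) ∩ intrinsicInterior ℝ (F : Set (Eucl d)) = x +ᵥ X := inter_eq_left.2 hxX
  have e1 := h.apply_inter_intrinsicInterior F (hXm.const_vadd x)
  have e2 := h.apply_inter_intrinsicInterior F' hXm
  rw [hXF] at e2
  rw [hXF'] at e1
  have e3 : Φ P (x +ᵥ X) = Φ P' X := by
    rw [← h.covariant P' x X hXm]
    refine h.apply_congr_of_feasibleCone (hXm.const_vadd x) fun z hz => ?_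
    have hzF := hxX hz
    have hzF' : z - x ∈ intrinsicInterior ℝ (F' : Set (Eucl d)) :=
      (mem_vadd_set_iff_sub_mem.1 hz).1
    have hzP : z ∈ (P : Set (Eucl d)) := F.subset (intrinsicInterior_subset hzF)
    have hzP' : z - x ∈ (P' : Set (Eucl d)) := F'.subset (intrinsicInterior_subset hzF')
    refine ⟨hzP, mem_vadd_set_iff_sub_mem.2 hzP', ?_⟩
    rw [Polytope.coe_translate, feasibleCone_vadd,
      feasibleCone_eq_of_minFace_eq P.isPolytopal.convex hzP hpP
        (by rw [F.minFace_eq hzF, F.minFace_eq hp]),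
      feasibleCone_eq_of_minFace_eq P'.isPolytopal.convex hzP' hpP'
        (by rw [F'.minFace_eq hzF', F'.minFace_eq hp']), hcone]
  have e4 : F.lebesgue (x +ᵥ X) = F'.lebesgue X := by
    rw [F.lebesgue_apply (intrinsicInterior_subset hp) (hXm.const_vadd x),
      F'.lebesgue_apply (intrinsicInterior_subset hp') hXm, hXF, hXF', hL]
    have := flatMeasure_vadd_apply (L := vectorSpan ℝ (F' : Set (Eucl d))) (p := p') x hXm
    rwa [hx, sub_add_cancel] at this
  -- The overlap contains a relative ball, so its measure can be cancelled at the end.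
  have e5 : 0 < F'.lebesgue X := by
    rw [F'.lebesgue_apply (intrinsicInterior_subset hp') hXm, hXF]
    refine flatMeasure_pos hXm ?_
    obtain ⟨_, r, hr, h1⟩ := mem_intrinsicInterior_iff.1 hp
    obtain ⟨_, r', hr', h2⟩ := mem_intrinsicInterior_iff.1 hp'
    have key : ∀ {i : ℕ} {Q : Polytope d} (G : Face i Q) (q : Eucl d) (s : ℝ), 0 < s →
        (∀ v ∈ vectorSpan ℝ (G : Set (Eucl d)), ‖v‖ < s → q + v ∈ (G : Set (Eucl d))) →
        ∀ v ∈ vectorSpan ℝ (G : Set (Eucl d)), ‖v‖ < s / 2 →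
          q + v ∈ intrinsicInterior ℝ (G : Set (Eucl d)) := by
      intro i Q G q s hs hq v hv hvs
      refine mem_intrinsicInterior_iff.2 ⟨hq v hv (by linarith), s / 2, by positivity,
        fun w hw hws => ?_⟩
      rw [add_assoc]
      exact hq _ (Submodule.add_mem _ hv hw) ((norm_add_le _ _).trans_lt (by linarith))
    refine ⟨min (r / 2) (r' / 2), lt_min (by positivity) (by positivity), fun v hv hvr => ?_⟩
    rw [lt_min_iff] at hvr
    refine ⟨key F' p' r' hr' h2 v hv hvr.2, ?_⟩
    rw [mem_vadd_set_iff_sub_mem]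
    have := key F p r hr h1 v (hL ▸ hv) hvr.1
    convert this using 1
    rw [hx]
    abel
  have e6 : 0 < F'.lebesgue.real X := ENNReal.toReal_pos e5.ne' (measure_ne_top _ _)
  have e7 : F.lebesgue.real (x +ᵥ X) = F'.lebesgue.real X := by rw [Measure.real, e4, Measure.real]
  rw [e3, e2, e7] at e1
  exact (mul_right_cancel₀ e6.ne' e1).symm

open Classical in
/-- The function that assigns to the normals at a `j`-face the density of the local extension on
this face. -/
def assoc (_h : IsLocalExtension φ Φ) (j : ℕ) (N : Set (Eucl d)) : ℝ :=
  if hN : ∃ q : Σ P : Polytope d, Face j P, sphericalNormals (q.1 : Set (Eucl d)) q.2 = N then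
    Φ hN.choose.1 (intrinsicInterior ℝ (hN.choose.2 : Set (Eucl d))) / hN.choose.2.vol
  else 0

theorem assoc_sphericalNormals (h : IsLocalExtension φ Φ) {P : Polytope d} {j : ℕ}
    (F : Face j P) : h.assoc j (sphericalNormals (P : Set (Eucl d)) F) =
      Φ P (intrinsicInterior ℝ (F : Set (Eucl d))) / F.vol := by
  have hN : ∃ q : Σ P : Polytope d, Face j P,
      sphericalNormals (q.1 : Set (Eucl d)) q.2 = sphericalNormals (P : Set (Eucl d)) F :=
    ⟨⟨P, F⟩, rfl⟩
  rw [assoc, dif_pos hN]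
  exact h.density_eq _ _ hN.choose_spec

end IsLocalExtension

theorem Polytope.exists_face (P : Polytope d) {z : Eucl d} (hz : z ∈ (P : Set (Eucl d))) :
    ∃ q : Σ j : Fin (d + 1), Face (j : ℕ) P, z ∈ intrinsicInterior ℝ (q.2 : Set (Eucl d)) := by
  let F : Face _ P := Face.ofPoint P hz rfl
  exact ⟨⟨⟨_, Nat.lt_succ_of_le F.le_dim⟩, F⟩, P.isPolytopal.mem_intrinsicInterior_minFace hz⟩

theorem Face.sigma_ext {P : Polytope d} {q q' : Σ j : Fin (d + 1), Face (j : ℕ) P}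
    (h : (q.2 : Set (Eucl d)) = q'.2) : q = q' := by
  obtain ⟨j, F⟩ := q
  obtain ⟨j', F'⟩ := q'
  have hj : j = j' := by
    apply Fin.ext
    rw [← F.finrank_vectorSpan, ← F'.finrank_vectorSpan]
    simp only at h
    rw [h]
  subst hj
  obtain rfl : F = F' := Face.ext h
  rfl

/-- A local extension has a constant density on every face, which depends only on the normals at
the face. -/
theorem IsLocalExtension.apply_eq_sum {φ : Polytope d → ℝ}
    {Φ : Polytope d → SignedMeasure (Eucl d)} (h : IsLocalExtension φ Φ) (P : Polytope d)
    {A : Set (Eucl d)} (hA : MeasurableSet A) :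
    Φ P A = ∑ j ∈ Finset.range (d + 1), ∑ F : Face j P,
      h.assoc j (sphericalNormals P F) * F.lebesgue.real A := by
  classical
  have hP := P.isCompact.measurableSet
  have h1 : Φ P A = Φ P (A ∩ P) := by
    rw [← VectorMeasure.of_add_of_sdiff (hA.inter hP) hA inter_subset_left,
      h.apply_eq_zero P (hA.diff (hA.inter hP)) (by
        rintro z ⟨hzA, hz⟩ hzP; exact hz ⟨hzA, hzP⟩), add_zero]
  have h2 : A ∩ (P : Set (Eucl d)) = ⋃ q ∈ (Finset.univ : Finset (Σ j : Fin (d + 1), Face (j : ℕ) P)),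
      A ∩ intrinsicInterior ℝ (q.2 : Set (Eucl d)) := by
    ext z
    simp only [mem_inter_iff, Finset.mem_univ, iUnion_true, mem_iUnion]
    constructor
    · rintro ⟨hzA, hzP⟩
      obtain ⟨q, hq⟩ := P.exists_face hzP
      exact ⟨q, hzA, hq⟩
    · rintro ⟨q, hzA, hq⟩
      exact ⟨hzA, q.2.subset (intrinsicInterior_subset hq)⟩
  rw [h1, h2, VectorMeasure.of_biUnion_finset]
  · rw [← Finset.univ_sigma_univ, Finset.sum_sigma, Finset.sum_range]
    refine Finset.sum_congr rfl fun j _ => Finset.sum_congr rfl fun F _ => ?_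
    rw [h.apply_inter_intrinsicInterior F hA, h.assoc_sphericalNormals]
  · intro q _ q' _ hne
    rw [Function.onFun, Set.disjoint_left]
    rintro z ⟨-, hz⟩ ⟨-, hz'⟩
    exact hne (Face.sigma_ext (by rw [← q.2.minFace_eq hz, ← q'.2.minFace_eq hz']))
  · intro q _
    exact hA.inter q.2.measurableSet_intrinsicInterior

end PolytopeIntegral

end

noncomputable section

namespace PolytopeIntegral

variable {d : ℕ}

/-! ### Dilates of faces -/

theorem smul_vadd_set_eq (a : ℝ) (x : Eucl d) (A : Set (Eucl d)) :
    a • (x +ᵥ A) = a • x +ᵥ a • A := by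
  simp only [← image_smul, ← image_vadd, image_image, vadd_eq_add, smul_add]

theorem flatMeasure_smul_apply {L : Submodule ℝ (Eucl d)} {p : Eucl d} {a : ℝ} (ha : 0 < a)
    {A : Set (Eucl d)} (hA : MeasurableSet A) :
    flatMeasure L (a • p) (a • A) = ENNReal.ofReal (a ^ Module.finrank ℝ L) * flatMeasure L p A := by
  rw [flatMeasure_apply _ _ hA, flatMeasure_apply _ _ (hA.const_smul₀ a)]
  have : {v : L | (v : Eucl d) + a • p ∈ a • A} = a • {v : L | (v : Eucl d) + p ∈ A} := by
    ext v
    simp only [mem_ofPred_eq, mem_smul_set_iff_inv_smul_mem₀ ha.ne', smul_add,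
      inv_smul_smul₀ ha.ne', Submodule.coe_smul]
  rw [this, Measure.addHaar_smul, abs_of_pos (by positivity)]

namespace Face

variable {j : ℕ} {P : Polytope d}

theorem exists_dilate {a : ℝ} (ha : 0 < a) (F : Face j P) :
    ∃ G : Face j (P.dilate a), (G : Set (Eucl d)) = a • (F : Set (Eucl d)) := by
  obtain ⟨p, hp⟩ := F.exists_mem_intrinsicInterior
  have hpP : p ∈ (P : Set (Eucl d)) := F.subset (intrinsicInterior_subset hp)
  have hap : a • p ∈ (P.dilate a : Set (Eucl d)) := smul_mem_smul_set hpP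
  refine ⟨ofPoint (P.dilate a) hap ?_, ?_⟩
  · rw [vectorSpan_minFace_congr (P.dilate a).isPolytopal.convex P.isPolytopal.convex hap hpP
      (feasibleCone_smul ha p), F.minFace_eq hp, F.finrank_vectorSpan]
  · rw [coe_ofPoint, Polytope.coe_dilate, minFace_smul ha, F.minFace_eq hp]

/-- The face `a F` of `a P`. -/
def dilate {a : ℝ} (ha : 0 < a) (F : Face j P) : Face j (P.dilate a) := (F.exists_dilate ha).choose

@[simp] theorem coe_dilate {a : ℝ} (ha : 0 < a) (F : Face j P) :
    (F.dilate ha : Set (Eucl d)) = a • (F : Set (Eucl d)) := (F.exists_dilate ha).choose_spec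

theorem dilate_bijective {a : ℝ} (ha : 0 < a) :
    Function.Bijective (dilate ha : Face j P → Face j (P.dilate a)) := by
  constructor
  · intro F G h
    have : (F.dilate ha : Set (Eucl d)) = G.dilate ha := by rw [h]
    rw [coe_dilate, coe_dilate] at this
    refine ext ?_
    rw [← inv_smul_smul₀ ha.ne' (F : Set (Eucl d)), this, inv_smul_smul₀ ha.ne']
  · intro G
    obtain ⟨q, hq⟩ := G.exists_mem_intrinsicInterior
    obtain ⟨p, hp, rfl⟩ : q ∈ a • (P : Set (Eucl d)) := G.subset (intrinsicInterior_subset hq)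
    have hap : a • p ∈ (P.dilate a : Set (Eucl d)) := smul_mem_smul_set hp
    refine ⟨ofPoint P hp ?_, ext ?_⟩
    · rw [← G.finrank_vectorSpan, ← G.minFace_eq hq]
      rw [vectorSpan_minFace_congr (P.dilate a).isPolytopal.convex P.isPolytopal.convex hap hp
        (feasibleCone_smul ha p)]
    · rw [coe_dilate, coe_ofPoint, ← minFace_smul ha]
      exact G.minFace_eq hq

theorem vectorSpan_dilate {a : ℝ} (ha : 0 < a) (F : Face j P) :
    vectorSpan ℝ (F.dilate ha : Set (Eucl d)) = vectorSpan ℝ (F : Set (Eucl d)) := by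
  obtain ⟨p, hp⟩ := F.exists_mem_intrinsicInterior
  have hpP : p ∈ (P : Set (Eucl d)) := F.subset (intrinsicInterior_subset hp)
  have hap : a • p ∈ (P.dilate a : Set (Eucl d)) := smul_mem_smul_set hpP
  rw [coe_dilate, ← F.minFace_eq hp, ← minFace_smul ha]
  exact vectorSpan_minFace_congr (P.dilate a).isPolytopal.convex P.isPolytopal.convex hap hpP
    (feasibleCone_smul ha p)

theorem sphericalNormals_dilate {a : ℝ} (ha : 0 < a) (F : Face j P) :
    sphericalNormals (P.dilate a : Set (Eucl d)) (F.dilate ha) =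
      sphericalNormals (P : Set (Eucl d)) F := by
  obtain ⟨p, hp⟩ := F.exists_mem_intrinsicInterior
  have hpP : p ∈ (P : Set (Eucl d)) := F.subset (intrinsicInterior_subset hp)
  have hap : a • p ∈ (P.dilate a : Set (Eucl d)) := smul_mem_smul_set hpP
  rw [coe_dilate, ← F.minFace_eq hp, ← minFace_smul ha, sphericalNormals_minFace hpP]
  exact (sphericalNormals_minFace hap).trans (by rw [Polytope.coe_dilate, feasibleCone_smul ha])

theorem lebesgue_dilate {a : ℝ} (ha : 0 < a) (F : Face j P) {A : Set (Eucl d)}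
    (hA : MeasurableSet A) :
    (F.dilate ha).lebesgue.real (a • A) = a ^ j * F.lebesgue.real A := by
  obtain ⟨p, hp⟩ := F.nonempty
  have hp' : a • p ∈ (F.dilate ha : Set (Eucl d)) := by
    rw [coe_dilate]; exact smul_mem_smul_set hp
  rw [Measure.real, Measure.real, lebesgue_eq _ hp, lebesgue_eq _ hp', Measure.restrict_apply hA,
    Measure.restrict_apply (hA.const_smul₀ a), vectorSpan_dilate, coe_dilate,
    ← smul_set_inter₀ ha.ne', flatMeasure_smul_apply ha (hA.inter F.isCompact.measurableSet),
    F.finrank_vectorSpan, ENNReal.toReal_mul, ENNReal.toReal_ofReal (by positivity)]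

/-- The dilate is a single point. This settles homogeneity at the factor 0 in positive degree, where
the sums over faces become empty. -/
theorem isEmpty_dilate_zero (hj : j ≠ 0) : IsEmpty (Face j (P.dilate 0)) := by
  refine ⟨fun F => hj ?_⟩
  have h0 : (P.dilate 0 : Set (Eucl d)) = {0} := by
    rw [Polytope.coe_dilate, zero_smul_set P.nonempty, singleton_zero]
  have h1 : (F : Set (Eucl d)).Subsingleton :=
    subsingleton_singleton.anti (F.subset.trans h0.subset)
  rw [← F.finrank_vectorSpan, vectorSpan_of_subsingleton ℝ h1, finrank_bot]

end Face

/-! ### Kernels given by densities on faces -/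

/-- The measure with density `f (n(P, F))` on each `j`-face `F` of `P`. -/
def faceKernel (f : Set (Eucl d) → ℝ) (j : ℕ) (P : Polytope d) : SignedMeasure (Eucl d) :=
  ∑ F : Face j P, f (sphericalNormals P F) • F.lebesgue.toSignedMeasure

theorem signedMeasure_sum_apply {α ι : Type*} [MeasurableSpace α] (s : Finset ι)
    (μ : ι → SignedMeasure α) (A : Set α) : (∑ i ∈ s, μ i) A = ∑ i ∈ s, μ i A := by
  classical
  induction s using Finset.induction_on with
  | empty => simp
  | insert a s ha ih => rw [Finset.sum_insert ha, Finset.sum_insert ha, add_apply, ih]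

theorem faceKernel_apply (f : Set (Eucl d) → ℝ) (j : ℕ) (P : Polytope d) {A : Set (Eucl d)}
    (hA : MeasurableSet A) :
    faceKernel f j P A = ∑ F : Face j P, f (sphericalNormals P F) * F.lebesgue.real A := by
  rw [faceKernel, signedMeasure_sum_apply]
  refine Finset.sum_congr rfl fun F _ => ?_
  rw [smul_apply, Measure.toSignedMeasure_apply_measurable hA, smul_eq_mul]

theorem isHomogeneousKernel_faceKernel (f : Set (Eucl d) → ℝ) (j : ℕ) :
    IsHomogeneousKernel j (faceKernel f j : Polytope d → _) := by
  intro a P A ha hj hA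
  rcases ha.eq_or_lt with rfl | ha
  · have hj : j ≠ 0 := by simpa using hj
    have := Face.isEmpty_dilate_zero (P := P) hj
    simp [faceKernel, hj]
  · rw [faceKernel_apply _ _ _ hA, faceKernel_apply _ _ _ (hA.const_smul₀ a), Finset.mul_sum]
    refine ((Face.dilate_bijective ha).sum_comp _).symm.trans (Finset.sum_congr rfl fun F _ => ?_)
    rw [F.sphericalNormals_dilate ha, F.lebesgue_dilate ha hA]
    ring

/-! ### Extraction of homogeneous parts -/

/-- The weights are the rows of the inverse Vandermonde matrix with nodes 1, …, D + 1; the shift by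
one avoids dilatation by 0. -/
theorem exists_homogeneous_weights (D : ℕ) :
    ∃ c : ℕ → Fin (D + 1) → ℝ, ∀ t ≤ D, ∀ s ≤ D,
      ∑ n : Fin (D + 1), c t n * ((n : ℝ) + 1) ^ s = if s = t then 1 else 0 := by
  set V : Matrix (Fin (D + 1)) (Fin (D + 1)) ℝ :=
    Matrix.vandermonde fun n : Fin (D + 1) => (n : ℝ) + 1 with hV
  have hdet : IsUnit V.det := by
    rw [isUnit_iff_ne_zero, hV, Matrix.det_vandermonde_ne_zero_iff]
    intro a b hab
    have : ((a : ℕ) : ℝ) = ((b : ℕ) : ℝ) := add_right_cancel hab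
    exact Fin.ext (by exact_mod_cast this)
  have hinv := Matrix.nonsing_inv_mul V hdet
  refine ⟨fun t n => if h : t < D + 1 then V⁻¹ ⟨t, h⟩ n else 0, fun t ht s hs => ?_⟩
  have h1 := congrFun (congrFun hinv ⟨t, Nat.lt_succ_of_le ht⟩) ⟨s, Nat.lt_succ_of_le hs⟩
  rw [Matrix.mul_apply, Matrix.one_apply] at h1
  simp only [hV, Matrix.vandermonde_apply, Fin.mk.injEq] at h1
  simp only [Nat.lt_succ_of_le ht, dif_pos]
  rw [h1]
  simp only [eq_comm]

/-- Weights that extract the part of degree `t` of a polynomial of degree at most `D`. -/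
def hWeight (D t : ℕ) (n : Fin (D + 1)) : ℝ := (exists_homogeneous_weights D).choose t n

theorem sum_hWeight {D t s : ℕ} (ht : t ≤ D) (hs : s ≤ D) :
    ∑ n : Fin (D + 1), hWeight D t n * ((n : ℝ) + 1) ^ s = if s = t then 1 else 0 :=
  (exists_homogeneous_weights D).choose_spec t ht s hs

theorem Polytope.measurable_dilate (a : ℝ) : Measurable (Polytope.dilate a : Polytope d → _) := by
  have hc : Continuous (Polytope.dilate a : Polytope d → Polytope d) := by
    have h1 : Continuous fun P : Polytope d =>
        TopologicalSpace.NonemptyCompacts.map (fun v : Eucl d => a • v) (continuous_const_smul a) P.1 :=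
      (continuous_const_smul a).nonemptyCompacts_map.comp continuous_subtype_val
    exact h1.subtype_mk _
  borelize (Polytope d)
  exact hc.borel_measurable

theorem Polytope.dilate_translate (a : ℝ) (x : Eucl d) (P : Polytope d) :
    (P.translate x).dilate a = (P.dilate a).translate (a • x) :=
  Polytope.ext (by simp [smul_vadd_set_eq])

/-- The value of `Φ` at dilates is a polynomial in the factor, with the face kernels as
coefficients, and the weights select degree `j`. Being a finite combination of values of `Φ`, the
part inherits measurability, covariance and local determination, none of which is visible from the
sum over faces. -/
theorem IsLocalExtension.faceKernel_assoc_apply {φ : Polytope d → ℝ}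
    {Φ : Polytope d → SignedMeasure (Eucl d)} (h : IsLocalExtension φ Φ) {j : ℕ} (hj : j ≤ d)
    (P : Polytope d) {A : Set (Eucl d)} (hA : MeasurableSet A) :
    faceKernel (h.assoc j) j P A =
      ∑ n : Fin (d + 1), hWeight d j n * Φ (P.dilate ((n : ℝ) + 1)) (((n : ℝ) + 1) • A) := by
  have h1 : ∀ n : Fin (d + 1), Φ (P.dilate ((n : ℝ) + 1)) (((n : ℝ) + 1) • A) =
      ∑ s ∈ Finset.range (d + 1), ((n : ℝ) + 1) ^ s * faceKernel (h.assoc s) s P A := by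
    intro n
    have hn : (0 : ℝ) < (n : ℝ) + 1 := by positivity
    rw [h.apply_eq_sum _ (hA.const_smul₀ _)]
    refine Finset.sum_congr rfl fun s _ => ?_
    rw [← isHomogeneousKernel_faceKernel _ s _ P A hn.le (Or.inl hn.ne') hA,
      faceKernel_apply _ _ _ (hA.const_smul₀ _)]
  simp_rw [h1, Finset.mul_sum]
  rw [Finset.sum_comm]
  simp_rw [← mul_assoc, ← Finset.sum_mul]
  rw [Finset.sum_eq_single_of_mem j (Finset.mem_range.2 (Nat.lt_succ_of_le hj))]
  · rw [sum_hWeight hj hj, if_pos rfl, one_mul]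
  · intro s hs hne
    rw [sum_hWeight hj (Nat.lt_succ_iff.1 (Finset.mem_range.1 hs)), if_neg hne, zero_mul]

theorem IsLocalExtension.faceKernel_assoc {φ : Polytope d → ℝ}
    {Φ : Polytope d → SignedMeasure (Eucl d)} (h : IsLocalExtension φ Φ) {j : ℕ} (hj : j ≤ d) :
    IsLocalExtension (fun P => faceKernel (h.assoc j) j P univ) (faceKernel (h.assoc j) j) where
  measurable A hA := by
    simp_rw [fun P => h.faceKernel_assoc_apply hj P hA]
    exact Finset.measurable_sum _ fun n _ =>
      ((h.measurable _ (hA.const_smul₀ _)).comp (Polytope.measurable_dilate _)).const_mul _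
  total P := rfl
  covariant P x A hA := by
    rw [h.faceKernel_assoc_apply hj _ (hA.const_vadd x), h.faceKernel_assoc_apply hj P hA]
    refine Finset.sum_congr rfl fun n _ => ?_
    rw [Polytope.dilate_translate, smul_vadd_set_eq, h.covariant _ _ _ (hA.const_smul₀ _)]
  locallyDetermined P Q A U hA hU hAU hPQ := by
    rw [h.faceKernel_assoc_apply hj P hA, h.faceKernel_assoc_apply hj Q hA]
    refine Finset.sum_congr rfl fun n _ => ?_
    have hn : (n : ℝ) + 1 ≠ 0 := by positivity
    rw [h.locallyDetermined _ _ _ (((n : ℝ) + 1) • U) (hA.const_smul₀ _) (hU.smul₀ hn)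
      (smul_set_mono hAU)]
    rw [Polytope.coe_dilate, Polytope.coe_dilate, ← smul_set_inter₀ hn, ← smul_set_inter₀ hn, hPQ]

theorem IsLocalExtension.areHomogeneousParts {φ : Polytope d → ℝ}
    {Φ : Polytope d → SignedMeasure (Eucl d)} (h : IsLocalExtension φ Φ) :
    AreHomogeneousParts φ Φ (fun j P => faceKernel (h.assoc j) j P univ)
      (fun j => faceKernel (h.assoc j) j) := by
  have hsum : ∀ P, Φ P = ∑ j ∈ Finset.range (d + 1), faceKernel (h.assoc j) j P := by
    intro P
    refine VectorMeasure.ext fun A hA => ?_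
    rw [h.apply_eq_sum P hA, signedMeasure_sum_apply]
    exact Finset.sum_congr rfl fun j _ => (faceKernel_apply _ _ _ hA).symm
  refine ⟨fun P => ?_, hsum, fun j hj => h.faceKernel_assoc hj, fun j _ a P ha hj => ?_,
    fun j _ => isHomogeneousKernel_faceKernel _ j⟩
  · rw [h.total, hsum, signedMeasure_sum_apply]
  · rcases ha.eq_or_lt with rfl | ha
    · have hj : j ≠ 0 := by simpa using hj
      have := Face.isEmpty_dilate_zero (P := P) hj
      simp [faceKernel, hj]
    · have := isHomogeneousKernel_faceKernel (h.assoc j) j a P univ ha.le hj MeasurableSet.univ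
      rwa [smul_set_univ₀ ha.ne'] at this

/-- Applied to an already homogeneous kernel, the extraction of degree `j` returns the kernel
itself. This covers arbitrary homogeneous parts, not only those constructed from `assoc`. -/
theorem IsLocalExtension.isAssociatedFunction {φ : Polytope d → ℝ}
    {Φ : Polytope d → SignedMeasure (Eucl d)} (h : IsLocalExtension φ Φ) {j : ℕ} (hj : j ≤ d)
    (hhom : IsHomogeneousKernel j Φ) : IsAssociatedFunction j Φ (h.assoc j) := by
  intro P
  refine VectorMeasure.ext fun A hA => ?_
  refine Eq.trans ?_ (h.faceKernel_assoc_apply hj P hA).symm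
  have h1 : ∀ n : Fin (d + 1), Φ (P.dilate ((n : ℝ) + 1)) (((n : ℝ) + 1) • A) =
      ((n : ℝ) + 1) ^ j * Φ P A := fun n => by
    have hn : (0 : ℝ) < (n : ℝ) + 1 := by positivity
    exact hhom _ P A hn.le (Or.inl hn.ne') hA
  simp_rw [h1, ← mul_assoc, ← Finset.sum_mul]
  rw [sum_hWeight hj hj, if_pos rfl, one_mul]

end PolytopeIntegral

end

noncomputable section

namespace PolytopeIntegral

variable {d k : ℕ}

/-! ### The determinant of a family of subspaces -/

/-- The union of orthonormal bases of the orthogonal complements of the subspaces `L i`. -/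
def normalBasis (L : Fin k → Submodule ℝ (Eucl d))
    (a : Σ i : Fin k, Fin (Module.finrank ℝ ((L i)ᗮ : Submodule ℝ (Eucl d)))) : Eucl d :=
  ((stdOrthonormalBasis ℝ ((L a.1)ᗮ : Submodule ℝ (Eucl d)) a.2 : _) : Eucl d)

/-- The volume of the parallelepiped spanned by `normalBasis L`. -/
def subspaceDet (L : Fin k → Submodule ℝ (Eucl d)) : ℝ :=
  Real.sqrt (Matrix.gram ℝ (normalBasis L)).det

theorem faceDet_eq (F : Fin k → Set (Eucl d)) :
    faceDet F = subspaceDet fun i => vectorSpan ℝ (F i) := rfl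

variable {L : Fin k → Submodule ℝ (Eucl d)}

theorem linearIndependent_normalBasis (hL : subspaceDet L ≠ 0) :
    LinearIndependent ℝ (normalBasis L) := by
  refine Matrix.det_gram_ne_zero_iff_linearIndependent.1 fun h => hL ?_
  rw [subspaceDet, h, Real.sqrt_zero]

theorem span_normalBasis : Submodule.span ℝ (range (normalBasis L)) = ⨆ i, (L i)ᗮ := by
  rw [range_sigma_eq_iUnion_range, Submodule.span_iUnion]
  congr 1
  ext1 i
  have h := (stdOrthonormalBasis ℝ ((L i)ᗮ : Submodule ℝ (Eucl d))).toBasis.span_eq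
  rw [OrthonormalBasis.coe_toBasis] at h
  have h2 := congrArg (Submodule.map (Submodule.subtype (L i)ᗮ)) h
  rw [Submodule.map_span, Submodule.map_subtype_top, ← range_comp] at h2
  exact h2

theorem iSup_orthogonal_eq : (⨆ i, (L i)ᗮ) = (⨅ i, L i)ᗮ := by
  rw [← Submodule.orthogonal_orthogonal (⨆ i, (L i)ᗮ), ← Submodule.iInf_orthogonal]
  simp only [Submodule.orthogonal_orthogonal]

theorem finrank_add_sum_finrank_orthogonal (hL : subspaceDet L ≠ 0) :
    Module.finrank ℝ (⨅ i, L i : Submodule ℝ (Eucl d)) +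
      ∑ i, Module.finrank ℝ ((L i)ᗮ : Submodule ℝ (Eucl d)) = d := by
  have h1 := finrank_span_eq_card (linearIndependent_normalBasis hL)
  rw [span_normalBasis, iSup_orthogonal_eq] at h1
  have h2 := Submodule.finrank_add_finrank_orthogonal (⨅ i, L i)
  rw [h1] at h2
  simpa using h2

/-- Independent normals make codimensions add up; this is the origin of the condition m_1 + … + m_k
= (k - 1)d + j. -/
theorem sum_finrank_of_subspaceDet_ne_zero (hL : subspaceDet L ≠ 0) :
    ∑ i, Module.finrank ℝ (L i) + d =
      k * d + Module.finrank ℝ (⨅ i, L i : Submodule ℝ (Eucl d)) := by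
  have h1 := finrank_add_sum_finrank_orthogonal hL
  have h2 : ∀ i, Module.finrank ℝ (L i) + Module.finrank ℝ ((L i)ᗮ : Submodule ℝ (Eucl d)) = d :=
    fun i => by simpa using Submodule.finrank_add_finrank_orthogonal (L i)
  have h3 := Finset.sum_congr (rfl : (Finset.univ : Finset (Fin k)) = _) fun i _ => h2 i
  rw [Finset.sum_add_distrib, Finset.sum_const, Finset.card_univ, Fintype.card_fin,
    smul_eq_mul] at h3
  omega

/-- If the determinant vanishes, then there are nontrivial dependent normal vectors. -/
theorem exists_dependent_normals (hL : subspaceDet L = 0) :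
    ∃ u : Fin k → Eucl d, (∀ i, u i ∈ (L i)ᗮ) ∧ ∑ i, u i = 0 ∧ ∃ i, u i ≠ 0 := by
  have hdep : ¬ LinearIndependent ℝ (normalBasis L) := by
    intro h
    have h1 := Matrix.posDef_gram_of_linearIndependent h
    have h2 := Real.sqrt_pos.2 h1.det_pos
    exact h2.ne' hL
  rw [Fintype.linearIndependent_iff] at hdep
  push Not at hdep
  obtain ⟨c, hc, ⟨i, a⟩, ha⟩ := hdep
  -- The terms of a linear relation among the basis vectors are grouped by subspace; a nonzero
  -- coefficient makes its group nonzero.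
  let w : ∀ i, ((L i)ᗮ : Submodule ℝ (Eucl d)) := fun i =>
    ∑ a, c ⟨i, a⟩ • stdOrthonormalBasis ℝ ((L i)ᗮ : Submodule ℝ (Eucl d)) a
  refine ⟨fun i => w i, fun i => (w i).2, ?_, i, fun h0 => ha ?_⟩
  · rw [Fintype.sum_sigma] at hc
    rw [← hc]
    refine Finset.sum_congr rfl fun i _ => ?_
    simp only [w, Submodule.coe_sum, Submodule.coe_smul, normalBasis]
  · have h1 : w i = 0 := Subtype.ext h0
    exact Fintype.linearIndependent_iff.1
      (stdOrthonormalBasis ℝ ((L i)ᗮ : Submodule ℝ (Eucl d))).toBasis.linearIndependent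
      (fun a => c ⟨i, a⟩) (by simpa [w] using h1) a

/-! ### The change of variables given by normal components -/

/-- The components of a vector in `⋂ L i` and in the orthogonal complements of the `L i`. -/
def normalMap (L : Fin k → Submodule ℝ (Eucl d)) :
    Eucl d →ₗ[ℝ] (⨅ i, L i : Submodule ℝ (Eucl d)) × (∀ i, ((L i)ᗮ : Submodule ℝ (Eucl d))) :=
  LinearMap.prod (⨅ i, L i : Submodule ℝ (Eucl d)).orthogonalProjectionOnto.toLinearMap
    (LinearMap.pi fun i => ((L i)ᗮ : Submodule ℝ (Eucl d)).orthogonalProjectionOnto.toLinearMap)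

@[simp] theorem normalMap_fst (z : Eucl d) : (normalMap L z).1 =
    (⨅ i, L i : Submodule ℝ (Eucl d)).orthogonalProjectionOnto z := rfl

@[simp] theorem normalMap_snd (z : Eucl d) (i : Fin k) : (normalMap L z).2 i =
    ((L i)ᗮ : Submodule ℝ (Eucl d)).orthogonalProjectionOnto z := rfl

theorem normalMap_injective : Function.Injective (normalMap L) := by
  rw [injective_iff_map_eq_zero]
  intro z hz
  have h1 : ∀ i, z ∈ L i := fun i => by
    have h : ((L i)ᗮ : Submodule ℝ (Eucl d)).orthogonalProjectionOnto z = 0 := by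
      rw [← normalMap_snd, hz]; rfl
    rw [Submodule.orthogonalProjectionOnto_eq_zero_iff, Submodule.orthogonal_orthogonal] at h
    exact h
  have h2 : (⨅ i, L i : Submodule ℝ (Eucl d)).orthogonalProjectionOnto z = 0 := by
    rw [← normalMap_fst, hz]; rfl
  have h3 := Submodule.orthogonalProjectionOnto_mem_subspace_eq_self
    (⟨z, (Submodule.mem_iInf _).2 h1⟩ : (⨅ i, L i : Submodule ℝ (Eucl d)))
  rw [h2] at h3
  exact (congrArg Subtype.val h3).symm

/-- `normalMap` as a linear equivalence. -/
def normalEquiv (hL : subspaceDet L ≠ 0) :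
    Eucl d ≃ₗ[ℝ] (⨅ i, L i : Submodule ℝ (Eucl d)) × (∀ i, ((L i)ᗮ : Submodule ℝ (Eucl d))) :=
  (normalMap L).linearEquivOfInjective normalMap_injective (by
    rw [Module.finrank_prod, Module.finrank_pi_fintype, finrank_add_sum_finrank_orthogonal hL]
    simp)

@[simp] theorem normalEquiv_apply (hL : subspaceDet L ≠ 0) (z : Eucl d) :
    normalEquiv hL z = normalMap L z := rfl

theorem volume_preserving_piCurry {ι : Type*} [Fintype ι] (κ : ι → Type*) [∀ i, Fintype (κ i)] :
    MeasurePreserving (MeasurableEquiv.piCurry fun (i : ι) (_ : κ i) => ℝ) volume volume := by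
  refine MeasurePreserving.symm (MeasurableEquiv.piCurry fun (i : ι) (_ : κ i) => ℝ).symm ?_
  refine ⟨MeasurableEquiv.measurable _, (Measure.pi_eq fun s hs => ?_).symm⟩
  rw [MeasurableEquiv.map_apply]
  have : (MeasurableEquiv.piCurry fun (i : ι) (_ : κ i) => ℝ).symm ⁻¹' univ.pi s =
      univ.pi fun i => univ.pi fun a => s ⟨i, a⟩ := by
    ext y
    simp only [mem_preimage, mem_univ_pi, Sigma.forall]
    rfl
  rw [this, volume_pi_pi, Fintype.prod_sigma]
  exact Finset.prod_congr rfl fun i _ => volume_pi_pi _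

/-- The vectors of an orthonormal basis of `⋂ L i` together with `normalBasis L`. -/
def fullBasis (L : Fin k → Submodule ℝ (Eucl d)) :
    Fin (Module.finrank ℝ (⨅ i, L i : Submodule ℝ (Eucl d))) ⊕
      (Σ i : Fin k, Fin (Module.finrank ℝ ((L i)ᗮ : Submodule ℝ (Eucl d)))) → Eucl d :=
  Sum.elim (fun s => (stdOrthonormalBasis ℝ (⨅ i, L i : Submodule ℝ (Eucl d)) s : Eucl d))
    (normalBasis L)

/-- Vectors of `⋂ L i` are orthogonal to all normals, so the Gram matrix is block diagonal with an
identity block. -/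
theorem det_gram_fullBasis :
    (Matrix.gram ℝ (fullBasis L)).det = (Matrix.gram ℝ (normalBasis L)).det := by
  have h : Matrix.gram ℝ (fullBasis L) =
      Matrix.fromBlocks 1 0 0 (Matrix.gram ℝ (normalBasis L)) := by
    have hz : ∀ (s : Fin (Module.finrank ℝ (⨅ i, L i : Submodule ℝ (Eucl d))))
        (a : Σ i : Fin k, Fin (Module.finrank ℝ ((L i)ᗮ : Submodule ℝ (Eucl d)))),
        ⟪(stdOrthonormalBasis ℝ (⨅ i, L i : Submodule ℝ (Eucl d)) s : Eucl d),
          normalBasis L a⟫ = 0 := by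
      rintro s ⟨i, a⟩
      exact Submodule.inner_right_of_mem_orthogonal
        ((Submodule.mem_iInf _).1
          (stdOrthonormalBasis ℝ (⨅ i, L i : Submodule ℝ (Eucl d)) s).2 i)
        (stdOrthonormalBasis ℝ ((L i)ᗮ : Submodule ℝ (Eucl d)) a).2
    ext s t
    rcases s with s | s <;> rcases t with t | t
    · have := orthonormal_iff_ite.1
        (stdOrthonormalBasis ℝ (⨅ i, L i : Submodule ℝ (Eucl d))).orthonormal s t
      simpa [fullBasis, Matrix.gram_apply, Matrix.one_apply] using this
    · simpa [fullBasis, Matrix.gram_apply] using hz s t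
    · have := hz t s
      rw [real_inner_comm] at this
      simpa [fullBasis, Matrix.gram_apply] using this
    · simp [fullBasis, Matrix.gram_apply]
  rw [h, Matrix.det_fromBlocks_zero₂₁, Matrix.det_one, one_mul]

/-- In orthonormal coordinates the map is a square matrix whose squared determinant is the Gram
determinant. -/
theorem map_inner_volume {ι : Type*} [Fintype ι] [DecidableEq ι] (u : ι → Eucl d)
    (hcard : Fintype.card ι = d) (hu : (Matrix.gram ℝ u).det ≠ 0) :
    Measure.map (fun z : Eucl d => fun s => ⟪u s, z⟫) volume =
      ENNReal.ofReal (Real.sqrt (Matrix.gram ℝ u).det)⁻¹ • (volume : Measure (ι → ℝ)) := by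
  have hc : Module.finrank ℝ (Eucl d) = Fintype.card ι := by simp [hcard]
  let B : OrthonormalBasis ι ℝ (Eucl d) :=
    (stdOrthonormalBasis ℝ (Eucl d)).reindex (Fintype.equivOfCardEq (by simp [hcard]))
  set M : Matrix ι ι ℝ := Matrix.of fun i j => B.repr (u j) i with hM
  have hgram : Matrix.gram ℝ u = M.conjTranspose * M := Matrix.gram_eq_conjTranspose_mul B u
  have hdet : (Matrix.gram ℝ u).det = M.transpose.det ^ 2 := by
    rw [hgram, Matrix.conjTranspose_eq_transpose_of_trivial, Matrix.det_mul, Matrix.det_transpose]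
    ring
  have hM0 : M.transpose.det ≠ 0 := fun h => hu (by rw [hdet, h]; simp)
  have h1 := Real.map_matrix_volume_pi_eq_smul_volume_pi hM0
  have h2 : MeasurePreserving (fun z : Eucl d => (B.repr z).ofLp) volume volume :=
    (PiLp.volume_preserving_ofLp ι).comp B.measurePreserving_repr
  have h3 : (fun z : Eucl d => fun s => ⟪u s, z⟫) =
      Matrix.toLin' M.transpose ∘ fun z : Eucl d => (B.repr z).ofLp := by
    ext z s
    simp only [Function.comp_apply, Matrix.toLin'_apply, Matrix.mulVec, dotProduct,
      Matrix.transpose_apply, hM, Matrix.of_apply, B.repr_apply_apply]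
    rw [← B.sum_inner_mul_inner]
    refine Finset.sum_congr rfl fun t _ => ?_
    rw [real_inner_comm]
  rw [h3, ← Measure.map_map (LinearMap.continuous_of_finiteDimensional _).measurable h2.measurable,
    h2.map_eq, h1, hdet, Real.sqrt_sq_eq_abs, abs_inv]

/-- In orthonormal bases of the target spaces, `normalMap` takes inner products with `fullBasis`;
its Jacobian is therefore `subspaceDet L`. -/
theorem map_normalMap_volume (hL : subspaceDet L ≠ 0) :
    Measure.map (normalMap L) volume = ENNReal.ofReal (subspaceDet L)⁻¹ • volume := by
  classical
  let I := (⨅ i, L i : Submodule ℝ (Eucl d))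
  let b := stdOrthonormalBasis ℝ I
  let e := fun i => stdOrthonormalBasis ℝ ((L i)ᗮ : Submodule ℝ (Eucl d))
  let C : (Fin (Module.finrank ℝ I) ⊕
      (Σ i : Fin k, Fin (Module.finrank ℝ ((L i)ᗮ : Submodule ℝ (Eucl d)))) → ℝ) →
      I × (∀ i, ((L i)ᗮ : Submodule ℝ (Eucl d))) := fun y =>
    (b.repr.symm (WithLp.toLp 2 fun s => y (.inl s)),
      fun i => (e i).repr.symm (WithLp.toLp 2 fun a => y (.inr ⟨i, a⟩)))
  have hC : MeasurePreserving C volume volume := by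
    have h1 := volume_measurePreserving_sumPiEquivProdPi
      fun _ : Fin (Module.finrank ℝ I) ⊕
        (Σ i : Fin k, Fin (Module.finrank ℝ ((L i)ᗮ : Submodule ℝ (Eucl d)))) => ℝ
    have h2 := b.measurePreserving_repr_symm.comp
      (PiLp.volume_preserving_toLp (Fin (Module.finrank ℝ I)))
    have h3 := volume_preserving_pi fun i => (e i).measurePreserving_repr_symm.comp
      (PiLp.volume_preserving_toLp (Fin (Module.finrank ℝ ((L i)ᗮ : Submodule ℝ (Eucl d)))))
    have h4 := h3.comp (volume_preserving_piCurry
      fun i => Fin (Module.finrank ℝ ((L i)ᗮ : Submodule ℝ (Eucl d))))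
    exact (h2.prod h4).comp h1
  have hT : ⇑(normalMap L) = C ∘ fun z : Eucl d => fun s => ⟪fullBasis L s, z⟫ := by
    ext1 z
    refine Prod.ext ?_ (funext fun i => ?_)
    · change _ = b.repr.symm _
      rw [LinearIsometryEquiv.eq_symm_apply]
      ext s
      rw [b.repr_apply_apply, normalMap_fst,
        Submodule.inner_orthogonalProjectionOnto_eq_of_mem_left]
      rfl
    · change _ = (e i).repr.symm _
      rw [LinearIsometryEquiv.eq_symm_apply]
      ext s
      rw [(e i).repr_apply_apply, normalMap_snd,
        Submodule.inner_orthogonalProjectionOnto_eq_of_mem_left]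
      rfl
  have hcard : Fintype.card (Fin (Module.finrank ℝ I) ⊕
      (Σ i : Fin k, Fin (Module.finrank ℝ ((L i)ᗮ : Submodule ℝ (Eucl d))))) = d := by
    simpa using finrank_add_sum_finrank_orthogonal hL
  have hdet : (Matrix.gram ℝ (fullBasis L)).det ≠ 0 := by
    rw [det_gram_fullBasis]
    intro h
    exact hL (by rw [subspaceDet, h, Real.sqrt_zero])
  rw [hT, ← Measure.map_map hC.measurable (by fun_prop), map_inner_volume _ hcard hdet,
    Measure.map_smul, hC.map_eq, det_gram_fullBasis]
  rfl

end PolytopeIntegral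

end

noncomputable section

namespace PolytopeIntegral

variable {d k : ℕ} {L : Fin k → Submodule ℝ (Eucl d)}

/-! ### Intersections of translated flats: the linear coarea formula. -/

theorem volume_preserving_piProd {ι : Type*} [Fintype ι] (α β : ι → Type*)
    [∀ i, MeasureSpace (α i)] [∀ i, MeasureSpace (β i)]
    [∀ i, SigmaFinite (volume : Measure (α i))] [∀ i, SigmaFinite (volume : Measure (β i))] :
    MeasurePreserving (fun q : ∀ i, α i × β i => (fun i => (q i).1, fun i => (q i).2))
      volume volume where
  measurable := by fun_prop
  map_eq := by
    refine (Measure.FiniteSpanningSetsIn.ext ?_ (isPiSystem_pi.prod isPiSystem_pi)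
      ((Measure.FiniteSpanningSetsIn.pi
        fun i ↦ (volume : Measure (α i)).toFiniteSpanningSetsIn).prod
      (Measure.FiniteSpanningSetsIn.pi
        (fun i ↦ (volume : Measure (β i)).toFiniteSpanningSetsIn))) ?_).symm
    · refine (generateFrom_eq_prod generateFrom_pi generateFrom_pi ?_ ?_).symm
      · exact (Measure.FiniteSpanningSetsIn.pi
          (fun i ↦ (volume : Measure (α i)).toFiniteSpanningSetsIn)).isCountablySpanning
      · exact (Measure.FiniteSpanningSetsIn.pi
          (fun i ↦ (volume : Measure (β i)).toFiniteSpanningSetsIn)).isCountablySpanning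
    · rintro _ ⟨s, ⟨s, hs, rfl⟩, ⟨_, ⟨t, ht, rfl⟩, rfl⟩⟩
      rw [Measure.map_apply (by fun_prop) ((MeasurableSet.univ_pi fun i => hs i (mem_univ i)).prod
        (MeasurableSet.univ_pi fun i => ht i (mem_univ i)))]
      rw [show (fun q : ∀ i, α i × β i => ((fun i => (q i).1 : ∀ i, α i),
          (fun i => (q i).2 : ∀ i, β i))) ⁻¹' (univ.pi s ×ˢ univ.pi t) =
          (univ.pi fun i ↦ s i ×ˢ t i) by
          ext; simp [Set.mem_pi, forall_and]]
      change ((Measure.pi fun i => (volume : Measure (α i))).prod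
          (Measure.pi fun i => (volume : Measure (β i)))) _ =
        (Measure.pi fun i => (volume : Measure (α i)).prod (volume : Measure (β i))) _
      simp_rw [Measure.pi_pi, Measure.prod_prod, Measure.pi_pi, Finset.prod_mul_distrib]

theorem volume_preserving_tangent_normal (L : Fin k → Submodule ℝ (Eucl d)) :
    MeasurePreserving (fun x : Fin k → Eucl d =>
      ((fun i => (L i).orthogonalProjectionOnto (x i) : ∀ i, L i),
        (fun i => ((L i)ᗮ : Submodule ℝ (Eucl d)).orthogonalProjectionOnto (x i) :
          ∀ i, ((L i)ᗮ : Submodule ℝ (Eucl d))))) volume volume := by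
  have h1 : ∀ i, MeasurePreserving (fun x : Eucl d => ((L i).orthogonalProjectionOnto x,
      ((L i)ᗮ : Submodule ℝ (Eucl d)).orthogonalProjectionOnto x)) volume volume := fun i => by
    have := (WithLp.volume_preserving_ofLp (L i) ((L i)ᗮ : Submodule ℝ (Eucl d))).comp
      (L i).orthogonalDecomposition.measurePreserving
    have he : (fun x : Eucl d => ((L i).orthogonalProjectionOnto x,
        ((L i)ᗮ : Submodule ℝ (Eucl d)).orthogonalProjectionOnto x)) =
        WithLp.ofLp ∘ (L i).orthogonalDecomposition := by
      ext1 x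
      rw [Function.comp_apply, Submodule.orthogonalDecomposition_apply]
    rw [he]
    exact this
  exact (volume_preserving_piProd _ _).comp (volume_preserving_pi h1)

section

variable (hL : subspaceDet L ≠ 0)

theorem subspaceDet_pos (hL : subspaceDet L ≠ 0) : 0 < subspaceDet L := lt_of_le_of_ne (Real.sqrt_nonneg _) hL.symm

theorem measurable_normalEquiv_symm : Measurable (normalEquiv hL).symm :=
  ((normalEquiv hL).symm.toLinearMap.continuous_of_finiteDimensional).measurable

theorem lintegral_comp_normalEquiv_symm {H : Eucl d → ENNReal} (hH : Measurable H) :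
    ∫⁻ q, H ((normalEquiv hL).symm q) = ENNReal.ofReal (subspaceDet L) * ∫⁻ z, H z := by
  have h0 := subspaceDet_pos hL
  have h1 : (volume : Measure ((⨅ i, L i : Submodule ℝ (Eucl d)) ×
      (∀ i, ((L i)ᗮ : Submodule ℝ (Eucl d))))) =
      ENNReal.ofReal (subspaceDet L) • Measure.map (normalMap L) volume := by
    rw [map_normalMap_volume hL, smul_smul, ← ENNReal.ofReal_mul h0.le, mul_inv_cancel₀ hL,
      ENNReal.ofReal_one, one_smul]
  have hm : Measurable fun q => H ((normalEquiv hL).symm q) :=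
    hH.comp (measurable_normalEquiv_symm hL)
  rw [h1, lintegral_smul_measure, lintegral_map hm
    (normalMap L).continuous_of_finiteDimensional.measurable, smul_eq_mul]
  congr 1
  refine lintegral_congr fun z => ?_
  rw [← normalEquiv_apply hL, LinearEquiv.symm_apply_apply]

/-- Each `x i` is split into a part in `L i` and a part in its orthogonal complement. For fixed `v`
and normal parts the point `z` is fixed, and the tangential parts enter by a reflection and a shift,
which preserve volume. The remaining change of variables from `v` and the normal parts to `z`
contributes the factor `subspaceDet L`. -/
theorem lintegral_translates {g : Eucl d → (∀ i, L i) → ENNReal}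
    (hg : Measurable (Function.uncurry g)) :
    ∫⁻ x : Fin k → Eucl d, ∫⁻ v : (⨅ i, L i : Submodule ℝ (Eucl d)),
      g ((normalEquiv hL).symm (v, fun i => (L i)ᗮ.orthogonalProjectionOnto (x i)))
        (fun i => (L i).orthogonalProjectionOnto
          ((normalEquiv hL).symm (v, fun i => (L i)ᗮ.orthogonalProjectionOnto (x i)) - x i)) =
      ENNReal.ofReal (subspaceDet L) * ∫⁻ z, ∫⁻ a, g z a := by
  have hT := measurable_normalEquiv_symm hL
  set h : (∀ i, L i) × (∀ i, ((L i)ᗮ : Submodule ℝ (Eucl d))) → ENNReal := fun q =>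
    ∫⁻ v : (⨅ i, L i : Submodule ℝ (Eucl d)), g ((normalEquiv hL).symm (v, q.2))
      (fun i => (L i).orthogonalProjectionOnto ((normalEquiv hL).symm (v, q.2)) - q.1 i) with hh
  have hm3 : Measurable fun r : ((∀ i, L i) × (∀ i, ((L i)ᗮ : Submodule ℝ (Eucl d)))) ×
      (⨅ i, L i : Submodule ℝ (Eucl d)) => g ((normalEquiv hL).symm (r.2, r.1.2))
      (fun i => (L i).orthogonalProjectionOnto ((normalEquiv hL).symm (r.2, r.1.2)) - r.1.1 i) := by
    have h1 : Measurable fun r : ((∀ i, L i) × (∀ i, ((L i)ᗮ : Submodule ℝ (Eucl d)))) ×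
      (⨅ i, L i : Submodule ℝ (Eucl d)) => (normalEquiv hL).symm (r.2, r.1.2) :=
      hT.comp (by fun_prop)
    refine hg.comp (h1.prodMk (measurable_pi_lambda _ fun i => ?_))
    exact ((L i).orthogonalProjectionOnto.continuous.measurable.comp h1).sub (by fun_prop)
  have hhm : Measurable h := hm3.lintegral_prod_right'
  have e1 : ∀ x : Fin k → Eucl d, ∫⁻ v : (⨅ i, L i : Submodule ℝ (Eucl d)),
      g ((normalEquiv hL).symm (v, fun i => (L i)ᗮ.orthogonalProjectionOnto (x i)))
        (fun i => (L i).orthogonalProjectionOnto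
          ((normalEquiv hL).symm (v, fun i => (L i)ᗮ.orthogonalProjectionOnto (x i)) - x i)) =
      h ((fun i => (L i).orthogonalProjectionOnto (x i)),
        (fun i => ((L i)ᗮ : Submodule ℝ (Eucl d)).orthogonalProjectionOnto (x i))) := fun x => by
    simp only [hh, map_sub]
  simp_rw [e1]
  rw [(volume_preserving_tangent_normal L).lintegral_comp hhm, Measure.volume_eq_prod,
    lintegral_prod_symm _ hhm.aemeasurable]
  have hH : Measurable fun z => ∫⁻ a, g z a := hg.lintegral_prod_right'
  have : (volume : Measure (∀ i, L i)).IsNegInvariant := Measure.pi.isNegInvariant _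
  have e2 : ∀ b : (∀ i, ((L i)ᗮ : Submodule ℝ (Eucl d))), ∫⁻ a, h (a, b) =
      ∫⁻ v : (⨅ i, L i : Submodule ℝ (Eucl d)), ∫⁻ a, g ((normalEquiv hL).symm (v, b)) a := by
    intro b
    rw [hh, lintegral_lintegral_swap]
    · refine lintegral_congr fun v => ?_
      exact lintegral_sub_left_eq_self (fun a => g ((normalEquiv hL).symm (v, b)) a)
        (fun i => (L i).orthogonalProjectionOnto ((normalEquiv hL).symm (v, b)))
    · exact (hm3.comp (show Measurable fun r : (∀ i, L i) × (⨅ i, L i : Submodule ℝ (Eucl d)) =>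
        ((r.1, b), r.2) by fun_prop)).aemeasurable
  simp_rw [e2]
  rw [← lintegral_comp_normalEquiv_symm hL hH, Measure.volume_eq_prod, lintegral_prod_symm]
  exact (hH.comp hT).aemeasurable

/-- A point of the flat `⋂ i, (L i + x i)`. -/
def flatPoint (x : Fin k → Eucl d) : Eucl d :=
  (normalEquiv hL).symm (0, fun i => (L i)ᗮ.orthogonalProjectionOnto (x i))

theorem normalEquiv_symm_sub_mem (v : (⨅ i, L i : Submodule ℝ (Eucl d))) (x : Fin k → Eucl d)
    (i : Fin k) :
    (normalEquiv hL).symm (v, fun i => (L i)ᗮ.orthogonalProjectionOnto (x i)) - x i ∈ L i := by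
  set z := (normalEquiv hL).symm (v, fun i => (L i)ᗮ.orthogonalProjectionOnto (x i)) with hz
  have h1 : normalMap L z = (v, fun i => (L i)ᗮ.orthogonalProjectionOnto (x i)) := by
    rw [← normalEquiv_apply hL, hz, LinearEquiv.apply_symm_apply]
  have h2 := congrFun (congrArg Prod.snd h1) i
  rw [normalMap_snd] at h2
  rw [← Submodule.orthogonal_orthogonal (L i), ← Submodule.orthogonalProjectionOnto_eq_zero_iff,
    map_sub, h2, sub_self]

theorem flatPoint_sub_mem (x : Fin k → Eucl d) (i : Fin k) : flatPoint hL x - x i ∈ L i :=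
  normalEquiv_symm_sub_mem hL 0 x i

theorem normalEquiv_symm_eq (v : (⨅ i, L i : Submodule ℝ (Eucl d))) (x : Fin k → Eucl d) :
    (normalEquiv hL).symm (v, fun i => (L i)ᗮ.orthogonalProjectionOnto (x i)) =
      v + flatPoint hL x := by
  rw [LinearEquiv.symm_apply_eq, map_add, flatPoint, LinearEquiv.apply_symm_apply,
    normalEquiv_apply]
  refine Prod.ext ?_ (funext fun i => ?_)
  · simp
  · have : (L i)ᗮ.orthogonalProjectionOnto (v : Eucl d) = 0 := by
      rw [Submodule.orthogonalProjectionOnto_eq_zero_iff, Submodule.orthogonal_orthogonal]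
      exact (Submodule.mem_iInf _).1 v.2 i
    simp [this]

/-- The measure of the intersection of translates of subsets `C i` of flats `L i + p i`. -/
def sectionMeasure (p : Fin k → Eucl d) (C : Fin k → Set (Eucl d)) (x : Fin k → Eucl d) : ENNReal :=
  flatMeasure (⨅ i, L i) (flatPoint hL (x + p)) (⋂ i, x i +ᵥ C i)

theorem sectionMeasure_eq {p : Fin k → Eucl d} {C : Fin k → Set (Eucl d)} {x : Fin k → Eucl d}
    {z : Eucl d} (hz : ∀ i, z - (x i + p i) ∈ L i) :
    sectionMeasure hL p C x = flatMeasure (⨅ i, L i) z (⋂ i, x i +ᵥ C i) := by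
  rw [sectionMeasure, flatMeasure_eq]
  refine (Submodule.mem_iInf _).2 fun i => ?_
  have := (L i).sub_mem (hz i) (flatPoint_sub_mem hL (x + p) i)
  simpa using this

/-- A common translation of all the sets moves their intersection rigidly, so one of the translation
vectors can be fixed. -/
theorem sectionMeasure_add_const (p : Fin k → Eucl d) {C : Fin k → Set (Eucl d)}
    (hC : ∀ i, MeasurableSet (C i)) (x : Fin k → Eucl d) (t : Eucl d) :
    sectionMeasure hL p C (x + fun _ => t) = sectionMeasure hL p C x := by
  rw [sectionMeasure_eq hL (z := t + flatPoint hL (x + p)), sectionMeasure,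
    ← flatMeasure_vadd_apply t (MeasurableSet.iInter fun i => (hC i).const_vadd (x i))]
  · congr 1
    ext z
    simp only [mem_iInter, mem_vadd_set_iff_sub_mem, Pi.add_apply]
    refine forall_congr' fun i => ?_
    rw [show z - (x i + t) = z - t - x i by abel]
  · intro i
    have := flatPoint_sub_mem hL (x + p) i
    convert this using 1
    simp only [Pi.add_apply]
    abel

theorem sectionMeasure_eq_lintegral (p : Fin k → Eucl d) {C : Fin k → Set (Eucl d)}
    (hC : ∀ i, MeasurableSet (C i)) (x : Fin k → Eucl d) :
    sectionMeasure hL p C x = ∫⁻ v : (⨅ i, L i : Submodule ℝ (Eucl d)),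
      (⋂ i, x i +ᵥ C i).indicator 1 ((v : Eucl d) + flatPoint hL (x + p)) := by
  have hm : MeasurableSet (⋂ i, x i +ᵥ C i) := MeasurableSet.iInter fun i => (hC i).const_vadd (x i)
  rw [sectionMeasure, flatMeasure_apply _ _ hm]
  have hm' : MeasurableSet {v : (⨅ i, L i : Submodule ℝ (Eucl d)) |
      (v : Eucl d) + flatPoint hL (x + p) ∈ ⋂ i, x i +ᵥ C i} :=
    measurableSet_preimage (by fun_prop) hm
  rw [← lintegral_indicator_one hm']
  rfl

theorem measurable_sectionMeasure (p : Fin k → Eucl d) {C : Fin k → Set (Eucl d)}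
    (hC : ∀ i, MeasurableSet (C i)) : Measurable (sectionMeasure hL p C) := by
  have h1 : MeasurableSet {r : (Fin k → Eucl d) × (⨅ i, L i : Submodule ℝ (Eucl d)) |
      (r.2 : Eucl d) + flatPoint hL (r.1 + p) ∈ ⋂ i, r.1 i +ᵥ C i} := by
    have hp : Measurable fun r : (Fin k → Eucl d) × (⨅ i, L i : Submodule ℝ (Eucl d)) =>
        (r.2 : Eucl d) + flatPoint hL (r.1 + p) := by
      refine (measurable_subtype_coe.comp measurable_snd).add
        ((measurable_normalEquiv_symm hL).comp (measurable_const.prodMk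
          (measurable_pi_lambda _ fun i => ?_)))
      exact ((L i)ᗮ.orthogonalProjectionOnto.continuous.measurable).comp
        (g := ⇑((L i)ᗮ.orthogonalProjectionOnto)) (by fun_prop)
    have : {r : (Fin k → Eucl d) × (⨅ i, L i : Submodule ℝ (Eucl d)) |
      (r.2 : Eucl d) + flatPoint hL (r.1 + p) ∈ ⋂ i, r.1 i +ᵥ C i} =
      ⋂ i, {r | (r.2 : Eucl d) + flatPoint hL (r.1 + p) - r.1 i ∈ C i} := by
      ext r
      simp only [mem_ofPred_eq, mem_iInter, mem_vadd_set_iff_sub_mem]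
    rw [this]
    exact MeasurableSet.iInter fun i => (hp.sub (by fun_prop)) (hC i)
  have h2 := measurable_measure_prodMk_left (ν := (volume : Measure (⨅ i, L i : Submodule ℝ (Eucl d)))) h1
  convert h2 using 1
  ext1 x
  exact flatMeasure_apply _ _ (MeasurableSet.iInter fun i => (hC i).const_vadd (x i))

/-- Integration over all the translations would diverge because of common translations. The window
`B` for one of them makes the integral usable while all variables remain symmetric for
`lintegral_translates`. -/
theorem lintegral_window_sectionMeasure (p : Fin k → Eucl d) {C : Fin k → Set (Eucl d)}
    (hC : ∀ i, MeasurableSet (C i)) (i₀ : Fin k) {B : Set (Eucl d)} (hB : MeasurableSet B) :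
    ∫⁻ x : Fin k → Eucl d, B.indicator 1 (x i₀) * sectionMeasure hL p C x =
      volume B * (ENNReal.ofReal (subspaceDet L) * ∏ i, flatMeasure (L i) (p i) (C i)) := by
  set D : Set (∀ i, L i) := univ.pi fun i => {a : L i | (a : Eucl d) + p i ∈ C i} with hD
  have hDm : MeasurableSet D := MeasurableSet.univ_pi fun i =>
    measurableSet_preimage (by fun_prop) (hC i)
  -- For a point `z` of the section and `a i` its position relative to the i-th flat, `z - (a i₀ + p
  -- i₀)` recovers the translation of index `i₀`, and `D` says that `z` lies in every translated
  -- set.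
  set g : Eucl d → (∀ i, L i) → ENNReal := fun z a =>
    B.indicator 1 (z - (a i₀ + p i₀)) * D.indicator 1 a with hg
  have hgm : Measurable (Function.uncurry g) := by
    refine Measurable.mul ?_ ?_
    · exact (measurable_one.indicator hB).comp (by fun_prop)
    · exact (measurable_one.indicator hDm).comp measurable_snd
  have e1 : ∫⁻ x : Fin k → Eucl d, B.indicator 1 (x i₀) * sectionMeasure hL p C x =
      ∫⁻ x : Fin k → Eucl d, B.indicator 1 ((x - p) i₀) * sectionMeasure hL p C (x - p) :=
    (lintegral_sub_right_eq_self
      (fun x => B.indicator 1 (x i₀) * sectionMeasure hL p C x) p).symm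
  have e2 : ∀ x : Fin k → Eucl d, B.indicator 1 ((x - p) i₀) * sectionMeasure hL p C (x - p) =
      ∫⁻ v : (⨅ i, L i : Submodule ℝ (Eucl d)),
      g ((normalEquiv hL).symm (v, fun i => (L i)ᗮ.orthogonalProjectionOnto (x i)))
        (fun i => (L i).orthogonalProjectionOnto
          ((normalEquiv hL).symm (v, fun i => (L i)ᗮ.orthogonalProjectionOnto (x i)) - x i)) := by
    intro x
    have hproj : ∀ (v : (⨅ i, L i : Submodule ℝ (Eucl d))) (i : Fin k),
        ((L i).orthogonalProjectionOnto ((normalEquiv hL).symm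
          (v, fun i => (L i)ᗮ.orthogonalProjectionOnto (x i)) - x i) : Eucl d) =
        (v : Eucl d) + flatPoint hL x - x i := by
      intro v i
      rw [← normalEquiv_symm_eq]
      exact congrArg Subtype.val (Submodule.orthogonalProjectionOnto_mem_subspace_eq_self
        (⟨_, normalEquiv_symm_sub_mem hL v x i⟩ : L i))
    rw [sectionMeasure_eq_lintegral hL p hC, sub_add_cancel, ← lintegral_const_mul'']
    · refine lintegral_congr fun v => ?_
      simp only [hg, hproj]
      rw [normalEquiv_symm_eq]
      congr 1
      · congr 1
        simp only [Pi.sub_apply]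
        abel
      · have : ((v : Eucl d) + flatPoint hL x ∈ ⋂ i, (x - p) i +ᵥ C i) ↔
            (fun i => (L i).orthogonalProjectionOnto ((v : Eucl d) + flatPoint hL x - x i)) ∈ D := by
          simp only [hD, mem_iInter, mem_univ_pi, mem_ofPred_eq, mem_vadd_set_iff_sub_mem]
          refine forall_congr' fun i => ?_
          rw [← normalEquiv_symm_eq, hproj, normalEquiv_symm_eq]
          rw [show (v : Eucl d) + flatPoint hL x - (x - p) i =
            (v : Eucl d) + flatPoint hL x - x i + p i by simp only [Pi.sub_apply]; abel]
        by_cases h : (v : Eucl d) + flatPoint hL x ∈ ⋂ i, (x - p) i +ᵥ C i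
        · rw [indicator_of_mem h, indicator_of_mem (this.1 h)]; rfl
        · rw [indicator_of_notMem h, indicator_of_notMem (fun h' => h (this.2 h'))]
    · refine ((measurable_one.indicator (MeasurableSet.iInter fun i =>
        (hC i).const_vadd ((x - p) i))).comp ?_).aemeasurable
      fun_prop
  rw [e1, lintegral_congr e2, lintegral_translates hL hgm, lintegral_lintegral_swap
    hgm.aemeasurable]
  have e3 : ∀ a : ∀ i, L i, ∫⁻ z, g z a = volume B * D.indicator 1 a := by
    intro a
    rw [hg, lintegral_mul_const, lintegral_sub_right_eq_self (fun z => B.indicator 1 z),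
      lintegral_indicator_one hB]
    exact (measurable_one.indicator hB).comp (by fun_prop)
  simp_rw [e3]
  rw [lintegral_const_mul _ (measurable_one.indicator hDm), lintegral_indicator_one hDm, hD,
    volume_pi_pi, mul_left_comm]
  congr 2
  exact Finset.prod_congr rfl fun i _ => (flatMeasure_apply _ _ (hC i)).symm

end

/-- Linear coarea formula for the intersection of translates of subsets of flats. -/
theorem lintegral_sectionMeasure {n : ℕ} {L : Fin (n + 1) → Submodule ℝ (Eucl d)}
    (hL : subspaceDet L ≠ 0) (p : Fin (n + 1) → Eucl d) {C : Fin (n + 1) → Set (Eucl d)}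
    (hC : ∀ i, MeasurableSet (C i)) (i₀ : Fin (n + 1)) :
    ∫⁻ y : Fin n → Eucl d, sectionMeasure hL p C (i₀.insertNth (α := fun _ => Eucl d) 0 y) =
      ENNReal.ofReal (subspaceDet L) * ∏ i, flatMeasure (L i) (p i) (C i) := by
  -- Any window of positive finite volume would do. The inner integral does not depend on the
  -- translation `t` of index `i₀`, so the window splits off as a factor and cancels.
  set B := Metric.ball (0 : Eucl d) 1
  have hB : MeasurableSet B := Metric.isOpen_ball.measurableSet
  have h1 := lintegral_window_sectionMeasure hL p hC i₀ hB
  have hm := measurable_sectionMeasure hL p hC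
  have hGm : Measurable fun x : Fin (n + 1) → Eucl d =>
      B.indicator (1 : Eucl d → ENNReal) (x i₀) * sectionMeasure hL p C x :=
    ((measurable_one.indicator hB).comp (by fun_prop)).mul hm
  have hmp := (volume_preserving_piFinSuccAbove (fun _ : Fin (n + 1) => Eucl d) i₀).symm
  have h3 := lintegral_prod (μ := volume) (ν := volume) _ (hGm.comp hmp.measurable).aemeasurable
  have h4 := h3.symm.trans ((hmp.lintegral_comp hGm).trans h1)
  have h2 : ∀ t : Eucl d, ∫⁻ y : Fin n → Eucl d,
      B.indicator (1 : Eucl d → ENNReal)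
        ((MeasurableEquiv.piFinSuccAbove (fun _ : Fin (n + 1) => Eucl d) i₀).symm (t, y) i₀) *
        sectionMeasure hL p C
          ((MeasurableEquiv.piFinSuccAbove (fun _ : Fin (n + 1) => Eucl d) i₀).symm (t, y)) =
      B.indicator 1 t * ∫⁻ y : Fin n → Eucl d,
        sectionMeasure hL p C (i₀.insertNth (α := fun _ => Eucl d) 0 y) := by
    intro t
    have e : ∀ y : Fin n → Eucl d,
        (MeasurableEquiv.piFinSuccAbove (fun _ : Fin (n + 1) => Eucl d) i₀).symm (t, y) =
        i₀.insertNth (α := fun _ => Eucl d) t y := fun y => rfl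
    simp_rw [e, Fin.insertNth_apply_same]
    have hins : ∀ s : Eucl d, Measurable fun y : Fin n → Eucl d =>
        i₀.insertNth (α := fun _ => Eucl d) s y := fun s =>
      (MeasurableEquiv.piFinSuccAbove (fun _ : Fin (n + 1) => Eucl d) i₀).symm.measurable.comp
        measurable_prodMk_left
    have hmt : Measurable fun y : Fin n → Eucl d =>
        sectionMeasure hL p C (i₀.insertNth (α := fun _ => Eucl d) t y) := hm.comp (hins t)
    rw [lintegral_const_mul _ hmt]
    congr 1
    rw [← lintegral_add_right_eq_self (fun y : Fin n → Eucl d =>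
      sectionMeasure hL p C (i₀.insertNth (α := fun _ => Eucl d) t y)) (fun _ => t)]
    refine lintegral_congr fun y => ?_
    rw [← sectionMeasure_add_const hL p hC (i₀.insertNth (α := fun _ => Eucl d) 0 y) t]
    congr 1
    ext1 i
    refine Fin.succAboveCases i₀ ?_ (fun l => ?_) i
    · simp
    · simp
  have h5 := (lintegral_congr h2).symm.trans h4
  rw [lintegral_mul_const _ (measurable_one.indicator hB), lintegral_indicator_one hB] at h5
  have hB0 : volume B ≠ 0 := (Metric.measure_ball_pos volume 0 one_pos).ne'
  have hBt : volume B ≠ ⊤ := measure_ball_lt_top.ne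
  exact (ENNReal.mul_right_inj hB0 hBt).1 h5

end PolytopeIntegral

end

noncomputable section

namespace PolytopeIntegral

variable {d k : ℕ}

/-! ### Values at polytopal sets -/

theorem evalAt_coe (φ : Polytope d → ℝ) (K : Polytope d) : evalAt φ (K : Set (Eucl d)) = φ K := by
  have h : ∃ K' : Polytope d, (K' : Set (Eucl d)) = K := ⟨K, rfl⟩
  rw [evalAt, dif_pos h, Polytope.ext h.choose_spec]

theorem evalAt_empty (φ : Polytope d → ℝ) : evalAt φ ∅ = 0 :=
  dif_neg fun ⟨K, hK⟩ => K.nonempty.ne_empty hK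

/-! ### Faces of intersections -/

theorem minFace_subset_minFace {K : Set (Eucl d)} (hK : Convex ℝ K) {p q : Eucl d}
    (hq : q ∈ K) (h : p ∈ minFace K q) : minFace K p ⊆ minFace K q := by
  rintro x ⟨hx, hx'⟩
  refine ⟨hx, ?_⟩
  have h1 := add_mem_feasibleCone hK hq h.2 (feasibleCone_subset_of_mem_minFace hK h hx')
  rw [sub_add_sub_cancel] at h1
  exact h1

theorem minFace_eq_of_mem {K : Set (Eucl d)} (hK : Convex ℝ K) {p q : Eucl d}
    (hp : p ∈ minFace K q) (hq : q ∈ minFace K p) : minFace K p = minFace K q :=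
  (minFace_subset_minFace hK hq.1 hp).antisymm (minFace_subset_minFace hK hp.1 hq)

theorem minFace_iInter_vadd {P : Fin k → Set (Eucl d)} (hP : ∀ i, Convex ℝ (P i))
    {x : Fin k → Eucl d} {z : Eucl d} (hz : ∀ i, z - x i ∈ P i) :
    minFace (⋂ i, x i +ᵥ P i) z = ⋂ i, x i +ᵥ minFace (P i) (z - x i) := by
  rw [minFace_iInter (fun i => (hP i).vadd (x i)) fun i => mem_vadd_set_iff_sub_mem.2 (hz i)]
  simp only [minFace_vadd]

theorem feasibleCone_iInter_vadd {P : Fin k → Set (Eucl d)} (hP : ∀ i, Convex ℝ (P i))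
    {x : Fin k → Eucl d} {z : Eucl d} (hz : ∀ i, z - x i ∈ P i) :
    feasibleCone (⋂ i, x i +ᵥ P i) z = ⋂ i, feasibleCone (P i) (z - x i) := by
  rw [feasibleCone_iInter (fun i => (hP i).vadd (x i)) fun i => mem_vadd_set_iff_sub_mem.2 (hz i)]
  simp only [feasibleCone_vadd]

theorem vectorSpan_minFace_iInter_vadd {P : Fin k → Set (Eucl d)} (hP : ∀ i, Convex ℝ (P i))
    {x : Fin k → Eucl d} {z : Eucl d} (hz : ∀ i, z - x i ∈ P i) :
    vectorSpan ℝ (minFace (⋂ i, x i +ᵥ P i) z) =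
      ⨅ i, vectorSpan ℝ (minFace (P i) (z - x i)) := by
  have hK : Convex ℝ (⋂ i, x i +ᵥ P i) := convex_iInter fun i => (hP i).vadd (x i)
  have hzK : z ∈ ⋂ i, x i +ᵥ P i := mem_iInter.2 fun i => mem_vadd_set_iff_sub_mem.2 (hz i)
  rw [vectorSpan_minFace hK hzK]
  ext v
  simp only [Submodule.mem_iInf, vectorSpan_minFace (hP _) (hz _)]
  change (_ ∧ _) ↔ ∀ i, (_ ∧ _)
  rw [feasibleCone_iInter_vadd hP hz, mem_iInter, mem_iInter, forall_and]

/-- Two points with the same minimal face in the intersection lie in each other's minimal faces in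
every `P i`; so a face of the intersection determines a tuple of faces. -/
theorem minFace_eq_of_minFace_iInter_vadd_eq {P : Fin k → Set (Eucl d)} (hP : ∀ i, Convex ℝ (P i))
    {x : Fin k → Eucl d} {z w : Eucl d} (hz : ∀ i, z - x i ∈ P i) (hw : ∀ i, w - x i ∈ P i)
    (h : minFace (⋂ i, x i +ᵥ P i) z = minFace (⋂ i, x i +ᵥ P i) w) (i : Fin k) :
    minFace (P i) (z - x i) = minFace (P i) (w - x i) := by
  have hzK : z ∈ ⋂ i, x i +ᵥ P i := mem_iInter.2 fun i => mem_vadd_set_iff_sub_mem.2 (hz i)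
  have hwK : w ∈ ⋂ i, x i +ᵥ P i := mem_iInter.2 fun i => mem_vadd_set_iff_sub_mem.2 (hw i)
  obtain ⟨h1, h2⟩ := mem_minFace_comm hzK hwK h
  rw [minFace_iInter_vadd hP hw, mem_iInter] at h1
  rw [minFace_iInter_vadd hP hz, mem_iInter] at h2
  exact minFace_eq_of_mem (hP i) (mem_vadd_set_iff_sub_mem.1 (h1 i))
    (mem_vadd_set_iff_sub_mem.1 (h2 i))

/-- Translation vectors such that the faces of the translates meet only in general position. -/
def IsGeneric (P : Fin k → Polytope d) (x : Fin k → Eucl d) : Prop :=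
  ∀ z, (∀ i, z - x i ∈ (P i : Set (Eucl d))) →
    subspaceDet (fun i => vectorSpan ℝ (minFace (P i : Set (Eucl d)) (z - x i))) ≠ 0

/-- The measure of the intersection of the translates of the parts in `A i` of the faces `F i`. -/
def sectionVol {m : Fin k → ℕ} {P : Fin k → Polytope d} (F : ∀ i, Face (m i) (P i))
    (A : Fin k → Set (Eucl d)) (x : Fin k → Eucl d) : ℝ :=
  open Classical in
  if h : subspaceDet (fun i => vectorSpan ℝ (F i : Set (Eucl d))) ≠ 0 then
    (sectionMeasure h (fun i => (F i).nonempty.some)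
      (fun i => A i ∩ intrinsicInterior ℝ (F i : Set (Eucl d))) x).toReal else 0

theorem exists_of_sectionVol_ne_zero {m : Fin k → ℕ} {P : Fin k → Polytope d}
    {F : ∀ i, Face (m i) (P i)} {A : Fin k → Set (Eucl d)} {x : Fin k → Eucl d}
    (h : sectionVol F A x ≠ 0) :
    subspaceDet (fun i => vectorSpan ℝ (F i : Set (Eucl d))) ≠ 0 ∧
      ∃ z, ∀ i, z - x i ∈ intrinsicInterior ℝ (F i : Set (Eucl d)) := by
  rw [sectionVol] at h
  split_ifs at h with hL
  · refine ⟨hL, ?_⟩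
    by_contra hne
    refine h ?_
    rw [sectionMeasure, show (⋂ i, x i +ᵥ (A i ∩ intrinsicInterior ℝ (F i : Set (Eucl d)))) = ∅ from ?_,
      measure_empty, ENNReal.toReal_zero]
    refine eq_empty_of_forall_notMem fun z hz => hne ⟨z, fun i => ?_⟩
    exact (mem_vadd_set_iff_sub_mem.1 (mem_iInter.1 hz i)).2
  · exact absurd rfl h

theorem sectionVol_eq {m : Fin k → ℕ} {P : Fin k → Polytope d}
    {F : ∀ i, Face (m i) (P i)} {A : Fin k → Set (Eucl d)} {x : Fin k → Eucl d} {z : Eucl d}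
    (hL : subspaceDet (fun i => vectorSpan ℝ (F i : Set (Eucl d))) ≠ 0)
    (hz : ∀ i, z - x i ∈ (F i : Set (Eucl d))) :
    sectionVol F A x = (flatMeasure (⨅ i, vectorSpan ℝ (F i : Set (Eucl d))) z
      (⋂ i, x i +ᵥ (A i ∩ intrinsicInterior ℝ (F i : Set (Eucl d))))).toReal := by
  rw [sectionVol, dif_pos hL, sectionMeasure_eq (z := z)]
  intro i
  rw [← sub_sub]
  exact vsub_mem_vectorSpan ℝ (hz i) (F i).nonempty.some_mem

theorem mem_mixedIndices_of_finrank [NeZero k] {j : ℕ} {L : Fin k → Submodule ℝ (Eucl d)}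
    (hL : subspaceDet L ≠ 0) (hj : Module.finrank ℝ (⨅ i, L i : Submodule ℝ (Eucl d)) = j) :
    (fun i => Module.finrank ℝ (L i)) ∈ mixedIndices d k j := by
  have h := sum_finrank_of_subspaceDet_ne_zero hL
  obtain ⟨n, rfl⟩ := Nat.exists_eq_succ_of_ne_zero (NeZero.ne k)
  simp only [mixedIndices, Finset.mem_filter, Fintype.mem_piFinset, Finset.mem_Icc]
  refine ⟨fun i => ⟨hj ▸ Submodule.finrank_mono (iInf_le _ i), ?_⟩, ?_⟩
  · simpa using Submodule.finrank_le (L i)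
  · rw [Nat.succ_mul] at h
    simp only [Nat.succ_eq_add_one, Nat.add_sub_cancel]
    have h' := h
    rw [hj] at h'
    linarith

theorem finrank_iInf_of_mem_mixedIndices [NeZero k] {j : ℕ} {L : Fin k → Submodule ℝ (Eucl d)}
    (hL : subspaceDet L ≠ 0) {m : Fin k → ℕ} (hm : m ∈ mixedIndices d k j)
    (hLm : ∀ i, Module.finrank ℝ (L i) = m i) :
    Module.finrank ℝ (⨅ i, L i : Submodule ℝ (Eucl d)) = j := by
  have h := sum_finrank_of_subspaceDet_ne_zero hL
  obtain ⟨n, rfl⟩ := Nat.exists_eq_succ_of_ne_zero (NeZero.ne k)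
  have h2 := (Finset.mem_filter.1 hm).2
  simp only [Nat.succ_eq_add_one, Nat.add_sub_cancel] at h2
  rw [Nat.succ_mul, Finset.sum_congr rfl fun i _ => hLm i, h2] at h
  omega

/-- The faces of the intersection of polytopes in general position are the intersections of
faces. -/
theorem IsAssociatedFunction.evalAt_iInter [NeZero k] {j : ℕ}
    {Φ : Polytope d → SignedMeasure (Eucl d)} {f : Set (Eucl d) → ℝ}
    (hf : IsAssociatedFunction j Φ f) (P : Fin k → Polytope d) {A : Fin k → Set (Eucl d)}
    (hA : ∀ i, MeasurableSet (A i)) {x : Fin k → Eucl d} (hx : IsGeneric P x) :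
    evalAt (fun K => Φ K (⋂ i, x i +ᵥ A i)) (⋂ i, x i +ᵥ (P i : Set (Eucl d))) =
      ∑ m ∈ mixedIndices d k j, ∑ F : ((i : Fin k) → Face (m i) (P i)),
        f (mixedNormals (fun i => (P i : Set (Eucl d))) (fun i => (F i : Set (Eucl d)))) *
          sectionVol F A x := by
  have hconv : ∀ i, Convex ℝ (P i : Set (Eucl d)) := fun i => (P i).isPolytopal.convex
  -- An empty intersection has value 0, and then no tuple of faces has a nonzero section volume.
  rcases (⋂ i, x i +ᵥ (P i : Set (Eucl d))).eq_empty_or_nonempty with he | hne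
  · rw [he, evalAt_empty]
    refine (Finset.sum_eq_zero fun m _ => Finset.sum_eq_zero fun F _ => ?_).symm
    by_contra h0
    obtain ⟨-, z, hz⟩ := exists_of_sectionVol_ne_zero (right_ne_zero_of_mul h0)
    refine (eq_empty_iff_forall_notMem.1 he z) (mem_iInter.2 fun i => ?_)
    exact mem_vadd_set_iff_sub_mem.2 ((F i).subset (intrinsicInterior_subset (hz i)))
  set K : Polytope d := Polytope.mk' _ (IsPolytopal.iInter fun i => (P i).isPolytopal.vadd (x i)) hne
    with hK
  have hKc : (K : Set (Eucl d)) = ⋂ i, x i +ᵥ (P i : Set (Eucl d)) := rfl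
  have hBm : MeasurableSet (⋂ i, x i +ᵥ A i) := MeasurableSet.iInter fun i => (hA i).const_vadd _
  rw [← hKc, evalAt_coe, hf K]
  change faceKernel f j K _ = _
  rw [faceKernel_apply _ _ _ hBm, Finset.sum_sigma']
  choose z hz using fun G : Face j K => G.exists_mem_intrinsicInterior
  have hzP : ∀ (G : Face j K) i, z G - x i ∈ (P i : Set (Eucl d)) := fun G i =>
    mem_vadd_set_iff_sub_mem.1 (mem_iInter.1 (G.subset (intrinsicInterior_subset (hz G))) i)
  have hzG : ∀ G : Face j K, minFace (⋂ i, x i +ᵥ (P i : Set (Eucl d))) (z G) = G := fun G =>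
    G.minFace_eq (hz G)
  -- `e` sends a `j`-face of the intersection to the tuple of minimal faces of the `P i` at a chosen
  -- relative interior point.
  obtain ⟨e, he1, he2⟩ : ∃ e : Face j K → Σ m : Fin k → ℕ, ∀ i, Face (m i) (P i),
      (∀ G, (e G).1 = fun i =>
        Module.finrank ℝ (vectorSpan ℝ (minFace (P i : Set (Eucl d)) (z G - x i)))) ∧
      ∀ G i, ((e G).2 i : Set (Eucl d)) = minFace (P i : Set (Eucl d)) (z G - x i) :=
    ⟨fun G => ⟨_, fun i => Face.ofPoint (P i) (hzP G i) rfl⟩, fun _ => rfl, fun _ _ => rfl⟩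
  have hspan : ∀ G : Face j K, vectorSpan ℝ (G : Set (Eucl d)) =
      ⨅ i, vectorSpan ℝ (minFace (P i : Set (Eucl d)) (z G - x i)) := fun G => by
    rw [← hzG, vectorSpan_minFace_iInter_vadd hconv (hzP G)]
  refine Finset.sum_of_injOn e ?_ ?_ ?_ ?_
  · intro G _ G' _ h
    have h1 : ∀ i, minFace (P i : Set (Eucl d)) (z G - x i) =
        minFace (P i : Set (Eucl d)) (z G' - x i) := fun i => by
      rw [← he2, ← he2, h]
    ext1
    rw [← hzG G, ← hzG G', minFace_iInter_vadd hconv (hzP G), minFace_iInter_vadd hconv (hzP G')]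
    simp only [h1]
  · intro G _
    simp only [Finset.coe_sigma, mem_sigma_iff, Finset.mem_coe, and_true, Finset.coe_univ, mem_univ]
    rw [he1]
    exact mem_mixedIndices_of_finrank (hx (z G) (hzP G)) (by rw [← hspan, G.finrank_vectorSpan])
  -- A tuple with nonzero section volume has a common relative interior point `w`. The minimal face
  -- of the intersection at `w` has dimension `j` and is mapped to this tuple, so tuples outside the
  -- range contribute nothing.
  · rintro ⟨m, F⟩ hmF hnot
    have hm : m ∈ mixedIndices d k j := (Finset.mem_sigma.1 hmF).1
    by_contra h0
    obtain ⟨hL, w, hw⟩ := exists_of_sectionVol_ne_zero (right_ne_zero_of_mul h0)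
    refine hnot ?_
    have hwP : ∀ i, w - x i ∈ (P i : Set (Eucl d)) := fun i =>
      (F i).subset (intrinsicInterior_subset (hw i))
    have hwF : ∀ i, minFace (P i : Set (Eucl d)) (w - x i) = F i := fun i => (F i).minFace_eq (hw i)
    have hwK : w ∈ (K : Set (Eucl d)) := by
      rw [hKc]
      exact mem_iInter.2 fun i => mem_vadd_set_iff_sub_mem.2 (hwP i)
    have hdim : Module.finrank ℝ (vectorSpan ℝ (minFace (K : Set (Eucl d)) w)) = j := by
      rw [hKc, vectorSpan_minFace_iInter_vadd hconv hwP]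
      rw [iInf_congr fun i => congrArg (vectorSpan ℝ) (hwF i)]
      exact finrank_iInf_of_mem_mixedIndices hL hm fun i => (F i).finrank_vectorSpan
    refine ⟨Face.ofPoint K hwK hdim, Finset.mem_coe.2 (Finset.mem_univ _), ?_⟩
    have h1 : ∀ i, minFace (P i : Set (Eucl d)) (z (Face.ofPoint K hwK hdim) - x i) = F i := by
      intro i
      rw [← hwF i]
      exact minFace_eq_of_minFace_iInter_vadd_eq hconv (hzP _) hwP (hzG _) i
    have h2 : (fun i => Module.finrank ℝ (vectorSpan ℝ (minFace (P i : Set (Eucl d))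
        (z (Face.ofPoint K hwK hdim) - x i)))) = m := by
      ext1 i
      rw [h1, (F i).finrank_vectorSpan]
    have key : ∀ s t : Σ m : Fin k → ℕ, ∀ i, Face (m i) (P i), s.1 = t.1 →
        (∀ i, (s.2 i : Set (Eucl d)) = t.2 i) → s = t := by
      rintro ⟨m₁, F₁⟩ ⟨m₂, F₂⟩ h h'
      obtain rfl : m₁ = m₂ := h
      exact congrArg _ (funext fun i => Face.ext (h' i))
    exact key _ _ ((he1 _).trans h2) fun i => (he2 _ i).trans (h1 i)
  · intro G _
    have hL := hx (z G) (hzP G)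
    have e1 : f (sphericalNormals K G) = f (mixedNormals (fun i => (P i : Set (Eucl d)))
        (fun i => ((e G).2 i : Set (Eucl d)))) := by
      rw [show (fun i => ((e G).2 i : Set (Eucl d))) =
        fun i => minFace (P i : Set (Eucl d)) (z G - x i) from funext fun i => he2 G i]
      have hzK : z G ∈ (K : Set (Eucl d)) := G.subset (intrinsicInterior_subset (hz G))
      rw [mixedNormals_eq (fun i => (P i).isPolytopal) (hzP G), ← feasibleCone_iInter_vadd hconv (hzP G),
        ← sphericalNormals_minFace (K := ⋂ i, x i +ᵥ (P i : Set (Eucl d))) hzK, hzG, hKc]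
    have e2 : G.lebesgue.real (⋂ i, x i +ᵥ A i) = sectionVol (e G).2 A x := by
      have hL' : subspaceDet (fun i => vectorSpan ℝ ((e G).2 i : Set (Eucl d))) ≠ 0 := by
        simpa only [he2] using hL
      rw [sectionVol_eq (z := z G) hL' fun i => by rw [he2]; exact mem_minFace_self (hzP G i),
        Measure.real, G.lebesgue_apply (intrinsicInterior_subset (hz G)) hBm, hspan]
      simp only [he2]
      congr 2
      ext w
      -- The relative interior of `G` is the intersection of the translated relative interiors of
      -- the faces in its tuple.
      have hGw : w ∈ intrinsicInterior ℝ (G : Set (Eucl d)) ↔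
          ∀ i, w - x i ∈ intrinsicInterior ℝ (minFace (P i : Set (Eucl d)) (z G - x i)) := by
        have hzK : z G ∈ (K : Set (Eucl d)) := G.subset (intrinsicInterior_subset (hz G))
        rw [← G.minFace_eq (hz G), K.mem_intrinsicInterior_minFace_iff hzK, hKc]
        simp only [(P _).mem_intrinsicInterior_minFace_iff (hzP G _), mem_iInter,
          mem_vadd_set_iff_sub_mem]
        constructor
        · rintro ⟨h1, h2⟩ i
          exact ⟨h1 i, minFace_eq_of_minFace_iInter_vadd_eq hconv h1 (hzP G) h2 i⟩
        · intro h
          refine ⟨fun i => (h i).1, ?_⟩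
          rw [minFace_iInter_vadd hconv (hzP G), minFace_iInter_vadd hconv fun i => (h i).1]
          simp only [(h _).2]
      rw [mem_inter_iff, hGw]
      simp only [mem_iInter, mem_vadd_set_iff_sub_mem, mem_inter_iff, forall_and]
    rw [e1, e2]

/-! ### Integration -/

theorem volume_hyperplane {ι E : Type*} [Fintype ι] [NormedAddCommGroup E] [InnerProductSpace ℝ E]
    [FiniteDimensional ℝ E] [MeasurableSpace E] [BorelSpace E] {u : ι → E}
    (hu : ∃ i, u i ≠ 0) (c : ℝ) : volume {y : ι → E | ∑ i, ⟪u i, y i⟫ = c} = 0 := by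
  classical
  let ℓ : (ι → E) →ₗ[ℝ] ℝ := ∑ i, (innerₛₗ ℝ (u i)).comp (LinearMap.proj i)
  have hℓ : ∀ y, ℓ y = ∑ i, ⟪u i, y i⟫ := fun y => by simp [ℓ, LinearMap.sum_apply]
  rcases {y : ι → E | ∑ i, ⟪u i, y i⟫ = c}.eq_empty_or_nonempty with h | ⟨y₀, hy₀⟩
  · rw [h, measure_empty]
  refine measure_mono_null ?_ (Measure.addHaar_affineSubspace volume
    (AffineSubspace.mk' y₀ (LinearMap.ker ℓ)) ?_)
  · intro y hy
    rw [SetLike.mem_coe, AffineSubspace.mem_mk', LinearMap.mem_ker, vsub_eq_sub, map_sub, hℓ, hℓ]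
    rw [mem_ofPred_eq] at hy hy₀
    rw [hy, hy₀, sub_self]
  · intro h
    obtain ⟨i, hi⟩ := hu
    have h1 : LinearMap.ker ℓ = ⊤ := by
      rw [← AffineSubspace.direction_mk' y₀ (LinearMap.ker ℓ), h, AffineSubspace.direction_top]
    have h2 : ℓ (Pi.single i (u i)) = 0 := by
      rw [LinearMap.ker_eq_top.1 h1, LinearMap.zero_apply]
    rw [hℓ, Finset.sum_eq_single i (fun l _ hl => by simp [hl]) (by simp)] at h2
    exact hi (by simpa using h2)

variable {n : ℕ}

/-- With dependent normals `u i` of sum zero, pairing `z - x i - a i` with `u i` and summing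
eliminates `z` and leaves one linear equation for the translations. It is nontrivial in the free
translations: if only `u i₀` could be nonzero, the zero sum would kill it too. -/
theorem volume_translates_inter_eq_zero {F : Fin (n + 1) → Set (Eucl d)}
    (hF : subspaceDet (fun i => vectorSpan ℝ (F i)) = 0) (i₀ : Fin (n + 1)) :
    volume {y : Fin n → Eucl d |
      ∃ z, ∀ i, z - i₀.insertNth (α := fun _ => Eucl d) 0 y i ∈ F i} = 0 := by
  obtain ⟨u, hu, hsum, hne⟩ := exists_dependent_normals hF
  by_cases hFne : ∀ i, (F i).Nonempty
  swap
  · push Not at hFne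
    obtain ⟨i, hi⟩ := hFne
    rw [show {y : Fin n → Eucl d |
      ∃ z, ∀ i, z - i₀.insertNth (α := fun _ => Eucl d) 0 y i ∈ F i} = ∅ from ?_, measure_empty]
    refine eq_empty_of_forall_notMem ?_
    rintro y ⟨z, hz⟩
    have := hz i
    rw [hi] at this
    exact this
  choose a ha using hFne
  have hne' : ∃ l : Fin n, u (i₀.succAbove l) ≠ 0 := by
    by_contra h0
    push Not at h0
    obtain ⟨i, hi⟩ := hne
    rw [Fin.sum_univ_succAbove _ i₀, Finset.sum_eq_zero fun l _ => h0 l, add_zero] at hsum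
    refine hi (Fin.succAboveCases i₀ ?_ (fun l => ?_) i)
    · exact hsum
    · exact h0 l
  refine measure_mono_null ?_ (volume_hyperplane hne' (-∑ i, ⟪u i, a i⟫))
  rintro y ⟨z, hz⟩
  set x := i₀.insertNth (α := fun _ => Eucl d) 0 y with hx
  have h1 : ∀ i, ⟪u i, z - x i - a i⟫ = 0 := fun i => by
    have := hu i
    rw [Submodule.mem_orthogonal'] at this
    exact this _ (vsub_mem_vectorSpan ℝ (hz i) (ha i))
  have h2 := Finset.sum_congr rfl fun i (_ : i ∈ Finset.univ) => h1 i
  simp only [inner_sub_right, Finset.sum_sub_distrib, Finset.sum_const_zero, ← sum_inner, hsum,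
    inner_zero_left] at h2
  rw [Fin.sum_univ_succAbove (fun i => ⟪u i, x i⟫) i₀] at h2
  simp only [hx, Fin.insertNth_apply_same, inner_zero_right, Fin.insertNth_apply_succAbove] at h2
  rw [mem_ofPred_eq]
  linarith

/-- There are only finitely many tuples of faces, and each dependent one excludes a null set. -/
theorem ae_isGeneric (P : Fin (n + 1) → Polytope d) (i₀ : Fin (n + 1)) :
    ∀ᵐ y : Fin n → Eucl d, IsGeneric P (i₀.insertNth (α := fun _ => Eucl d) 0 y) := by
  have hfin : (Set.pi univ fun i => {F | IsExposed ℝ (P i : Set (Eucl d)) F}).Finite :=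
    Set.Finite.pi fun i => (P i).isPolytopal.finite_isExposed
  have : ∀ᵐ y : Fin n → Eucl d, ∀ F ∈ Set.pi univ fun i => {F | IsExposed ℝ (P i : Set (Eucl d)) F},
      subspaceDet (fun i => vectorSpan ℝ (F i)) = 0 →
        ¬ ∃ z, ∀ i, z - i₀.insertNth (α := fun _ => Eucl d) 0 y i ∈ F i := by
    rw [ae_ball_iff hfin.countable]
    intro F _
    by_cases h : subspaceDet (fun i => vectorSpan ℝ (F i)) = 0
    · filter_upwards [measure_eq_zero_iff_ae_notMem.1 (volume_translates_inter_eq_zero h i₀)]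
        with y hy _ using hy
    · exact Filter.Eventually.of_forall fun y h' => absurd h' h
  filter_upwards [this] with y hy z hz h0
  exact hy _ (fun i _ => (P i).isPolytopal.isExposed_minFace (hz i)) h0
    ⟨z, fun i => mem_minFace_self (hz i)⟩

theorem integral_sectionVol {m : Fin (n + 1) → ℕ} {P : Fin (n + 1) → Polytope d}
    (F : ∀ i, Face (m i) (P i)) {A : Fin (n + 1) → Set (Eucl d)} (hA : ∀ i, MeasurableSet (A i))
    (i₀ : Fin (n + 1)) :
    Integrable (fun y : Fin n → Eucl d =>
      sectionVol F A (i₀.insertNth (α := fun _ => Eucl d) 0 y)) ∧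
    ∫ y : Fin n → Eucl d, sectionVol F A (i₀.insertNth (α := fun _ => Eucl d) 0 y) =
      faceDet (fun i => (F i : Set (Eucl d))) * ∏ i, (F i).lebesgue.real (A i) := by
  rw [faceDet_eq]
  by_cases hL : subspaceDet (fun i => vectorSpan ℝ (F i : Set (Eucl d))) ≠ 0
  swap
  -- For a vanishing determinant both sides are 0, by the default value in `sectionVol`.
  · have h0 : ∀ x, sectionVol F A x = 0 := fun x => by rw [sectionVol, dif_neg hL]
    simp only [h0]
    rw [not_not] at hL
    simp [hL]
  have hC : ∀ i, MeasurableSet (A i ∩ intrinsicInterior ℝ (F i : Set (Eucl d))) := fun i =>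
    (hA i).inter (F i).measurableSet_intrinsicInterior
  have h1 := lintegral_sectionMeasure hL (fun i => (F i).nonempty.some) hC i₀
  have h2 : ∀ i, flatMeasure (vectorSpan ℝ (F i : Set (Eucl d))) (F i).nonempty.some
      (A i ∩ intrinsicInterior ℝ (F i : Set (Eucl d))) = (F i).lebesgue (A i) := fun i =>
    ((F i).lebesgue_apply (F i).nonempty.some_mem (hA i)).symm
  simp only [h2] at h1
  have hfin : ENNReal.ofReal (subspaceDet fun i => vectorSpan ℝ (F i : Set (Eucl d))) *
      ∏ i, (F i).lebesgue (A i) ≠ ⊤ :=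
    ENNReal.mul_ne_top ENNReal.ofReal_ne_top (ENNReal.prod_ne_top fun i _ => measure_ne_top _ _)
  have hm : Measurable fun y : Fin n → Eucl d =>
      sectionMeasure hL (fun i => (F i).nonempty.some)
        (fun i => A i ∩ intrinsicInterior ℝ (F i : Set (Eucl d)))
        (i₀.insertNth (α := fun _ => Eucl d) 0 y) :=
    (measurable_sectionMeasure hL _ hC).comp
      ((MeasurableEquiv.piFinSuccAbove (fun _ : Fin (n + 1) => Eucl d) i₀).symm.measurable.comp
        measurable_prodMk_left)
  have he : ∀ x, sectionVol F A x = (sectionMeasure hL (fun i => (F i).nonempty.some)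
        (fun i => A i ∩ intrinsicInterior ℝ (F i : Set (Eucl d))) x).toReal := fun x => by
    rw [sectionVol, dif_pos hL]
  simp only [he]
  refine ⟨integrable_toReal_of_lintegral_ne_top hm.aemeasurable (h1 ▸ hfin), ?_⟩
  rw [integral_toReal hm.aemeasurable (ae_lt_top hm (h1 ▸ hfin)), h1, ENNReal.toReal_mul,
    ENNReal.toReal_ofReal (subspaceDet_pos hL).le, ENNReal.toReal_prod]
  rfl

/-- The translative integral formula for kernels. -/
theorem IsAssociatedFunction.integral_evalAt {j : ℕ}
    {Φ : Polytope d → SignedMeasure (Eucl d)} {f : Set (Eucl d) → ℝ}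
    (hf : IsAssociatedFunction j Φ f) (P : Fin (n + 1) → Polytope d) {A : Fin (n + 1) → Set (Eucl d)}
    (hA : ∀ i, MeasurableSet (A i)) (i₀ : Fin (n + 1)) :
    Integrable (fun y : Fin n → Eucl d =>
      evalAt (fun K => Φ K (⋂ i, i₀.insertNth (α := fun _ => Eucl d) 0 y i +ᵥ A i))
        (⋂ i, i₀.insertNth (α := fun _ => Eucl d) 0 y i +ᵥ (P i : Set (Eucl d)))) ∧
    ∫ y : Fin n → Eucl d,
      evalAt (fun K => Φ K (⋂ i, i₀.insertNth (α := fun _ => Eucl d) 0 y i +ᵥ A i))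
        (⋂ i, i₀.insertNth (α := fun _ => Eucl d) 0 y i +ᵥ (P i : Set (Eucl d))) =
      ∑ m ∈ mixedIndices d (n + 1) j, ∑ F : ((i : Fin (n + 1)) → Face (m i) (P i)),
        f (mixedNormals (fun i => (P i : Set (Eucl d))) (fun i => (F i : Set (Eucl d)))) *
          faceDet (fun i => (F i : Set (Eucl d))) * ∏ i, (F i).lebesgue.real (A i) := by
  have hae := (ae_isGeneric P i₀).mono fun y hy => hf.evalAt_iInter P hA hy
  have hint : ∀ (m : Fin (n + 1) → ℕ) (F : ∀ i, Face (m i) (P i)),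
      Integrable fun y : Fin n → Eucl d =>
        f (mixedNormals (fun i => (P i : Set (Eucl d))) (fun i => (F i : Set (Eucl d)))) *
        sectionVol F A (i₀.insertNth (α := fun _ => Eucl d) 0 y) := fun m F =>
    (integral_sectionVol F hA i₀).1.const_mul _
  constructor
  · rw [integrable_congr hae]
    exact integrable_finsetSum _ fun m _ => integrable_finsetSum _ fun F _ => hint m F
  · rw [integral_congr_ae hae, integral_finsetSum _ fun m _ =>
      integrable_finsetSum _ fun F _ => hint m F]
    refine Finset.sum_congr rfl fun m _ => ?_
    rw [integral_finsetSum _ fun F _ => hint m F]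
    refine Finset.sum_congr rfl fun F _ => ?_
    rw [integral_const_mul, (integral_sectionVol F hA i₀).2, mul_assoc]

end PolytopeIntegral

end

noncomputable section

namespace PolytopeIntegral

variable {d n : ℕ}

/-! ### Measurability of intersections -/

instance : SecondCountableTopology (Polytope d) :=
  inferInstanceAs (SecondCountableTopology
    {K : TopologicalSpace.NonemptyCompacts (Eucl d) //
      ∃ S : Set (Eucl d), S.Finite ∧ (K : Set (Eucl d)) = convexHull ℝ S})

instance : BorelSpace (Polytope d) := ⟨rfl⟩

/-- The Hausdorff metric induces the Vietoris topology, which supplies a subbasis of hit and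
containment conditions for testing measurability. -/
theorem Polytope.topology_eq_generateFrom :
    (inferInstance : TopologicalSpace (Polytope d)) = .generateFrom
      ((fun U : Set (Eucl d) => {P : Polytope d | (P : Set (Eucl d)) ⊆ U}) '' {U | IsOpen U} ∪
        (fun U : Set (Eucl d) => {P : Polytope d | ((P : Set (Eucl d)) ∩ U).Nonempty}) ''
          {U | IsOpen U}) := by
  have h : (inferInstance : TopologicalSpace (Polytope d)) =
      TopologicalSpace.induced (Polytope.carrier) (TopologicalSpace.vietoris (Eucl d)) :=
    (induced_compose (f := Subtype.val) (g := fun K : TopologicalSpace.NonemptyCompacts (Eucl d) => (K : Set (Eucl d)))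
      (tγ := TopologicalSpace.vietoris (Eucl d)))
  rw [h, TopologicalSpace.vietoris, induced_generateFrom_eq, image_union, image_image, image_image]
  rfl

/-- A map to the space of polytopes is measurable if the preimages of the sets of polytopes that hit
a given compact set are measurable. -/
theorem Polytope.measurable_of_isCompact {X : Type*} [MeasurableSpace X] {T : X → Polytope d}
    (hT : ∀ C : Set (Eucl d), IsCompact C → MeasurableSet {x | ((T x : Set (Eucl d)) ∩ C).Nonempty}) :
    Measurable T := by
  have hclosed : ∀ C : Set (Eucl d), IsClosed C →
      MeasurableSet {x | ((T x : Set (Eucl d)) ∩ C).Nonempty} := by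
    intro C hC
    have : {x | ((T x : Set (Eucl d)) ∩ C).Nonempty} =
        ⋃ i, {x | ((T x : Set (Eucl d)) ∩ (compactCovering (Eucl d) i ∩ C)).Nonempty} := by
      ext x
      simp only [mem_ofPred_eq, mem_iUnion]
      constructor
      · rintro ⟨z, hz, hzC⟩
        obtain ⟨i, hi⟩ := exists_mem_compactCovering z
        exact ⟨i, z, hz, hi, hzC⟩
      · rintro ⟨i, z, hz, -, hzC⟩
        exact ⟨z, hz, hzC⟩
    rw [this]
    exact MeasurableSet.iUnion fun i => hT _ ((isCompact_compactCovering _ i).inter_right hC)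
  have hm : (inferInstance : MeasurableSpace (Polytope d)) = _ :=
    borel_eq_generateFrom_of_subbasis (α := Polytope d) Polytope.topology_eq_generateFrom
  refine @measurable_generateFrom _ _ _ _ _ ?_ |>.mono le_rfl hm.le
  rintro _ (⟨U, hU, rfl⟩ | ⟨U, hU, rfl⟩)
  · have : T ⁻¹' {P : Polytope d | (P : Set (Eucl d)) ⊆ U} =
        {x | ((T x : Set (Eucl d)) ∩ Uᶜ).Nonempty}ᶜ := by
      ext x
      simp only [mem_preimage, mem_ofPred_eq, mem_compl_iff, inter_compl_nonempty_iff, not_not]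
    rw [this]
    exact (hclosed _ (IsOpen.isClosed_compl hU)).compl
  -- An open set is a countable union of closed sets, so hitting it reduces to the closed case.
  · obtain ⟨C, hC, -, hCU, -⟩ := IsOpen.exists_iUnion_isClosed (U := U) hU
    have : T ⁻¹' {P : Polytope d | ((P : Set (Eucl d)) ∩ U).Nonempty} =
        ⋃ i, {x | ((T x : Set (Eucl d)) ∩ C i).Nonempty} := by
      ext x
      simp only [mem_preimage, mem_ofPred_eq, mem_iUnion, ← hCU, inter_iUnion, nonempty_iUnion]
    rw [this]
    exact MeasurableSet.iUnion fun i => hclosed _ (hC i)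

/-- A point outside the compact polytope is separated from it by disjoint open sets, and containment
in an open set is an open condition on polytopes. -/
theorem Polytope.isClosed_mem :
    IsClosed {r : Eucl d × Polytope d | r.1 ∈ (r.2 : Set (Eucl d))} := by
  rw [← isOpen_compl_iff, isOpen_iff_mem_nhds]
  rintro ⟨z, K⟩ hz
  have hz : z ∉ (K : Set (Eucl d)) := hz
  obtain ⟨U, V, hU, hV, hzU, hKV, hUV⟩ := (SeparatedNhds.of_isCompact_isCompact
    (isCompact_singleton (x := z)) K.isCompact (disjoint_singleton_left.2 hz))
  have hVo : IsOpen {P : Polytope d | (P : Set (Eucl d)) ⊆ V} := by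
    have h := TopologicalSpace.isOpen_generateFrom_of_mem
      (mem_union_left ((fun U : Set (Eucl d) => {P : Polytope d | ((P : Set (Eucl d)) ∩ U).Nonempty}) ''
        {U | IsOpen U}) (mem_image_of_mem
        (fun U : Set (Eucl d) => {P : Polytope d | (P : Set (Eucl d)) ⊆ U}) (show V ∈ {U | IsOpen U} from hV)))
    rw [← Polytope.topology_eq_generateFrom] at h
    exact h
  filter_upwards [(hU.prod hVo).mem_nhds ⟨hzU rfl, hKV⟩] with r hr hr'
  exact hUV.notMem_of_mem_left hr.1 (hr.2 hr')

/-- The set is the projection along the compact factor `C` of a closed incidence relation. -/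
theorem isClosed_hits (Q : Fin n → Polytope d) {C : Set (Eucl d)} (hC : IsCompact C) :
    IsClosed {r : Polytope d × (Fin n → Eucl d) |
      (((r.1 : Set (Eucl d)) ∩ ⋂ l, r.2 l +ᵥ (Q l : Set (Eucl d))) ∩ C).Nonempty} := by
  have : CompactSpace C := isCompact_iff_compactSpace.1 hC
  have h1 : IsClosed {s : (Polytope d × (Fin n → Eucl d)) × C |
      (s.2 : Eucl d) ∈ (s.1.1 : Set (Eucl d)) ∧ ∀ l, (s.2 : Eucl d) - s.1.2 l ∈ (Q l : Set (Eucl d))} := by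
    refine IsClosed.and ?_ ?_
    · exact Polytope.isClosed_mem.preimage ((continuous_subtype_val.comp continuous_snd).prodMk
        (continuous_fst.comp continuous_fst))
    · simp only [ofPred_forall]
      exact isClosed_iInter fun l => (Q l).isCompact.isClosed.preimage (by fun_prop)
  have h2 := isClosedMap_fst_of_compactSpace (X := Polytope d × (Fin n → Eucl d)) (Y := C) _ h1
  convert h2 using 1
  ext r
  simp only [mem_ofPred_eq, mem_image, Prod.exists, exists_and_right, exists_eq_right]
  constructor
  · rintro ⟨z, ⟨hz, hzQ⟩, hzC⟩
    exact ⟨⟨z, hzC⟩, hz, fun l => mem_vadd_set_iff_sub_mem.1 (mem_iInter.1 hzQ l)⟩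
  · rintro ⟨z, hz, hzQ⟩
    exact ⟨z, ⟨hz, mem_iInter.2 fun l => mem_vadd_set_iff_sub_mem.2 (hzQ l)⟩, z.2⟩

theorem isPolytopal_inter_translates (K : Polytope d) (Q : Fin n → Polytope d)
    (y : Fin n → Eucl d) :
    IsPolytopal ((K : Set (Eucl d)) ∩ ⋂ l, y l +ᵥ (Q l : Set (Eucl d))) := by
  have h : (K : Set (Eucl d)) ∩ ⋂ l, y l +ᵥ (Q l : Set (Eucl d)) =
      ⋂ o : Option (Fin n), o.elim (K : Set (Eucl d)) fun l => y l +ᵥ (Q l : Set (Eucl d)) := by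
    rw [iInter_option]
    rfl
  rw [h]
  refine IsPolytopal.iInter fun o => ?_
  cases o with
  | none => exact K.isPolytopal
  | some l => exact (Q l).isPolytopal.vadd _

/-- Where the intersection is nonempty it depends measurably on the data, because its hitting sets
for compact sets are closed; elsewhere the value is 0. A fixed polytope `K₀` completes the map where
the intersection is empty. -/
theorem measurable_evalAt_inter {ψ : Polytope d → ℝ} (hψ : Measurable ψ) (Q : Fin n → Polytope d) :
    Measurable fun r : Polytope d × (Fin n → Eucl d) =>
      evalAt ψ ((r.1 : Set (Eucl d)) ∩ ⋂ l, r.2 l +ᵥ (Q l : Set (Eucl d))) := by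
  classical
  let S : Polytope d × (Fin n → Eucl d) → Set (Eucl d) := fun r =>
    (r.1 : Set (Eucl d)) ∩ ⋂ l, r.2 l +ᵥ (Q l : Set (Eucl d))
  have hS : ∀ r, IsPolytopal (S r) := fun r => isPolytopal_inter_translates r.1 Q r.2
  have hD : MeasurableSet {r | (S r).Nonempty} := by
    have : {r | (S r).Nonempty} = ⋃ i, {r | (S r ∩ compactCovering (Eucl d) i).Nonempty} := by
      ext r
      simp only [mem_ofPred_eq, mem_iUnion, ← nonempty_iUnion, ← inter_iUnion,
        iUnion_compactCovering, inter_univ]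
    rw [this]
    exact MeasurableSet.iUnion fun i => (isClosed_hits Q (isCompact_compactCovering _ i)).measurableSet
  have hne : Nonempty (Polytope d) :=
    ⟨Polytope.mk' {0} ⟨{0}, finite_singleton 0, (convexHull_singleton 0).symm⟩ (singleton_nonempty 0)⟩
  obtain ⟨K₀⟩ := hne
  let T : Polytope d × (Fin n → Eucl d) → Polytope d := fun r =>
    if h : (S r).Nonempty then Polytope.mk' (S r) (hS r) h else K₀
  have hT : Measurable T := by
    refine Polytope.measurable_of_isCompact fun C hC => ?_
    have : {r | ((T r : Set (Eucl d)) ∩ C).Nonempty} =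
        {r | (S r ∩ C).Nonempty} ∪ ({r | (S r).Nonempty}ᶜ ∩ {_r | ((K₀ : Set (Eucl d)) ∩ C).Nonempty}) := by
      ext r
      simp only [mem_ofPred_eq, mem_union, mem_inter_iff, mem_compl_iff]
      by_cases h : (S r).Nonempty
      · simp only [T, dif_pos h, Polytope.coe_mk', h, not_true_eq_false, false_and, or_false]
      · simp only [T, dif_neg h, h, not_false_eq_true, true_and]
        rw [not_nonempty_iff_eq_empty.1 h]
        simp
    rw [this]
    exact (isClosed_hits Q hC).measurableSet.union (hD.compl.inter (MeasurableSet.const _))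
  have : (fun r : Polytope d × (Fin n → Eucl d) => evalAt ψ (S r)) =
      fun r => if r ∈ {r | (S r).Nonempty} then ψ (T r) else 0 := by
    ext1 r
    by_cases h : (S r).Nonempty
    · rw [if_pos (show r ∈ {r | (S r).Nonempty} from h), ← evalAt_coe ψ]
      simp only [T, dif_pos h, Polytope.coe_mk']
    · rw [if_neg (show r ∉ {r | (S r).Nonempty} from h), not_nonempty_iff_eq_empty.1 h, evalAt_empty]
  exact this ▸ Measurable.ite hD (hψ.comp hT) measurable_const

/-! ### Properties of values at polytopal sets -/

namespace IsLocalExtension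

variable {φ : Polytope d → ℝ} {Φ : Polytope d → SignedMeasure (Eucl d)}

theorem evalAt_vadd (h : IsLocalExtension φ Φ) (x : Eucl d) {S A : Set (Eucl d)}
    (hS : IsPolytopal S) (hA : MeasurableSet A) :
    evalAt (fun K => Φ K (x +ᵥ A)) (x +ᵥ S) = evalAt (fun K => Φ K A) S := by
  rcases S.eq_empty_or_nonempty with rfl | hne
  · rw [vadd_set_empty, evalAt_empty, evalAt_empty]
  · have := evalAt_coe (fun K => Φ K (x +ᵥ A)) ((Polytope.mk' S hS hne).translate x)
    rw [Polytope.coe_translate, Polytope.coe_mk'] at this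
    rw [this, h.covariant _ _ _ hA, ← evalAt_coe (fun K => Φ K A), Polytope.coe_mk']

/-- Beyond local determination this covers the case that one set is empty: the other one then misses
`U`, and the measure vanishes off the polytope. -/
theorem evalAt_congr (h : IsLocalExtension φ Φ) {S S' A U : Set (Eucl d)}
    (hS : IsPolytopal S) (hS' : IsPolytopal S') (hA : MeasurableSet A) (hU : IsOpen U) (hAU : A ⊆ U)
    (hSU : S ∩ U = S' ∩ U) :
    evalAt (fun K => Φ K A) S = evalAt (fun K => Φ K A) S' := by
  have key : ∀ (T : Set (Eucl d)) (hT : IsPolytopal T), T ∩ U = ∅ → evalAt (fun K => Φ K A) T = 0 := by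
    intro T hT he
    rcases T.eq_empty_or_nonempty with rfl | hne
    · exact evalAt_empty _
    · have := evalAt_coe (fun K => Φ K A) (Polytope.mk' T hT hne)
      rw [Polytope.coe_mk'] at this
      rw [this]
      refine h.apply_eq_zero _ hA fun z hz hzT => ?_
      exact (eq_empty_iff_forall_notMem.1 he z) ⟨hzT, hAU hz⟩
  rcases S.eq_empty_or_nonempty with rfl | hne
  · rw [evalAt_empty, key S' hS' (by rw [← hSU, empty_inter])]
  rcases S'.eq_empty_or_nonempty with rfl | hne'
  · rw [evalAt_empty, key S hS (by rw [hSU, empty_inter])]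
  rw [← Polytope.coe_mk' S hS hne, ← Polytope.coe_mk' S' hS' hne', evalAt_coe, evalAt_coe]
  exact h.locallyDetermined _ _ A U hA hU hAU hSU

end IsLocalExtension

end PolytopeIntegral

end

noncomputable section

namespace PolytopeIntegral

variable {d n k : ℕ}

/-! ### Mixed functionals -/

/-- The value of the mixed measure at the product of the sets `A i`. -/
def mixedSum (f : Set (Eucl d) → ℝ) (m : Fin k → ℕ) (P : Fin k → Polytope d)
    (A : Fin k → Set (Eucl d)) : ℝ :=
  ∑ F : ((i : Fin k) → Face (m i) (P i)),
    f (mixedNormals (fun i => (P i : Set (Eucl d))) (fun i => (F i : Set (Eucl d)))) *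
      faceDet (fun i => (F i : Set (Eucl d))) * ∏ i, (F i).lebesgue.real (A i)

theorem mixedFunctional_eq_mixedSum (f : Set (Eucl d) → ℝ) (m : Fin k → ℕ)
    (P : Fin k → Polytope d) : mixedFunctional f m P = mixedSum f m P fun _ => univ := rfl

theorem mixedKernel_apply (f : Set (Eucl d) → ℝ) (m : Fin k → ℕ) (P : Fin k → Polytope d)
    (i : Fin k) (K : Polytope d) {A : Set (Eucl d)} (hA : MeasurableSet A) :
    mixedKernel f m P i K A =
      mixedSum f m (Function.update P i K) (Function.update (fun _ => univ) i A) := by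
  have hm : Measurable fun y : Fin k → Eucl d => y i := measurable_pi_apply i
  rw [mixedKernel, VectorMeasure.map_apply _ hm hA, mixedMeasure, signedMeasure_sum_apply, mixedSum]
  refine Finset.sum_congr rfl fun F _ => ?_
  have h : (fun y : Fin k → Eucl d => y i) ⁻¹' A =
      univ.pi (Function.update (fun _ => univ) i A) := by
    ext y
    simp only [mem_preimage, mem_univ_pi]
    constructor
    · intro hy l
      rcases eq_or_ne l i with rfl | hl
      · simpa using hy
      · simp [hl]
    · intro h
      simpa using h i
  rw [smul_apply, Measure.toSignedMeasure_apply_measurable (hm hA), smul_eq_mul, Measure.real, h,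
    Measure.pi_pi, ENNReal.toReal_prod]
  rfl

theorem mixedNormals_dilate {m : Fin k → ℕ} {P : Fin k → Polytope d} (F : ∀ i, Face (m i) (P i))
    {a : Fin k → ℝ} (ha : ∀ i, 0 < a i) :
    mixedNormals (fun i => ((P i).dilate (a i) : Set (Eucl d)))
      (fun i => ((F i).dilate (ha i) : Set (Eucl d))) =
    mixedNormals (fun i => (P i : Set (Eucl d))) (fun i => (F i : Set (Eucl d))) := by
  choose p hp using fun i => (F i).exists_mem_intrinsicInterior
  have hpP : ∀ i, p i ∈ (P i : Set (Eucl d)) := fun i =>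
    (F i).subset (intrinsicInterior_subset (hp i))
  have h1 : (fun i => (F i : Set (Eucl d))) = fun i => minFace (P i : Set (Eucl d)) (p i) :=
    funext fun i => ((F i).minFace_eq (hp i)).symm
  have h2 : (fun i => ((F i).dilate (ha i) : Set (Eucl d))) =
      fun i => minFace ((P i).dilate (a i) : Set (Eucl d)) (a i • p i) := funext fun i => by
    rw [Face.coe_dilate, Polytope.coe_dilate, minFace_smul (ha i), (F i).minFace_eq (hp i)]
  rw [h1, h2, mixedNormals_eq (fun i => (P i).isPolytopal) hpP,
    mixedNormals_eq (fun i => ((P i).dilate (a i)).isPolytopal) fun i => smul_mem_smul_set (hpP i)]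
  simp only [Polytope.coe_dilate, feasibleCone_smul (ha _)]

theorem mixedSum_dilate (f : Set (Eucl d) → ℝ) (m : Fin k → ℕ) (P : Fin k → Polytope d)
    {A : Fin k → Set (Eucl d)} (hA : ∀ i, MeasurableSet (A i)) {a : Fin k → ℝ}
    (ha : ∀ i, 0 < a i) :
    mixedSum f m (fun i => (P i).dilate (a i)) (fun i => a i • A i) =
      (∏ i, a i ^ m i) * mixedSum f m P A := by
  rw [mixedSum, mixedSum, Finset.mul_sum]
  refine ((Equiv.piCongrRight fun i => Equiv.ofBijective _
    (Face.dilate_bijective (j := m i) (P := P i) (ha i))).sum_comp _).symm.trans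
    (Finset.sum_congr rfl fun F _ => ?_)
  simp only [Equiv.piCongrRight_apply, Pi.map_apply, Equiv.ofBijective_apply]
  have h1 : ∏ i, ((F i).dilate (ha i)).lebesgue.real (a i • A i) =
      (∏ i, a i ^ m i) * ∏ i, (F i).lebesgue.real (A i) := by
    rw [← Finset.prod_mul_distrib]
    exact Finset.prod_congr rfl fun i _ => (F i).lebesgue_dilate (ha i) (hA i)
  rw [mixedNormals_dilate, faceDet_eq, h1, faceDet_eq]
  simp only [Face.vectorSpan_dilate]
  ring

theorem isHomogeneous_mixedFunctional (f : Set (Eucl d) → ℝ) (m : Fin k → ℕ)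
    (P : Fin k → Polytope d) (i : Fin k) :
    IsHomogeneous (m i) fun K => mixedFunctional f m (Function.update P i K) := by
  intro a K ha hm
  simp only
  rcases ha.eq_or_lt with rfl | ha
  · have hm : m i ≠ 0 := by simpa using hm
    rw [zero_pow hm, zero_mul]
    refine Finset.sum_eq_zero fun F _ => ?_
    have h0 := Face.isEmpty_dilate_zero (P := K) hm
    have hF := F i
    rw [Function.update_self] at hF
    exact h0.elim hF
  -- Dilating by `a` in position `i` and by 1 elsewhere reduces the claim to simultaneous
  -- dilatation.
  · have hb : ∀ l, 0 < Function.update (fun _ => (1 : ℝ)) i a l := fun l => by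
      rcases eq_or_ne l i with rfl | hl
      · simpa using ha
      · simp [hl]
    have h := mixedSum_dilate f m (Function.update P i K) (A := fun _ => univ)
      (fun _ => MeasurableSet.univ) hb
    simp only [smul_set_univ₀ (hb _).ne'] at h
    rw [mixedFunctional_eq_mixedSum, mixedFunctional_eq_mixedSum]
    convert h using 2
    · ext1 l
      rcases eq_or_ne l i with rfl | hl
      · simp
      · ext1
        simp [hl]
    · rw [Finset.prod_eq_single i]
      · simp
      · intro l _ hl
        simp [hl]
      · simp

/-- Extraction of one mixed functional from a sum by means of dilatations. -/
theorem sum_hWeight_mul_sum_mixedSum (f : Set (Eucl d) → ℝ) {j : ℕ} {m : Fin k → ℕ}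
    (hm : m ∈ mixedIndices d k j) (P : Fin k → Polytope d) {A : Fin k → Set (Eucl d)}
    (hA : ∀ i, MeasurableSet (A i)) :
    ∑ N : Fin k → Fin (d + 1), (∏ i, hWeight d (m i) (N i)) *
      ∑ m' ∈ mixedIndices d k j, mixedSum f m' (fun i => (P i).dilate ((N i : ℝ) + 1))
        (fun i => ((N i : ℝ) + 1) • A i) = mixedSum f m P A := by
  have hle : ∀ m' ∈ mixedIndices d k j, ∀ i, m' i ≤ d := fun m' hm' i =>
    (Finset.mem_Icc.1 (Fintype.mem_piFinset.1 (Finset.mem_filter.1 hm').1 i)).2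
  have h1 : ∀ (N : Fin k → Fin (d + 1)) (m' : Fin k → ℕ),
      mixedSum f m' (fun i => (P i).dilate ((N i : ℝ) + 1)) (fun i => ((N i : ℝ) + 1) • A i) =
      (∏ i, ((N i : ℝ) + 1) ^ m' i) * mixedSum f m' P A := fun N m' =>
    mixedSum_dilate f m' P hA fun i => by positivity
  simp only [h1, Finset.mul_sum]
  rw [Finset.sum_comm]
  have h2 : ∀ m' ∈ mixedIndices d k j, ∑ N : Fin k → Fin (d + 1),
      (∏ i, hWeight d (m i) (N i)) * ((∏ i, ((N i : ℝ) + 1) ^ m' i) * mixedSum f m' P A) =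
      if m' = m then mixedSum f m P A else 0 := by
    intro m' hm'
    simp only [← mul_assoc, ← Finset.sum_mul, ← Finset.prod_mul_distrib]
    -- The sum over all factor tuples splits into one-variable sums, each of which is a Kronecker
    -- delta in `m' i` and `m i`.
    have h3 := Finset.prod_univ_sum (fun _ : Fin k => (Finset.univ : Finset (Fin (d + 1))))
      (fun i N => hWeight d (m i) N * ((N : ℝ) + 1) ^ m' i)
    rw [Fintype.piFinset_univ] at h3
    rw [← h3, Finset.prod_congr rfl fun i _ => sum_hWeight (hle m hm i) (hle m' hm' i)]
    split_ifs with h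
    · subst h
      simp
    · obtain ⟨i, hi⟩ := Function.ne_iff.1 h
      rw [Finset.prod_eq_zero (Finset.mem_univ i) (if_neg hi), zero_mul]
  rw [Finset.sum_congr rfl h2, Finset.sum_ite_eq', if_pos hm]

/-- Each integral produces the sum over all index tuples, and separate dilatations of the polytopes
isolate the tuple `m`. The vanishing translation is put in position `i`, so that `A` is not moved
and `K` enters only as the fixed body of the intersection. -/
theorem IsAssociatedFunction.mixedKernel_eq {j : ℕ} {Φ : Polytope d → SignedMeasure (Eucl d)}
    {f : Set (Eucl d) → ℝ} (hf : IsAssociatedFunction j Φ f) {m : Fin (n + 1) → ℕ}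
    (hm : m ∈ mixedIndices d (n + 1) j) (P : Fin (n + 1) → Polytope d) (i : Fin (n + 1))
    (K : Polytope d) {A : Set (Eucl d)} (hA : MeasurableSet A) :
    mixedKernel f m P i K A =
      ∑ N : Fin (n + 1) → Fin (d + 1), (∏ l, hWeight d (m l) (N l)) *
        ∫ y : Fin n → Eucl d, evalAt (fun K' => Φ K' (((N i : ℝ) + 1) • A))
          ((K.dilate ((N i : ℝ) + 1) : Set (Eucl d)) ∩
            ⋂ l, y l +ᵥ ((P (i.succAbove l)).dilate ((N (i.succAbove l) : ℝ) + 1) : Set (Eucl d))) := by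
  have hA' : ∀ l, MeasurableSet (Function.update (fun _ => (univ : Set (Eucl d))) i A l) := by
    intro l
    rcases eq_or_ne l i with rfl | hl
    · simpa using hA
    · simp [hl]
  rw [mixedKernel_apply f m P i K hA, ← sum_hWeight_mul_sum_mixedSum f hm _ hA']
  refine Finset.sum_congr rfl fun N _ => ?_
  congr 1
  have hN : ∀ l, (N l : ℝ) + 1 ≠ 0 := fun l => by positivity
  refine (hf.integral_evalAt (fun l => (Function.update P i K l).dilate ((N l : ℝ) + 1))
    (fun l => (hA' l).const_smul₀ ((N l : ℝ) + 1)) i).2.symm.trans (integral_congr_ae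
    (Filter.Eventually.of_forall fun y => ?_))
  have e1 : (⋂ l, i.insertNth (α := fun _ => Eucl d) 0 y l +ᵥ
      (((N l : ℝ) + 1) • Function.update (fun _ => (univ : Set (Eucl d))) i A l)) =
      ((N i : ℝ) + 1) • A := by
    ext z
    simp [mem_iInter, Fin.forall_iff_succAbove i, smul_set_univ₀ (hN _)]
  have e2 : (⋂ l, i.insertNth (α := fun _ => Eucl d) 0 y l +ᵥ
      ((Function.update P i K l).dilate ((N l : ℝ) + 1) : Set (Eucl d))) =
      (K.dilate ((N i : ℝ) + 1) : Set (Eucl d)) ∩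
            ⋂ l, y l +ᵥ ((P (i.succAbove l)).dilate ((N (i.succAbove l) : ℝ) + 1) : Set (Eucl d)) := by
    ext z
    simp only [mem_iInter, Fin.forall_iff_succAbove i, mem_inter_iff, Fin.insertNth_apply_same,
      Fin.insertNth_apply_succAbove, Function.update_self, zero_vadd, ne_eq, Fin.succAbove_ne,
      not_false_eq_true, Function.update_of_ne]
  simp only [e1, e2]

theorem IsLocalExtension.mixedKernel {j : ℕ} {φ : Polytope d → ℝ}
    {Φ : Polytope d → SignedMeasure (Eucl d)} (h : IsLocalExtension φ Φ)
    {f : Set (Eucl d) → ℝ} (hf : IsAssociatedFunction j Φ f) {m : Fin (n + 1) → ℕ}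
    (hm : m ∈ mixedIndices d (n + 1) j) (P : Fin (n + 1) → Polytope d) (i : Fin (n + 1)) :
    IsLocalExtension (fun K => mixedFunctional f m (Function.update P i K))
      (mixedKernel f m P i) where
  measurable A hA := by
    simp only [hf.mixedKernel_eq hm P i _ hA]
    refine Finset.measurable_sum _ fun N _ => Measurable.const_mul ?_ _
    have h1 := measurable_evalAt_inter (h.measurable (((N i : ℝ) + 1) • A) (hA.const_smul₀ _))
      (fun l => (P (i.succAbove l)).dilate ((N (i.succAbove l) : ℝ) + 1))
    have h2 := (h1.stronglyMeasurable.integral_prod_right' (ν := (volume : Measure (Fin n → Eucl d)))).measurable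
    exact h2.comp (Polytope.measurable_dilate _)
  total K := by
    rw [mixedKernel_apply f m P i K MeasurableSet.univ, mixedFunctional_eq_mixedSum,
      Function.update_eq_self_iff.2 rfl]
  covariant K x A hA := by
    rw [hf.mixedKernel_eq hm P i _ hA, hf.mixedKernel_eq hm P i _ (hA.const_vadd x)]
    refine Finset.sum_congr rfl fun N _ => ?_
    congr 1
    set a := (N i : ℝ) + 1
    -- Shifting all the translation variables by `a • x` makes the other polytopes follow the
    -- translate of `K`, so the whole intersection is translated.
    rw [← integral_sub_right_eq_self (fun y : Fin n → Eucl d => evalAt (fun K' => Φ K' (a • A))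
      ((K.dilate a : Set (Eucl d)) ∩ ⋂ l, y l +ᵥ
        ((P (i.succAbove l)).dilate ((N (i.succAbove l) : ℝ) + 1) : Set (Eucl d)))) (fun _ => a • x)]
    refine integral_congr_ae (Filter.Eventually.of_forall fun y => ?_)
    simp only
    rw [← h.evalAt_vadd (a • x) (isPolytopal_inter_translates _ _ _) (hA.const_smul₀ a),
      smul_vadd_set_eq, Polytope.dilate_translate, Polytope.coe_translate]
    congr 1
    ext z
    simp only [mem_vadd_set_iff_sub_mem, mem_inter_iff, mem_iInter, Pi.sub_apply]
    simp only [sub_sub_sub_cancel_right]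
  locallyDetermined K K' A U hA hU hAU hKU := by
    rw [hf.mixedKernel_eq hm P i _ hA, hf.mixedKernel_eq hm P i _ hA]
    refine Finset.sum_congr rfl fun N _ => ?_
    congr 1
    have hN : (N i : ℝ) + 1 ≠ 0 := by positivity
    refine integral_congr_ae (Filter.Eventually.of_forall fun y => ?_)
    refine h.evalAt_congr (U := ((N i : ℝ) + 1) • U) (isPolytopal_inter_translates _ _ _)
      (isPolytopal_inter_translates _ _ _) (hA.const_smul₀ _) (hU.smul₀ hN) (smul_set_mono hAU) ?_
    have e : (K.dilate ((N i : ℝ) + 1) : Set (Eucl d)) ∩ ((N i : ℝ) + 1) • U =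
        (K'.dilate ((N i : ℝ) + 1) : Set (Eucl d)) ∩ ((N i : ℝ) + 1) • U := by
      rw [Polytope.coe_dilate, Polytope.coe_dilate, ← smul_set_inter₀ hN, hKU, smul_set_inter₀ hN]
    rw [inter_right_comm, e, inter_right_comm]

end PolytopeIntegral

end

noncomputable section

namespace PolytopeIntegral

variable {d n k : ℕ}

/-! ### Full-dimensional faces -/

theorem Face.vectorSpan_eq_top {Q : Polytope d} (G : Face d Q) :
    vectorSpan ℝ (G : Set (Eucl d)) = ⊤ :=
  Submodule.eq_top_of_finrank_eq (by rw [G.finrank_vectorSpan]; simp)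

theorem Face.feasibleCone_eq_univ {Q : Polytope d} (G : Face d Q) {p : Eucl d}
    (hp : p ∈ intrinsicInterior ℝ (G : Set (Eucl d))) :
    feasibleCone (Q : Set (Eucl d)) p = univ := by
  have hpQ : p ∈ (Q : Set (Eucl d)) := G.subset (intrinsicInterior_subset hp)
  have h := G.vectorSpan_eq_top
  rw [← G.minFace_eq hp, vectorSpan_minFace Q.isPolytopal.convex hpQ] at h
  refine eq_univ_of_forall fun v => ?_
  have hv : v ∈ lineality Q.isPolytopal.convex hpQ := h ▸ Submodule.mem_top
  exact hv.1

theorem Face.coe_eq_of_finrank_eq {Q : Polytope d} (G : Face d Q) : (G : Set (Eucl d)) = Q := by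
  obtain ⟨p, hp⟩ := G.exists_mem_intrinsicInterior
  refine G.subset.antisymm fun x hx => ?_
  rw [← G.minFace_eq hp]
  have h : p - x ∈ feasibleCone (Q : Set (Eucl d)) p := G.feasibleCone_eq_univ hp ▸ mem_univ _
  exact ⟨hx, h⟩

/-- A `d`-face can only be `Q` itself; if there is none, `Q` lies in a proper affine subspace and
has volume 0. -/
theorem sum_vol_face_top (Q : Polytope d) :
    ∑ G : Face d Q, G.vol = volume.real (Q : Set (Eucl d)) := by
  have hvol : ∀ G : Face d Q, G.vol = volume.real (Q : Set (Eucl d)) := fun G => by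
    obtain ⟨p, hp⟩ := G.nonempty
    rw [Face.vol, Measure.real, Measure.real, G.lebesgue_eq hp, Measure.restrict_apply_univ,
      G.vectorSpan_eq_top, flatMeasure_top, G.coe_eq_of_finrank_eq]
  rcases isEmpty_or_nonempty (Face d Q) with he | ⟨⟨G⟩⟩
  · rw [Finset.univ_eq_empty, Finset.sum_empty]
    have h0 : volume (Q : Set (Eucl d)) = 0 := by
      refine measure_mono_null (subset_affineSpan ℝ _) (Measure.addHaar_affineSubspace volume _ ?_)
      intro h
      refine he.elim ⟨Q, Q.nonempty, IsExposed.refl _, ?_⟩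
      rw [← direction_affineSpan, h, AffineSubspace.direction_top, finrank_top]
      simp
    rw [Measure.real, h0, ENNReal.toReal_zero]
  · have : Subsingleton (Face d Q) := ⟨fun G G' =>
      Face.ext (G.coe_eq_of_finrank_eq.trans G'.coe_eq_of_finrank_eq.symm)⟩
    rw [Fintype.sum_subsingleton _ G, hvol]

/-- Only one subspace has nonzero normals, so the union of the bases is an orthonormal basis of its
complement. -/
theorem subspaceDet_eq_one {L : Fin k → Submodule ℝ (Eucl d)} {i : Fin k}
    (hL : ∀ l ≠ i, L l = ⊤) : subspaceDet L = 1 := by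
  have ho : Orthonormal ℝ (normalBasis L) := by
    have hi : ∀ a : (Σ l, Fin (Module.finrank ℝ ((L l)ᗮ : Submodule ℝ (Eucl d)))), a.1 = i := by
      rintro ⟨l, a⟩
      by_contra h
      have h0 : Module.finrank ℝ ((L l)ᗮ : Submodule ℝ (Eucl d)) = 0 := by
        rw [hL l h, Submodule.top_orthogonal_eq_bot, finrank_bot]
      exact (finCongr h0 a).elim0
    have hs := (stdOrthonormalBasis ℝ ((L i)ᗮ : Submodule ℝ (Eucl d))).orthonormal
    constructor
    · rintro ⟨l, a⟩
      obtain rfl : l = i := hi ⟨l, a⟩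
      exact hs.1 a
    · rintro ⟨l, a⟩ ⟨l', a'⟩ hne
      obtain rfl : l = i := hi ⟨l, a⟩
      obtain rfl : l' = l := hi ⟨l', a'⟩
      exact hs.2 fun h => hne (congrArg _ h)
  have h1 : Matrix.gram ℝ (normalBasis L) = 1 := by
    rw [Matrix.gram_eq_one_iff_orthonormal]
    exact ho
  change Real.sqrt (Matrix.gram ℝ (normalBasis L)).det = 1
  rw [h1, Matrix.det_one, Real.sqrt_one]

/-- At a full-dimensional face the feasible cone is the whole space and drops out of the
intersection of cones. -/
theorem mixedNormals_eq_sphericalNormals {m : Fin k → ℕ} {P : Fin k → Polytope d}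
    (F : ∀ i, Face (m i) (P i)) {i : Fin k} (hm : ∀ l ≠ i, m l = d) :
    mixedNormals (fun i => (P i : Set (Eucl d))) (fun i => (F i : Set (Eucl d))) =
      sphericalNormals (P i) (F i) := by
  choose p hp using fun i => (F i).exists_mem_intrinsicInterior
  have hpP : ∀ i, p i ∈ (P i : Set (Eucl d)) := fun i =>
    (F i).subset (intrinsicInterior_subset (hp i))
  have h1 : (fun i => (F i : Set (Eucl d))) = fun i => minFace (P i : Set (Eucl d)) (p i) :=
    funext fun i => ((F i).minFace_eq (hp i)).symm
  rw [h1, mixedNormals_eq (fun i => (P i).isPolytopal) hpP, ← (F i).minFace_eq (hp i),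
    sphericalNormals_minFace (hpP i)]
  congr 1
  refine (iInter_subset _ i).antisymm (subset_iInter fun l => ?_)
  rcases eq_or_ne l i with rfl | hl
  · exact subset_rfl
  · obtain ⟨G, hG⟩ : ∃ G : Face d (P l), (G : Set (Eucl d)) = F l :=
      ⟨⟨F l, (F l).nonempty, (F l).isExposed, (F l).finrank_vectorSpan.trans (hm l hl)⟩, rfl⟩
    rw [G.feasibleCone_eq_univ (hG ▸ hp l)]
    exact subset_univ _

theorem faceDet_eq_one {m : Fin k → ℕ} {P : Fin k → Polytope d} (F : ∀ i, Face (m i) (P i))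
    {i : Fin k} (hm : ∀ l ≠ i, m l = d) : faceDet (fun i => (F i : Set (Eucl d))) = 1 := by
  rw [faceDet_eq]
  refine subspaceDet_eq_one (i := i) fun l hl => Submodule.eq_top_of_finrank_eq ?_
  rw [(F l).finrank_vectorSpan, hm l hl]
  simp

/-! ### Formulas for the functional itself, and the case of two polytopes. -/

section TwoPolytopes

variable {j : ℕ} {φ : Polytope d → ℝ} {Φ : Polytope d → SignedMeasure (Eucl d)}
  {f : Set (Eucl d) → ℝ}

theorem IsAssociatedFunction.eq_sum (hf : IsAssociatedFunction j Φ f) (h : IsLocalExtension φ Φ)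
    (P : Polytope d) : φ P = ∑ F : Face j P, f (sphericalNormals P F) * F.vol := by
  rw [h.total, hf P]
  exact faceKernel_apply f j P MeasurableSet.univ

/-- The `d`-faces of `Q` change neither normals nor determinant, so the double sum factorizes. -/
theorem IsAssociatedFunction.mixedFunctional_left (hf : IsAssociatedFunction j Φ f)
    (h : IsLocalExtension φ Φ) (P Q : Polytope d) :
    mixedFunctional f ![j, d] ![P, Q] = φ P * volume.real (Q : Set (Eucl d)) := by
  have hm : ∀ l ≠ (0 : Fin 2), ![j, d] l = d := by
    intro l hl
    fin_cases l
    · exact absurd rfl hl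
    · rfl
  rw [mixedFunctional, hf.eq_sum h, ← sum_vol_face_top, Finset.sum_mul_sum,
    ← (piFinTwoEquiv fun i => Face (![j, d] i) (![P, Q] i)).symm.sum_comp, Fintype.sum_prod_type]
  refine Finset.sum_congr rfl fun F _ => Finset.sum_congr rfl fun G _ => ?_
  rw [mixedNormals_eq_sphericalNormals _ hm, faceDet_eq_one _ hm, Fin.prod_univ_two, mul_one,
    mul_assoc]
  rfl

theorem IsAssociatedFunction.mixedFunctional_right (hf : IsAssociatedFunction j Φ f)
    (h : IsLocalExtension φ Φ) (P Q : Polytope d) :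
    mixedFunctional f ![d, j] ![P, Q] = φ Q * volume.real (P : Set (Eucl d)) := by
  have hm : ∀ l ≠ (1 : Fin 2), ![d, j] l = d := by
    intro l hl
    fin_cases l
    · rfl
    · exact absurd rfl hl
  rw [mixedFunctional, hf.eq_sum h, ← sum_vol_face_top, mul_comm, Finset.sum_mul_sum,
    ← (piFinTwoEquiv fun i => Face (![d, j] i) (![P, Q] i)).symm.sum_comp, Fintype.sum_prod_type]
  refine Finset.sum_congr rfl fun F _ => Finset.sum_congr rfl fun G _ => ?_
  rw [mixedNormals_eq_sphericalNormals _ hm, faceDet_eq_one _ hm, Fin.prod_univ_two, mul_one,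
    mul_left_comm]
  rfl

theorem sum_mixedIndices_two (g : (Fin 2 → ℕ) → ℝ) :
    ∑ m ∈ mixedIndices d 2 j, g m = ∑ r ∈ Finset.Icc j d, g ![r, d - r + j] := by
  symm
  refine Finset.sum_bij' (fun r _ => ![r, d - r + j]) (fun m _ => m 0) ?_ ?_ ?_ ?_ ?_
  · intro r hr
    rw [Finset.mem_Icc] at hr
    simp only [mixedIndices, Finset.mem_filter, Fintype.mem_piFinset, Fin.forall_fin_two,
      Fin.sum_univ_two, Finset.mem_Icc, Matrix.cons_val_zero, Matrix.cons_val_one]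
    omega
  · intro m hm
    exact Fintype.mem_piFinset.1 (Finset.mem_filter.1 hm).1 0
  · intro r _
    rfl
  · intro m hm
    simp only [mixedIndices, Finset.mem_filter, Fintype.mem_piFinset, Fin.forall_fin_two,
      Fin.sum_univ_two, Finset.mem_Icc] at hm
    ext l
    fin_cases l
    · rfl
    · change d - m 0 + j = m 1
      omega
  · intro r _
    rfl

/-- The iterated translative formula. -/
theorem IsAssociatedFunction.integral_evalAt_succ (hf : IsAssociatedFunction j Φ f)
    (h : IsLocalExtension φ Φ) (P : Fin (n + 1) → Polytope d) :
    Integrable (fun x : Fin n → Eucl d => evalAt φ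
      ((P 0 : Set (Eucl d)) ∩ ⋂ i : Fin n, x i +ᵥ (P i.succ : Set (Eucl d)))) ∧
    ∫ x : Fin n → Eucl d, evalAt φ
        ((P 0 : Set (Eucl d)) ∩ ⋂ i : Fin n, x i +ᵥ (P i.succ : Set (Eucl d))) =
      ∑ m ∈ mixedIndices d (n + 1) j, mixedFunctional f m P := by
  have h1 := hf.integral_evalAt P (A := fun _ => univ) (fun _ => MeasurableSet.univ) 0
  have e1 : ∀ x : Fin n → Eucl d, (fun K => Φ K (⋂ i,
      (0 : Fin (n + 1)).insertNth (α := fun _ => Eucl d) 0 x i +ᵥ (univ : Set (Eucl d)))) = φ := by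
    intro x
    ext1 K
    simp only [vadd_set_univ, iInter_univ, h.total]
  have e2 : ∀ x : Fin n → Eucl d, (⋂ i,
      (0 : Fin (n + 1)).insertNth (α := fun _ => Eucl d) 0 x i +ᵥ (P i : Set (Eucl d))) =
      (P 0 : Set (Eucl d)) ∩ ⋂ i : Fin n, x i +ᵥ (P i.succ : Set (Eucl d)) := by
    intro x
    ext z
    simp [Fin.forall_fin_succ]
  simp only [e1, e2] at h1
  exact h1

/-- The translative formula for two polytopes. -/
theorem IsAssociatedFunction.integral_evalAt_inter (hf : IsAssociatedFunction j Φ f)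
    (h : IsLocalExtension φ Φ) (P Q : Polytope d) :
    Integrable (fun x : Eucl d => evalAt φ ((P : Set (Eucl d)) ∩ (x +ᵥ (Q : Set (Eucl d))))) ∧
    ∫ x : Eucl d, evalAt φ ((P : Set (Eucl d)) ∩ (x +ᵥ (Q : Set (Eucl d)))) =
      ∑ r ∈ Finset.Icc j d, mixedFunctional f ![r, d - r + j] ![P, Q] := by
  have h1 := hf.integral_evalAt_succ h (n := 1) ![P, Q]
  have hmp := volume_preserving_funUnique (Fin 1) (Eucl d)
  set g : Eucl d → ℝ := fun x => evalAt φ ((P : Set (Eucl d)) ∩ (x +ᵥ (Q : Set (Eucl d)))) with hg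
  have e : (fun x : Fin 1 → Eucl d => evalAt φ ((![P, Q] 0 : Set (Eucl d)) ∩
      ⋂ i : Fin 1, x i +ᵥ (![P, Q] i.succ : Set (Eucl d)))) =
      g ∘ MeasurableEquiv.funUnique (Fin 1) (Eucl d) := by
    ext1 x
    have : (⋂ i : Fin 1, x i +ᵥ (![P, Q] i.succ : Set (Eucl d))) = x 0 +ᵥ (Q : Set (Eucl d)) := by
      ext z
      simp
    rw [this]
    rfl
  rw [e] at h1
  have h2 := hmp.integral_comp' g
  refine ⟨(hmp.integrable_comp_emb (MeasurableEquiv.measurableEmbedding _)).1 h1.1, ?_⟩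
  rw [← h2, ← sum_mixedIndices_two fun m => mixedFunctional f m ![P, Q], ← h1.2]
  rfl

end TwoPolytopes

end PolytopeIntegral

end

open PolytopeIntegral
theorem corollary5p2 (d : ℕ) (φ : Polytope d → ℝ) (Φ : Polytope d → SignedMeasure (Eucl d))
    (hφ : IsLocalExtension φ Φ) :
    -- the homogeneous parts exist
    (∃ (φpart : ℕ → Polytope d → ℝ) (Φpart : ℕ → Polytope d → SignedMeasure (Eucl d)),
      AreHomogeneousParts φ Φ φpart Φpart) ∧
    ∀ (φpart : ℕ → Polytope d → ℝ) (Φpart : ℕ → Polytope d → SignedMeasure (Eucl d)),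
      AreHomogeneousParts φ Φ φpart Φpart → ∀ j ≤ d,
      -- the associated function exists
      (∃ f : Set (Eucl d) → ℝ, IsAssociatedFunction j (Φpart j) f) ∧
      ∀ f : Set (Eucl d) → ℝ, IsAssociatedFunction j (Φpart j) f →
        -- the translative formula for two polytopes
        (∀ P Q : Polytope d,
          Integrable (fun x : Eucl d =>
            evalAt (φpart j) ((P : Set (Eucl d)) ∩ (x +ᵥ (Q : Set (Eucl d))))) ∧
          (j < d →
            ∫ x : Eucl d, evalAt (φpart j) ((P : Set (Eucl d)) ∩ (x +ᵥ (Q : Set (Eucl d)))) =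
              φpart j P * volume.real (Q : Set (Eucl d)) +
              ∑ m ∈ Finset.Ioo j d, mixedFunctional f ![m, d - m + j] ![P, Q] +
              φpart j Q * volume.real (P : Set (Eucl d))) ∧
          (j = d →
            ∫ x : Eucl d, evalAt (φpart j) ((P : Set (Eucl d)) ∩ (x +ᵥ (Q : Set (Eucl d)))) =
              φpart j P * volume.real (Q : Set (Eucl d)))) ∧
        -- the iterated formula for `k = n + 1 ≥ 2` polytopes
        (∀ n : ℕ, 1 ≤ n → ∀ P : Fin (n + 1) → Polytope d,
          Integrable (fun x : Fin n → Eucl d =>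
            evalAt (φpart j)
              ((P 0 : Set (Eucl d)) ∩ ⋂ i : Fin n, x i +ᵥ (P i.succ : Set (Eucl d)))) ∧
          ∫ x : Fin n → Eucl d,
              evalAt (φpart j)
                ((P 0 : Set (Eucl d)) ∩ ⋂ i : Fin n, x i +ᵥ (P i.succ : Set (Eucl d))) =
            ∑ m ∈ mixedIndices d (n + 1) j, mixedFunctional f m P) ∧
        -- homogeneity and locality of the mixed functionals in every argument
        (∀ k : ℕ, 2 ≤ k → ∀ m ∈ mixedIndices d k j, ∀ (P : Fin k → Polytope d) (i : Fin k),
          IsHomogeneous (m i) (fun K => mixedFunctional f m (Function.update P i K)) ∧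
          IsLocalExtension (fun K => mixedFunctional f m (Function.update P i K))
            (mixedKernel f m P i)) := by
  refine ⟨⟨_, _, hφ.areHomogeneousParts⟩, fun φpart Φpart hparts j hj => ⟨⟨_,
    (hparts.localExtension j hj).isAssociatedFunction hj (hparts.homogeneous_kernel j hj)⟩,
    fun f hf => ?_⟩⟩
  have h := hparts.localExtension j hj
  refine ⟨fun P Q => ?_, fun n _ P => hf.integral_evalAt_succ h P, fun k hk m hm P i => ?_⟩
  · obtain ⟨hint, hval⟩ := hf.integral_evalAt_inter h P Q
    refine ⟨hint, fun hlt => ?_, fun he => ?_⟩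
    -- The indices `d` and `j` are split off; for `j < d` they are distinct and give the two terms
    -- with volumes.
    · rw [hval, ← Finset.Ico_insert_right hj, Finset.sum_insert Finset.right_notMem_Ico,
        ← Finset.Ioo_insert_left hlt, Finset.sum_insert Finset.left_notMem_Ioo,
        Nat.sub_add_cancel hj, Nat.sub_self, zero_add, hf.mixedFunctional_left h,
        hf.mixedFunctional_right h]
      ring
    -- For `j = d` the two extreme indices coincide, so only one term remains.
    · subst he
      rw [hval, Finset.Icc_self, Finset.sum_singleton, Nat.sub_self, zero_add,
        hf.mixedFunctional_left h]
  · obtain ⟨n, rfl⟩ := Nat.exists_eq_add_of_le' (Nat.le_of_succ_le hk)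
    exact ⟨isHomogeneous_mixedFunctional f m P i, h.mixedKernel hf hm P i⟩
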